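/- For $\tau$ in the upper half plane $\mathbb{H}$ and $q=e^{2\pi i\tau}$, $q^{1/4}=e^{2\pi i\tau/4}$, let $$X(\tau)=q^{1/4}\prod_{m=1}^{\infty}\frac{(1-q^{6m-1})(1-q^{6m-5})}{(1-q^{6m-2})(1-q^{6m-4})},\qquad w(\tau)=X(\tau)X(3\tau).$$ For each integer $a$ coprime to $6$ fix a matrix $\sigma_a\in\mathrm{SL}_2(\mathbb{Z})$ with $\sigma_a\equiv\begin{bmatrix}a^{-1}&0\\0&a\end{bmatrix}\pmod{18}$. For a positive integer $n$ coprime to $6$ put $\alpha_{a,b}=\sigma_a\begin{bmatrix}a&b\\0&n/a\end{bmatrix}$, acting on $\mathbb{H}$ by linear fractional transformations, and $$\Phi_n(X,\tau)=\prod_{0<a\mid n}\ \prod_{\substack{0\le b<n/a\\ \gcd(a,b,n/a)=1}}\bigl(X-(w\circ\alpha_{a,b})(\tau)\bigr).$$ Let $\psi(n)=n\prod_{p\mid n}(1+1/p)$, the product being over the primes dividing $n$. Then there is exactly one $\Phi_n(X,Y)\in\mathbb{C}(Y)[X]$ with $\Phi_n(X,w(\tau))=\Phi_n(X,\tau)$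 (an identity between polynomials in $X$ whose coefficients are meromorphic functions of $\tau\in\mathbb{H}$), and the following hold. 1. $\Phi_n(X,Y)\in\mathbb{Z}[X,Y]$ and $\deg_X\Phi_n(X,Y)=\deg_Y\Phi_n(X,Y)=\psi(n)$. 2. $\Phi_n(X,Y)$ is irreducible both as a polynomial in $X$ over $\mathbb{C}(Y)$ and as a polynomial in $Y$ over $\mathbb{C}(X)$. 3. If $n>1$, then $\Phi_n(X,Y)=\Phi_n(Y,X)$. 4. (Kronecker congruence relation) If $n=p\ge 5$ is a prime, then $\Phi_p(X,Y)\equiv(X^p-Y)(X-Y^p)\pmod{p\,\mathbb{Z}[X,Y]}$. -/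

import Mathlib

noncomputable section

namespace OrderSix

/-- The order six continued fraction `X(τ)`, through its product expansion
`q^(1/4) ∏_{m ≥ 1} (1 - q^(6m-1)) (1 - q^(6m-5)) / ((1 - q^(6m-2)) (1 - q^(6m-4)))`
with `q = exp (2 π i τ)` and `q^(1/4) = exp (2 π i τ / 4)`, for `0 < Im τ`
(the product is written with `m = k + 1`). -/
def contFracX (τ : ℂ) : ℂ :=
  let q : ℂ := Complex.exp (2 * Real.pi * Complex.I * τ)
  Complex.exp (2 * Real.pi * Complex.I * τ / 4) *
    ∏' k : ℕ, ((1 - q ^ (6 * k + 5)) * (1 - q ^ (6 * k + 1))) /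
      ((1 - q ^ (6 * k + 4)) * (1 - q ^ (6 * k + 2)))

/-- The modular function `w(τ) = X(τ) X(3τ)`, for `0 < Im τ`. -/
def w (τ : ℂ) : ℂ := contFracX τ * contFracX (3 * τ)

/-- The linear fractional transformation attached to an integer matrix. -/
def mobius (M : Matrix (Fin 2) (Fin 2) ℤ) (τ : ℂ) : ℂ :=
  ((M 0 0 : ℂ) * τ + (M 0 1 : ℂ)) / ((M 1 0 : ℂ) * τ + (M 1 1 : ℂ))

/-- `σ` is a choice of matrices `σ_a ∈ SL₂(ℤ)` with `σ_a ≡ diag(a⁻¹, a) (mod 18)`,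
for the integers `a` coprime to `6`. -/
def IsDiagonalLift (σ : ℤ → Matrix.SpecialLinearGroup (Fin 2) ℤ) : Prop :=
  ∀ a : ℤ, IsCoprime a 6 →
    a * (σ a).1 0 0 ≡ 1 [ZMOD 18] ∧ (σ a).1 0 1 ≡ 0 [ZMOD 18] ∧
      (σ a).1 1 0 ≡ 0 [ZMOD 18] ∧ (σ a).1 1 1 ≡ a [ZMOD 18]

/-- The coset representative `α_{a,b} = σ_a [a, b; 0, n/a]` (used for `a ∣ n`). -/
def alpha (σ : ℤ → Matrix.SpecialLinearGroup (Fin 2) ℤ) (n a b : ℕ) :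
    Matrix (Fin 2) (Fin 2) ℤ :=
  (σ (a : ℤ)).1 * !![(a : ℤ), (b : ℤ); 0, ((n / a : ℕ) : ℤ)]

/-- The polynomial `Φ_n(X, τ) = ∏_{0 < a ∣ n} ∏_{0 ≤ b < n/a, gcd(a,b,n/a) = 1}
(X - (w ∘ α_{a,b})(τ))` in `ℂ[X]`. -/
def cosetProduct (σ : ℤ → Matrix.SpecialLinearGroup (Fin 2) ℤ) (n : ℕ) (τ : ℂ) :
    Polynomial ℂ :=
  ∏ a ∈ n.divisors,
    ∏ b ∈ (Finset.range (n / a)).filter (fun b => Nat.gcd a (Nat.gcd b (n / a)) = 1),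
      (Polynomial.X - Polynomial.C (w (mobius (alpha σ n a b) τ)))

/-- `Ψ(X, Y) ∈ ℂ(Y)[X]` satisfies `Ψ(X, w(τ)) = Φ_n(X, τ)` as polynomials in `X` whose
coefficients are meromorphic functions of `τ` in the upper half plane: for each coefficient,
the two functions agree at all `τ` at which the denominator does not vanish. -/
def IsModularPolynomial (σ : ℤ → Matrix.SpecialLinearGroup (Fin 2) ℤ) (n : ℕ)
    (Ψ : Polynomial (RatFunc ℂ)) : Prop :=
  ∀ (i : ℕ) (τ : UpperHalfPlane), (Ψ.coeff i).denom.eval (w (τ : ℂ)) ≠ 0 →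
    (Ψ.coeff i).eval (RingHom.id ℂ) (w (τ : ℂ)) = (cosetProduct σ n (τ : ℂ)).coeff i

/-- `F(X, Y) ∈ ℤ[X, Y]` as a polynomial in `X` over `ℂ(Y)`
(the variables of `F` are `X = X 0` and `Y = X 1`). -/
def asPolyInX (F : MvPolynomial (Fin 2) ℤ) : Polynomial (RatFunc ℂ) :=
  MvPolynomial.aeval ![Polynomial.X, Polynomial.C RatFunc.X] F

/-- `F(X, Y) ∈ ℤ[X, Y]` as a polynomial in `Y` over `ℂ(X)`
(the variables of `F` are `X = X 0` and `Y = X 1`). -/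
def asPolyInY (F : MvPolynomial (Fin 2) ℤ) : Polynomial (RatFunc ℂ) :=
  MvPolynomial.aeval ![Polynomial.C RatFunc.X, Polynomial.X] F

/-- `ψ(n) = n ∏_{p ∣ n} (1 + 1/p)`. -/
def psi (n : ℕ) : ℚ := n * ∏ p ∈ n.primeFactors, (1 + 1 / (p : ℚ))

end OrderSix

end

/-! Put ψ(q) = ∑ q^(n(n+1)/2). Gauss's product for ψ turns the definition of w into w(τ) = q
ψ(q⁹)/ψ(q) with q = exp(2πiτ). So w is holomorphic and nowhere zero on ℍ, with an integral expansion
q + ⋯.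

Everything rests on the invariance of w under Γ₀(18) (`w_smul`). Since w²⁴ is a quotient of values
of Δ at multiples of τ, |w| is invariant, so w ∘ γ = χ w with a constant χ. The same quotient gives
the growth of w at every cusp: w does not vanish at the cusps inequivalent to ∞. To obtain χ = 1,
write w = θ₂(9τ)/θ₂(τ). It tends to 1/3 at the cusp 0 and also, by a comparison of Gauss sums, at
every b/d with d coprime to 6; γ(0) is such a point.

Next, a Γ₀(18)-invariant function with integral q-expansion, dominated by w^m at the cusps other
than ∞, is an integral polynomial in w (`exists_polynomial_of_invariant`). Indeed, subtract a
polynomial in w of degree at most m that matches the expansion up to q^m and divide by w^m: the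
result is a modular form of weight 0 vanishing at ∞.

This applies to the coefficients of ∏ (X - w ∘ α). Γ₀(18) permutes the factors. The expansions in
exp(2πiτ/n) have coefficients in the n-th cyclotomic integers that are fixed by the Galois group,
hence integers. Modulo a prime above p = n the root of unity becomes 1, and Frobenius yields
Kronecker's congruence.

Γ₀(18) is transitive on the factors and these are distinct, so a nonzero relation between w(nτ) and
w(τ) has degree at least their number. Hence Φ is irreducible and divides every relation
(`IsCosetPolynomial.dvd`). The transpose Φ(Y, X) is such a relation, so it equals ±Φ(X, Y); for n >
1 the minus sign would make X - Y a factor. Degree and irreducibility in Y follow, and the factors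
are counted by multiplicativity in n. -/

noncomputable section

namespace OrderSix

/-! ### Gauss's identity, and w as a function of q -/

section

open Filter Topology

/-- The partial products of `∏ (1 - q^(2k)) / (1 - q^(2k-1))`. -/
def psiProd (q : ℂ) (n : ℕ) : ℂ :=
  ∏ k ∈ Finset.range n, (1 - q ^ (2 * k + 2)) / (1 - q ^ (2 * k + 1))

/-- Ramanujan's theta function `ψ(q) = ∑ q^(n(n+1)/2)`. -/
def ramanujanPsi (q : ℂ) : ℂ := ∑' n : ℕ, q ^ (n * (n + 1) / 2)

lemma one_sub_pow_ne_zero {q : ℂ} (hq : ‖q‖ < 1) (n : ℕ) : 1 - q ^ (n + 1) ≠ 0 := by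
  intro h
  have h1 : ‖q ^ (n + 1)‖ = 1 := by rw [← sub_eq_zero.1 h]; simp
  rw [norm_pow] at h1
  exact (pow_lt_one₀ (norm_nonneg q) hq n.succ_ne_zero).ne h1

lemma psiProd_succ (q : ℂ) (n : ℕ) :
    psiProd q (n + 1) = psiProd q n * ((1 - q ^ (2 * n + 2)) / (1 - q ^ (2 * n + 1))) :=
  Finset.prod_range_succ _ _

lemma psiProd_ne_zero {q : ℂ} (hq : ‖q‖ < 1) (n : ℕ) : psiProd q n ≠ 0 :=
  Finset.prod_ne_zero_iff.2 fun k _ => div_ne_zero (one_sub_pow_ne_zero hq (2 * k + 1))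
    (one_sub_pow_ne_zero hq (2 * k))

/-- Shanks' finite form of Gauss's identity. -/
lemma shanks_identity {q : ℂ} (hq : ‖q‖ < 1) (n : ℕ) :
    ∑ s ∈ Finset.range n, psiProd q n / psiProd q s * q ^ (s * (2 * n + 1)) =
      ∑ k ∈ Finset.range (2 * n), q ^ (k * (k + 1) / 2) := by
  induction n with
  | zero => simp
  | succ n ih =>
    have h1 : 1 - q ^ (2 * n + 1) ≠ 0 := one_sub_pow_ne_zero hq (2 * n)
    -- The difference of the summands for n + 1 and for n is itself a difference in s, so the sum
    -- telescopes; the boundary term at s = 0 vanishes through 1 - q^0.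
    have key : ∀ s, psiProd q (n + 1) / psiProd q s * q ^ (s * (2 * (n + 1) + 1)) -
        psiProd q n / psiProd q s * q ^ (s * (2 * n + 1)) =
        (psiProd q n / psiProd q (s + 1) * (1 - q ^ (2 * (s + 1))) * q ^ ((s + 1) * (2 * n + 1)))
          / (1 - q ^ (2 * n + 1)) -
        (psiProd q n / psiProd q s * (1 - q ^ (2 * s)) * q ^ (s * (2 * n + 1)))
          / (1 - q ^ (2 * n + 1)) := by
      intro s
      have h2 : 1 - q ^ (2 * s + 1) ≠ 0 := one_sub_pow_ne_zero hq (2 * s)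
      have h3 : 1 - q ^ (2 * s + 2) ≠ 0 := one_sub_pow_ne_zero hq (2 * s + 1)
      have h4 := psiProd_ne_zero hq s
      rw [psiProd_succ, psiProd_succ, show 2 * (s + 1) = 2 * s + 2 by ring]
      field_simp
      ring
    have hsum := Finset.sum_congr rfl fun s (_ : s ∈ Finset.range n) => key s
    rw [Finset.sum_range_sub (fun s => (psiProd q n / psiProd q s * (1 - q ^ (2 * s)) *
      q ^ (s * (2 * n + 1))) / (1 - q ^ (2 * n + 1))), Finset.sum_sub_distrib, ih,
      sub_eq_iff_eq_add] at hsum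
    rw [Finset.sum_range_succ, hsum, show 2 * (n + 1) = 2 * n + 1 + 1 by ring,
      Finset.sum_range_succ, Finset.sum_range_succ]
    have e1 : 2 * n * (2 * n + 1) / 2 = n * (2 * n + 1) := by
      rw [mul_assoc, Nat.mul_div_cancel_left _ two_pos]
    have e2 : (2 * n + 1) * (2 * n + 1 + 1) / 2 = n * (2 * n + 1) + (2 * n + 1) := by
      rw [show (2 * n + 1) * (2 * n + 1 + 1) = 2 * (n * (2 * n + 1) + (2 * n + 1)) by ring,
        Nat.mul_div_cancel_left _ two_pos]
    have h4 := psiProd_ne_zero hq n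
    rw [e1, e2, psiProd_succ]
    simp only [mul_zero, pow_zero, sub_self, zero_mul, zero_div, sub_zero]
    field_simp
    ring

lemma multipliable_one_sub_pow_affine {q : ℂ} (hq : ‖q‖ < 1) {k : ℕ} (hk : 0 < k) (c : ℕ) :
    Multipliable fun n : ℕ => 1 - q ^ (k * n + c + 1) := by
  apply multipliable_one_add_of_summable (f := fun n => -q ^ (k * n + c + 1))
  simp only [norm_neg, norm_pow]
  refine Summable.of_nonneg_of_le (fun _ => by positivity) (fun n => ?_)
    (summable_geometric_of_lt_one (norm_nonneg q) hq)
  exact pow_le_pow_of_le_one (norm_nonneg q) hq.le (by nlinarith)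

lemma tprod_one_sub_pow_affine_ne_zero {q : ℂ} (hq : ‖q‖ < 1) {k : ℕ} (hk : 0 < k) (c : ℕ) :
    ∏' n : ℕ, (1 - q ^ (k * n + c + 1)) ≠ 0 := by
  refine tprod_one_add_ne_zero_of_summable (f := fun n => -q ^ (k * n + c + 1)) ?_ ?_
  · exact fun i => by simpa [sub_eq_add_neg] using one_sub_pow_ne_zero hq (k * i + c)
  · simp only [norm_neg, norm_pow]
    refine Summable.of_nonneg_of_le (fun _ => by positivity) (fun n => ?_)
      (summable_geometric_of_lt_one (norm_nonneg q) hq)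
    exact pow_le_pow_of_le_one (norm_nonneg q) hq.le (by nlinarith)

lemma summable_psi {q : ℂ} (hq : ‖q‖ < 1) : Summable fun n : ℕ => q ^ (n * (n + 1) / 2) := by
  refine Summable.of_norm_bounded (summable_geometric_of_lt_one (norm_nonneg q) hq) fun n => ?_
  rw [norm_pow]
  refine pow_le_pow_of_le_one (norm_nonneg q) hq.le ?_
  rw [Nat.le_div_iff_mul_le two_pos]
  rcases n with _ | n
  · simp
  · nlinarith

/-- Gauss's identity `∏ (1 - q^(2k)) / (1 - q^(2k-1)) = ∑ q^(n(n+1)/2)`. -/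
lemma tendsto_psiProd {q : ℂ} (hq : ‖q‖ < 1) :
    Tendsto (psiProd q) atTop (𝓝 (ramanujanPsi q)) ∧ ramanujanPsi q ≠ 0 := by
  have hp := (multipliable_one_sub_pow_affine hq two_pos 1).hasProd.div₀
    (multipliable_one_sub_pow_affine hq two_pos 0).hasProd
    (tprod_one_sub_pow_affine_ne_zero hq two_pos 0)
  set P : ℂ := (∏' n : ℕ, (1 - q ^ (2 * n + 1 + 1))) / (∏' n : ℕ, (1 - q ^ (2 * n + 0 + 1)))
  have hP0 : P ≠ 0 := div_ne_zero (tprod_one_sub_pow_affine_ne_zero hq two_pos 1)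
    (tprod_one_sub_pow_affine_ne_zero hq two_pos 0)
  have hP : Tendsto (psiProd q) atTop (𝓝 P) := hp.tendsto_prod_nat
  suffices h : ramanujanPsi q = P by rw [h]; exact ⟨hP, hP0⟩
  obtain ⟨C, hC⟩ := hP.norm.bddAbove_range
  obtain ⟨C', hC'⟩ := (hP.inv₀ hP0).norm.bddAbove_range
  have hC0 : 0 ≤ C := (norm_nonneg _).trans (hC ⟨0, rfl⟩)
  have hC'0 : 0 ≤ C' := (norm_nonneg _).trans (hC' ⟨0, rfl⟩)
  -- In `shanks_identity` the term s = 0 is the partial product itself; the other terms carry the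
  -- factor q^(s(2n+1)), and their sum is O(n ‖q‖^n).
  have hsmall : Tendsto (fun n : ℕ => ∑ s ∈ Finset.range n,
      psiProd q (n + 1) / psiProd q (s + 1) * q ^ ((s + 1) * (2 * (n + 1) + 1))) atTop (𝓝 0) := by
    refine squeeze_zero_norm (a := fun n : ℕ => C * C' * (n * ‖q‖ ^ n)) (fun n => ?_) ?_
    · refine (norm_sum_le _ _).trans ?_
      have : ∀ s ∈ Finset.range n, ‖psiProd q (n + 1) / psiProd q (s + 1) *
          q ^ ((s + 1) * (2 * (n + 1) + 1))‖ ≤ C * C' * ‖q‖ ^ n := by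
        intro s _
        rw [norm_mul, div_eq_mul_inv, norm_mul, norm_pow]
        have h1 : ‖psiProd q (n + 1)‖ ≤ C := hC ⟨n + 1, rfl⟩
        have h2 : ‖(psiProd q (s + 1))⁻¹‖ ≤ C' := hC' ⟨s + 1, rfl⟩
        have h3 : ‖q‖ ^ ((s + 1) * (2 * (n + 1) + 1)) ≤ ‖q‖ ^ n :=
          pow_le_pow_of_le_one (norm_nonneg q) hq.le (by nlinarith)
        gcongr
      refine (Finset.sum_le_sum this).trans (le_of_eq ?_)
      simp
      ring
    · simpa using (tendsto_self_mul_const_pow_of_lt_one (norm_nonneg q) hq).const_mul (C * C')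
  have hlim : Tendsto (fun n : ℕ => ∑ k ∈ Finset.range (2 * (n + 1)), q ^ (k * (k + 1) / 2))
      atTop (𝓝 P) := by
    have : (fun n : ℕ => ∑ k ∈ Finset.range (2 * (n + 1)), q ^ (k * (k + 1) / 2)) = fun n =>
        (∑ s ∈ Finset.range n,
          psiProd q (n + 1) / psiProd q (s + 1) * q ^ ((s + 1) * (2 * (n + 1) + 1))) +
        psiProd q (n + 1) := by
      funext n
      rw [← shanks_identity hq, Finset.sum_range_succ']
      simp [psiProd]
    rw [this]
    simpa using hsmall.add ((tendsto_add_atTop_iff_nat 1).2 hP)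
  have hsum := (summable_psi hq).hasSum.tendsto_sum_nat
  have h2 : Tendsto (fun n : ℕ => 2 * (n + 1)) atTop atTop :=
    tendsto_atTop_mono (fun n => by simp only [id]; omega) tendsto_id
  exact tendsto_nhds_unique (hsum.comp h2) hlim

lemma ramanujanPsi_ne_zero {q : ℂ} (hq : ‖q‖ < 1) : ramanujanPsi q ≠ 0 := (tendsto_psiProd hq).2

lemma norm_pow_lt_one {q : ℂ} (hq : ‖q‖ < 1) {k : ℕ} (hk : k ≠ 0) : ‖q ^ k‖ < 1 := by
  rw [norm_pow]; exact pow_lt_one₀ (norm_nonneg q) hq hk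

/-- Already at finite level: n factors on the left are n factors of the product for ψ(q³) divided by
3n factors of the product for ψ(q), since the exponents divisible by 3 cancel. -/
lemma tprod_contFrac {q : ℂ} (hq : ‖q‖ < 1) :
    ∏' k : ℕ, ((1 - q ^ (6 * k + 5)) * (1 - q ^ (6 * k + 1))) /
      ((1 - q ^ (6 * k + 4)) * (1 - q ^ (6 * k + 2))) =
    ramanujanPsi (q ^ 3) / ramanujanPsi q := by
  have h6 : 0 < 6 := by norm_num
  have hp := (((multipliable_one_sub_pow_affine hq h6 4).hasProd.mul
    (multipliable_one_sub_pow_affine hq h6 0).hasProd).div₀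
    ((multipliable_one_sub_pow_affine hq h6 3).hasProd.mul
    (multipliable_one_sub_pow_affine hq h6 1).hasProd)
    (mul_ne_zero (tprod_one_sub_pow_affine_ne_zero hq h6 3)
      (tprod_one_sub_pow_affine_ne_zero hq h6 1))).multipliable.hasProd.tendsto_prod_nat
  have h3 := norm_pow_lt_one hq (k := 3) (by norm_num)
  have hlim := ((tendsto_psiProd h3).1).div
    ((tendsto_psiProd hq).1.comp (tendsto_id.const_mul_atTop' (show 0 < 3 by norm_num)))
    (ramanujanPsi_ne_zero hq)
  refine tendsto_nhds_unique hp (hlim.congr fun n => ?_)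
  simp only [Pi.div_apply, Function.comp, id]
  induction n with
  | zero => simp [psiProd]
  | succ n ih =>
    rw [Finset.prod_range_succ, ← ih, show 3 * (n + 1) = 3 * n + 1 + 1 + 1 by ring,
      psiProd_succ, psiProd_succ, psiProd_succ, psiProd_succ, ← pow_mul, ← pow_mul]
    have e := fun k => one_sub_pow_ne_zero hq k
    have f1 := e (6 * n); have f2 := e (6 * n + 1); have f3 := e (6 * n + 2)
    have f4 := e (6 * n + 3); have f5 := e (6 * n + 4); have f6 := e (6 * n + 5)
    have g1 := psiProd_ne_zero hq (3 * n)
    simp only [add_assoc, Nat.reduceAdd] at f1 f2 f3 f4 f5 f6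
    rw [show 2 * (3 * n) + 2 = 6 * n + 2 by ring, show 2 * (3 * n) + 1 = 6 * n + 1 by ring,
      show 2 * (3 * n + 1) + 2 = 6 * n + 4 by ring, show 2 * (3 * n + 1) + 1 = 6 * n + 3 by ring,
      show 2 * (3 * n + 1 + 1) + 2 = 6 * n + 6 by ring,
      show 2 * (3 * n + 1 + 1) + 1 = 6 * n + 5 by ring,
      show 3 * (2 * n + 2) = 6 * n + 6 by ring, show 3 * (2 * n + 1) = 6 * n + 3 by ring]
    simp only [add_assoc, Nat.reduceAdd]
    field_simp

/-- The function `h` on the unit disc with `w(τ) = h(exp(2πiτ))`. -/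
def hauptDisc (q : ℂ) : ℂ := q * ramanujanPsi (q ^ 9) / ramanujanPsi q

lemma norm_exp_two_pi_lt_one {τ : ℂ} (hτ : 0 < τ.im) :
    ‖Complex.exp (2 * Real.pi * Complex.I * τ)‖ < 1 := by
  rw [Complex.norm_exp]
  simp
  positivity

lemma contFracX_eq {τ : ℂ} (hτ : 0 < τ.im) :
    contFracX τ = Complex.exp (2 * Real.pi * Complex.I * τ / 4) *
      (ramanujanPsi (Complex.exp (2 * Real.pi * Complex.I * τ) ^ 3) /
        ramanujanPsi (Complex.exp (2 * Real.pi * Complex.I * τ))) := by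
  rw [← tprod_contFrac (norm_exp_two_pi_lt_one hτ)]
  rfl

lemma w_eq_hauptDisc {τ : ℂ} (hτ : 0 < τ.im) :
    w τ = hauptDisc (Complex.exp (2 * Real.pi * Complex.I * τ)) := by
  have h3 : 0 < (3 * τ).im := by simpa using hτ
  have hq := norm_exp_two_pi_lt_one hτ
  rw [w, contFracX_eq hτ, contFracX_eq h3, hauptDisc]
  have e3 : Complex.exp (2 * Real.pi * Complex.I * (3 * τ)) =
      Complex.exp (2 * Real.pi * Complex.I * τ) ^ 3 := by
    rw [← Complex.exp_nat_mul]; congr 1; push_cast; ring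
  have e1 : Complex.exp (2 * Real.pi * Complex.I * τ) =
      Complex.exp (2 * Real.pi * Complex.I * τ / 4) *
        Complex.exp (2 * Real.pi * Complex.I * (3 * τ) / 4) := by
    rw [← Complex.exp_add]; congr 1; ring
  rw [e3, ← pow_mul]
  norm_num only
  have g3 := ramanujanPsi_ne_zero (norm_pow_lt_one hq (k := 3) (by norm_num))
  have g1 := ramanujanPsi_ne_zero hq
  rw [show ∀ x y a b c : ℂ, x * (a / b) * (y * (c / a)) = (x * y) * ((a / b) * (c / a)) from
    fun _ _ _ _ _ => by ring, ← e1]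
  field_simp

lemma hauptDisc_ne_zero {q : ℂ} (hq : ‖q‖ < 1) (h0 : q ≠ 0) : hauptDisc q ≠ 0 :=
  div_ne_zero (mul_ne_zero h0 (ramanujanPsi_ne_zero (norm_pow_lt_one hq (by norm_num))))
    (ramanujanPsi_ne_zero hq)

lemma w_ne_zero {τ : ℂ} (hτ : 0 < τ.im) : w τ ≠ 0 := by
  rw [w_eq_hauptDisc hτ]
  exact hauptDisc_ne_zero (norm_exp_two_pi_lt_one hτ) (Complex.exp_ne_zero _)

lemma differentiableOn_ramanujanPsi : DifferentiableOn ℂ ramanujanPsi (Metric.ball 0 1) := by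
  refine DifferentiableOn.congr (f := fun q => ∑' n : ℕ, q ^ (n * (n + 1) / 2)) ?_ fun _ _ => rfl
  intro q hq
  obtain ⟨r, hr, hr1⟩ := exists_between (mem_ball_zero_iff.1 hq)
  have hr0 : 0 ≤ r := (norm_nonneg q).trans hr.le
  refine (DifferentiableOn.differentiableAt (s := Metric.ball 0 r) ?_
    (Metric.isOpen_ball.mem_nhds (mem_ball_zero_iff.2 hr))).differentiableWithinAt
  refine Complex.differentiableOn_tsum_of_summable_norm (u := fun n : ℕ => r ^ n)
    (summable_geometric_of_lt_one hr0 hr1) (fun n => by fun_prop) Metric.isOpen_ball ?_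
  intro n z hz
  rw [norm_pow]
  have hz' : ‖z‖ ≤ r := (mem_ball_zero_iff.1 hz).le
  refine (pow_le_pow_left₀ (norm_nonneg z) hz' _).trans (pow_le_pow_of_le_one hr0 hr1.le ?_)
  rw [Nat.le_div_iff_mul_le two_pos]
  rcases n with _ | n
  · simp
  · nlinarith

lemma differentiableOn_hauptDisc : DifferentiableOn ℂ hauptDisc (Metric.ball 0 1) := by
  refine DifferentiableOn.div (DifferentiableOn.mul differentiableOn_id
    (differentiableOn_ramanujanPsi.comp (by fun_prop) fun q hq => ?_))
    differentiableOn_ramanujanPsi fun q hq => ramanujanPsi_ne_zero (mem_ball_zero_iff.1 hq)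
  exact mem_ball_zero_iff.2 (norm_pow_lt_one (mem_ball_zero_iff.1 hq) (by norm_num))

lemma differentiableOn_w : DifferentiableOn ℂ w {z | 0 < z.im} := by
  refine (differentiableOn_hauptDisc.comp (f := fun τ => Complex.exp (2 * Real.pi * Complex.I * τ))
    (by fun_prop) fun τ hτ => mem_ball_zero_iff.2 (norm_exp_two_pi_lt_one hτ)).congr
    fun τ hτ => w_eq_hauptDisc hτ

end

/-! ### The absolute value of w: invariance and growth at the cusps -/

section

open Filter Topology UpperHalfPlane Asymptotics MatrixGroups
open ModularForm (discriminant eta_q)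

/-- The affine map `τ ↦ (a τ + b) / d` of the upper half plane (for `a, d > 0`). -/
def aff (a b d : ℤ) (τ : ℍ) : ℍ := ofComplex ((a * τ + b) / d)

lemma coe_aff {a d : ℤ} (ha : 0 < a) (hd : 0 < d) (b : ℤ) (τ : ℍ) :
    (aff a b d τ : ℂ) = (a * τ + b) / d := by
  have him : ((a * τ + b : ℂ) / d).im = a * τ.im / d := by
    rw [show (d : ℂ) = ((d : ℝ) : ℂ) by simp, Complex.div_ofReal_im]
    simp
  have hpos : 0 < ((a * τ + b : ℂ) / d).im := by
    rw [him]
    have : (0 : ℝ) < a := by exact_mod_cast ha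
    have : (0 : ℝ) < d := by exact_mod_cast hd
    have := τ.im_pos
    positivity
  rw [aff, ofComplex_apply_of_im_pos hpos]

lemma im_aff {a d : ℤ} (ha : 0 < a) (hd : 0 < d) (b : ℤ) (τ : ℍ) :
    (aff a b d τ).im = a / d * τ.im := by
  rw [← coe_im, coe_aff ha hd, show (d : ℂ) = ((d : ℝ) : ℂ) by simp, Complex.div_ofReal_im]
  simp
  ring

lemma tendsto_aff {a d : ℤ} (ha : 0 < a) (hd : 0 < d) (b : ℤ) :
    Tendsto (aff a b d) atImInfty atImInfty := by
  rw [atImInfty, tendsto_comap_iff]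
  have h1 : (0 : ℝ) < a := by exact_mod_cast ha
  have h2 : (0 : ℝ) < d := by exact_mod_cast hd
  exact (tendsto_comap.const_mul_atTop (div_pos h1 h2)).congr fun τ => (im_aff ha hd b τ).symm

lemma coe_SL_smul (γ : SL(2, ℤ)) (τ : ℍ) :
    ((γ • τ : ℍ) : ℂ) = (γ 0 0 * τ + γ 0 1) / (γ 1 0 * τ + γ 1 1) := by
  rw [coe_specialLinearGroup_apply]
  simp

lemma SL_denom_ne_zero (γ : SL(2, ℤ)) (τ : ℍ) : (γ 1 0 * τ + γ 1 1 : ℂ) ≠ 0 := by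
  have := UpperHalfPlane.denom_ne_zero (γ : GL (Fin 2) ℝ) τ
  simpa [UpperHalfPlane.denom] using this

lemma SL_det (γ : SL(2, ℤ)) : γ 0 0 * γ 1 1 - γ 0 1 * γ 1 0 = 1 := by
  have := γ.det_coe
  rwa [Matrix.det_fin_two] at this

lemma aff_smul {a b d a' b' d' : ℤ} (ha : 0 < a) (hd : 0 < d) (ha' : 0 < a') (hd' : 0 < d')
    {γ γ' : SL(2, ℤ)} (h00 : a * γ 0 0 + b * γ 1 0 = γ' 0 0 * a')
    (h01 : a * γ 0 1 + b * γ 1 1 = γ' 0 0 * b' + γ' 0 1 * d')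
    (h10 : d * γ 1 0 = γ' 1 0 * a') (h11 : d * γ 1 1 = γ' 1 0 * b' + γ' 1 1 * d') (τ : ℍ) :
    aff a b d (γ • τ) = γ' • aff a' b' d' τ := by
  have n1 := SL_denom_ne_zero γ τ
  have n2 := SL_denom_ne_zero γ' (aff a' b' d' τ)
  rw [UpperHalfPlane.ext_iff, coe_aff ha hd, coe_SL_smul, coe_SL_smul]
  rw [coe_aff ha' hd'] at n2 ⊢
  have e : (d : ℂ) ≠ 0 := by exact_mod_cast hd.ne'
  have e' : (d' : ℂ) ≠ 0 := by exact_mod_cast hd'.ne'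
  have k00 : (a * γ 0 0 + b * γ 1 0 : ℂ) = γ' 0 0 * a' := by exact_mod_cast h00
  have k01 : (a * γ 0 1 + b * γ 1 1 : ℂ) = γ' 0 0 * b' + γ' 0 1 * d' := by exact_mod_cast h01
  have k10 : (d * γ 1 0 : ℂ) = γ' 1 0 * a' := by exact_mod_cast h10
  have k11 : (d * γ 1 1 : ℂ) = γ' 1 0 * b' + γ' 1 1 * d' := by exact_mod_cast h11
  have l1 : (a * ((γ 0 0 * τ + γ 0 1) / (γ 1 0 * τ + γ 1 1)) + b : ℂ) / d =
      ((a * γ 0 0 + b * γ 1 0) * τ + (a * γ 0 1 + b * γ 1 1)) /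
        ((d * γ 1 0) * τ + d * γ 1 1) := by
    rw [show (d * γ 1 0 * τ + d * γ 1 1 : ℂ) = d * (γ 1 0 * τ + γ 1 1) by ring,
      show ((a * γ 0 0 + b * γ 1 0) * τ + (a * γ 0 1 + b * γ 1 1) : ℂ) =
        a * (γ 0 0 * τ + γ 0 1) + b * (γ 1 0 * τ + γ 1 1) by ring]
    generalize (γ 1 0 * τ + γ 1 1 : ℂ) = D at n1 ⊢
    field_simp
  have l2 : (γ' 0 0 * ((a' * τ + b') / d') + γ' 0 1 : ℂ) / (γ' 1 0 * ((a' * τ + b') / d') + γ' 1 1)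
      = ((γ' 0 0 * a') * τ + (γ' 0 0 * b' + γ' 0 1 * d')) /
        ((γ' 1 0 * a') * τ + (γ' 1 0 * b' + γ' 1 1 * d')) := by
    rw [← mul_div_mul_left _ _ e']
    congr 1 <;> (field_simp; ring)
  rw [l1, l2, k00, k01, k10, k11]

/-- Hermite normal form: a product of an upper triangular matrix with an element of `SL₂(ℤ)`
is an element of `SL₂(ℤ)` times an upper triangular matrix. -/
lemma exists_hermite {a d : ℤ} (ha : 0 < a) (hd : 0 < d) (b : ℤ) (γ : SL(2, ℤ)) :
    ∃ (γ' : SL(2, ℤ)) (a' b' d' : ℤ), 0 < a' ∧ 0 < d' ∧ 0 ≤ b' ∧ b' < d' ∧ a' * d' = a * d ∧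
      a' = Int.gcd (a * γ 0 0 + b * γ 1 0) (d * γ 1 0) ∧
      a * γ 0 0 + b * γ 1 0 = γ' 0 0 * a' ∧
      a * γ 0 1 + b * γ 1 1 = γ' 0 0 * b' + γ' 0 1 * d' ∧
      d * γ 1 0 = γ' 1 0 * a' ∧ d * γ 1 1 = γ' 1 0 * b' + γ' 1 1 * d' := by
  set x := a * γ 0 0 + b * γ 1 0 with hx
  set z := d * γ 1 0 with hz
  set y := a * γ 0 1 + b * γ 1 1 with hy
  set t := d * γ 1 1 with ht
  have hdet : x * t - y * z = a * d := by
    rw [hx, hz, hy, ht]; linear_combination (a * d) * SL_det γ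
  have hg0 : (Int.gcd x z : ℤ) ≠ 0 := by
    intro h
    have h' := Int.gcd_eq_zero_iff.1 (by exact_mod_cast h : Int.gcd x z = 0)
    rw [h'.1, h'.2] at hdet
    nlinarith [mul_pos ha hd]
  have hg : 0 < (Int.gcd x z : ℤ) := lt_of_le_of_ne (by positivity) hg0.symm
  obtain ⟨x', hx'⟩ := Int.gcd_dvd_left x z
  obtain ⟨z', hz'⟩ := Int.gcd_dvd_right x z
  have hbez := Int.gcd_eq_gcd_ab x z
  set g : ℤ := ((Int.gcd x z : ℕ) : ℤ)
  set u := Int.gcdA x z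
  set v := Int.gcdB x z
  have hbez' : u * x' + v * z' = 1 := by
    have : g * (u * x' + v * z') = g * 1 := by
      linear_combination -u * hx' - v * hz' - hbez
    exact mul_left_cancel₀ hg0 this
  set D := x' * t - z' * y
  have hD : g * D = a * d := by
    rw [← hdet]; linear_combination -t * hx' + y * hz'
  have hDpos : 0 < D := by
    have := mul_pos ha hd
    rw [← hD] at this
    exact (mul_pos_iff_of_pos_left hg).1 this
  -- The primitive column (x', z') is completed to determinant 1 by the Bézout coefficients, which
  -- puts B in the upper right corner. Adding k times this column to the second column of `γ'`
  -- replaces B by B mod D.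
  set B := u * y + v * t
  set k := B / D
  refine ⟨⟨!![x', -v + x' * k; z', u + z' * k], ?_⟩, g, B % D, D, hg, hDpos,
    Int.emod_nonneg _ hDpos.ne', Int.emod_lt_of_pos _ hDpos, hD, rfl, ?_, ?_, ?_, ?_⟩
  · rw [Matrix.det_fin_two_of]
    linear_combination hbez'
  · simp
    linarith
  · have := Int.emod_add_mul_ediv B D
    simp
    simp only [k]
    linear_combination -x' * this + (-y) * hbez'
  · simp
    linarith
  · have := Int.emod_add_mul_ediv B D
    simp
    simp only [k]
    linear_combination -z' * this + (-t) * hbez'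

/-- The `SL₂(ℤ)`-invariant function `|Δ(τ)|² Im(τ)¹²`. -/
def discNorm (τ : ℍ) : ℝ := ‖petersson 12 discriminant discriminant τ‖

lemma discNorm_eq (τ : ℍ) : discNorm τ = ‖discriminant τ‖ ^ 2 * τ.im ^ 12 := by
  have := τ.im_pos
  rw [discNorm, petersson, norm_mul, norm_mul, Complex.norm_conj, norm_zpow, Complex.norm_real,
    Real.norm_of_nonneg this.le, zpow_ofNat]
  ring

lemma discNorm_smul (γ : SL(2, ℤ)) (τ : ℍ) : discNorm (γ • τ) = discNorm τ := by
  rw [discNorm, ← petersson_slash_SL, SlashInvariantForm.slash_action_generators_SL2Z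
    ModularForm.discriminant_S_invariant ModularForm.discriminant_T_invariant γ]
  rfl

lemma discNorm_pos (τ : ℍ) : 0 < discNorm τ := by
  rw [discNorm_eq]
  have := τ.im_pos
  have := norm_pos_iff.2 (ModularForm.discriminant_ne_zero τ)
  positivity

/-- Euler's function. -/
def eulerProd (q : ℂ) : ℂ := ∏' n : ℕ, (1 - q ^ (n + 1))

lemma hasProd_eulerProd {q : ℂ} (hq : ‖q‖ < 1) :
    HasProd (fun n : ℕ => 1 - q ^ (n + 1)) (eulerProd q) :=
  (ModularForm.multipliable_one_sub_pow hq).hasProd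

lemma ramanujanPsi_mul_eulerProd {q : ℂ} (hq : ‖q‖ < 1) :
    ramanujanPsi q * eulerProd q = eulerProd (q ^ 2) ^ 2 := by
  have h2 : Tendsto (fun n : ℕ => 2 * n) atTop atTop :=
    tendsto_atTop_mono (fun n => by simp only [id]; omega) tendsto_id
  have l1 := (tendsto_psiProd hq).1.mul ((hasProd_eulerProd hq).tendsto_prod_nat.comp h2)
  have l2 := (hasProd_eulerProd (norm_pow_lt_one hq (k := 2) two_ne_zero)).tendsto_prod_nat.pow 2
  refine tendsto_nhds_unique l1 (l2.congr fun n => ?_)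
  simp only [Function.comp]
  induction n with
  | zero => simp [psiProd]
  | succ n ih =>
    have := one_sub_pow_ne_zero hq (2 * n)
    rw [Finset.prod_range_succ, mul_pow, ih, psiProd_succ, show 2 * (n + 1) = 2 * n + 1 + 1 by ring,
      Finset.prod_range_succ, Finset.prod_range_succ, ← pow_mul,
      show 2 * (n + 1) = 2 * n + 1 + 1 by ring]
    field_simp

lemma discriminant_eq_eulerProd (τ : ℍ) :
    discriminant τ = Complex.exp (2 * Real.pi * Complex.I * τ) *
      eulerProd (Complex.exp (2 * Real.pi * Complex.I * τ)) ^ 24 := by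
  have hq : ‖Complex.exp (2 * Real.pi * Complex.I * τ)‖ < 1 := norm_exp_two_pi_lt_one τ.im_pos
  rw [ModularForm.discriminant_eq_q_prod, eulerProd,
    ← (ModularForm.multipliable_one_sub_pow hq).tprod_pow]
  simp [Function.Periodic.qParam, eta_q]

lemma discriminant_aff_eq {δ : ℤ} (hδ : 0 < δ) (τ : ℍ) {k : ℕ} (hk : δ = k) :
    discriminant (aff δ 0 1 τ) = Complex.exp (2 * Real.pi * Complex.I * τ) ^ k *
      eulerProd (Complex.exp (2 * Real.pi * Complex.I * τ) ^ k) ^ 24 := by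
  have : Complex.exp (2 * Real.pi * Complex.I * (aff δ 0 1 τ)) =
      Complex.exp (2 * Real.pi * Complex.I * τ) ^ k := by
    rw [coe_aff hδ one_pos, ← Complex.exp_nat_mul]
    congr 1
    rw [hk]
    push_cast
    ring
  rw [discriminant_eq_eulerProd, this]

/-- The 24th power of w = η(τ) η(18τ)² / (η(9τ) η(2τ)²); the power turns η into Δ and so avoids the
multiplier system of η. -/
lemma w_pow_eq (τ : ℍ) : w τ ^ 24 * (discriminant (aff 9 0 1 τ) * discriminant (aff 2 0 1 τ) ^ 2) =
    discriminant (aff 1 0 1 τ) * discriminant (aff 18 0 1 τ) ^ 2 := by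
  have hq := norm_exp_two_pi_lt_one τ.im_pos
  rw [w_eq_hauptDisc τ.im_pos, discriminant_aff_eq (k := 9) (by norm_num) τ (by norm_num),
    discriminant_aff_eq (k := 2) (by norm_num) τ (by norm_num),
    discriminant_aff_eq (k := 1) (by norm_num) τ (by norm_num),
    discriminant_aff_eq (k := 18) (by norm_num) τ (by norm_num), hauptDisc]
  set q := Complex.exp (2 * Real.pi * Complex.I * τ)
  have h1 := ramanujanPsi_mul_eulerProd hq
  have h9 := ramanujanPsi_mul_eulerProd (norm_pow_lt_one hq (k := 9) (by norm_num))
  have n1 := ramanujanPsi_ne_zero hq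
  rw [← pow_mul] at h9
  norm_num only at h9
  rw [div_pow, mul_pow, div_mul_eq_mul_div, div_eq_iff (pow_ne_zero _ n1)]
  calc q ^ 24 * ramanujanPsi (q ^ 9) ^ 24 *
        (q ^ 9 * eulerProd (q ^ 9) ^ 24 * (q ^ 2 * eulerProd (q ^ 2) ^ 24) ^ 2)
      = q ^ 37 * (ramanujanPsi (q ^ 9) * eulerProd (q ^ 9)) ^ 24 * (eulerProd (q ^ 2) ^ 2) ^ 24 := by
        ring
    _ = _ := by rw [h9, ← h1]; ring_nf

/-- Passing to |Δ|² Im¹² expresses |w| through an `SL₂(ℤ)`-invariant function. The powers of Im τ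
cancel and leave 18²⁴ / (9¹² · 2²⁴) = 9¹². -/
lemma norm_w_pow_eq (τ : ℍ) : ‖w τ‖ ^ 48 * 9 ^ 12 =
    discNorm (aff 1 0 1 τ) * discNorm (aff 18 0 1 τ) ^ 2 /
      (discNorm (aff 9 0 1 τ) * discNorm (aff 2 0 1 τ) ^ 2) := by
  have h := congrArg (fun z => ‖z‖ ^ 2) (w_pow_eq τ)
  simp only [norm_mul, norm_pow] at h
  rw [eq_div_iff (mul_pos (discNorm_pos _) (pow_pos (discNorm_pos _) 2)).ne']
  simp only [discNorm_eq]
  rw [im_aff one_pos one_pos, im_aff (by norm_num) one_pos, im_aff (by norm_num) one_pos,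
    im_aff (by norm_num) one_pos]
  push_cast
  linear_combination (9 ^ 12 * (9 ^ 12 * 2 ^ 24) * τ.im ^ 36) * h

/-- If δ divides c, conjugation by diag(δ, 1) takes γ to an integral matrix. -/
lemma discNorm_aff_smul_of_dvd {δ : ℤ} (hδ : 0 < δ) {γ : SL(2, ℤ)} (h : δ ∣ γ 1 0) (τ : ℍ) :
    discNorm (aff δ 0 1 (γ • τ)) = discNorm (aff δ 0 1 τ) := by
  obtain ⟨c, hc⟩ := h
  let γ' : SL(2, ℤ) := ⟨!![γ 0 0, δ * γ 0 1; c, γ 1 1], by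
    rw [Matrix.det_fin_two_of]; linear_combination SL_det γ + γ 0 1 * hc⟩
  rw [aff_smul hδ one_pos hδ one_pos (γ := γ) (γ' := γ') (b' := 0), discNorm_smul]
  · simp [γ', mul_comm]
  · simp [γ']
  · simp [γ', hc, mul_comm]
  · simp [γ']

lemma norm_w_smul {γ : SL(2, ℤ)} (h : (18 : ℤ) ∣ γ 1 0) (τ : ℍ) :
    ‖w (γ • τ : ℍ)‖ = ‖w τ‖ := by
  have h1 : ‖w (γ • τ : ℍ)‖ ^ 48 * 9 ^ 12 = ‖w τ‖ ^ 48 * 9 ^ 12 := by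
    rw [norm_w_pow_eq, norm_w_pow_eq]
    rw [discNorm_aff_smul_of_dvd (by norm_num) (by simp),
      discNorm_aff_smul_of_dvd (by norm_num) h,
      discNorm_aff_smul_of_dvd (by norm_num) ((by norm_num : (9 : ℤ) ∣ 18).trans h),
      discNorm_aff_smul_of_dvd (by norm_num) ((by norm_num : (2 : ℤ) ∣ 18).trans h)]
  exact (pow_left_inj₀ (norm_nonneg _) (norm_nonneg _) (by norm_num)).1
    (mul_right_cancel₀ (by norm_num) h1)

lemma isTheta_comp_tendsto {α β : Type*} {f : α → ℂ} {g : α → ℝ} {l : Filter α} (h : f =Θ[l] g)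
    {k : β → α} {l' : Filter β} (hk : Tendsto k l' l) : (f ∘ k) =Θ[l'] (g ∘ k) :=
  ⟨h.1.comp_tendsto hk, h.2.comp_tendsto hk⟩

lemma isTheta_congr {α : Type*} {f f' g g' : α → ℝ} {l : Filter α} (h : f =Θ[l] g)
    (hf : ∀ x, f x = f' x) (hg : ∀ x, g x = g' x) : f' =Θ[l] g' := by
  rwa [← funext hf, ← funext hg]

lemma discriminant_isTheta :
    (discriminant : ℍ → ℂ) =Θ[atImInfty] fun τ => Real.exp (-2 * Real.pi * τ.im) := by
  refine ⟨?_, ModularForm.exp_isBigO_discriminant⟩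
  have h1 := ModularForm.tendsto_atImInfty_tprod_one_sub_eta_q_pow.isBigO_one ℝ
  have h2 : (fun τ : ℍ => Function.Periodic.qParam 1 (τ : ℂ)) =O[atImInfty]
      fun τ : ℍ => Real.exp (-2 * Real.pi * τ.im) := by
    refine IsBigO.of_norm_left (IsBigO.of_bound 1 (Eventually.of_forall fun τ => ?_))
    simp [Function.Periodic.qParam, Complex.norm_exp]
  simpa using (h2.mul h1).congr_left fun τ => (ModularForm.discriminant_eq_q_prod τ).symm

lemma discNorm_aff_isTheta {a d : ℤ} (ha : 0 < a) (hd : 0 < d) (b : ℤ) :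
    (fun τ => discNorm (aff a b d τ)) =Θ[atImInfty]
      fun τ => τ.im ^ 12 * Real.exp (-4 * Real.pi * (a / d) * τ.im) := by
  have h1 : (fun τ => ‖discriminant (aff a b d τ)‖ ^ 2) =Θ[atImInfty]
      fun τ => Real.exp (-2 * Real.pi * (aff a b d τ).im) ^ 2 :=
    ((isTheta_comp_tendsto discriminant_isTheta (tendsto_aff ha hd b)).norm_left).pow 2
  have had : (0 : ℝ) < a / d := div_pos (by exact_mod_cast ha) (by exact_mod_cast hd)
  have h2 : (fun τ : ℍ => (aff a b d τ).im ^ 12) =Θ[atImInfty] fun τ => τ.im ^ 12 := by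
    simp only [im_aff ha hd, mul_pow]
    exact (isTheta_const_mul_left (pow_ne_zero 12 had.ne')).2 (isTheta_refl _ _)
  refine (isTheta_congr (h1.mul h2) (fun τ => (discNorm_eq _).symm) fun τ => ?_)
  rw [im_aff ha hd, ← Real.exp_nat_mul, mul_comm]
  congr 2
  push_cast
  ring

/-- The order of `w` at the cusp `γ ∞` is a positive multiple of this number, where `c` is the
lower left entry of `γ`. -/
def cuspOrder (c : ℤ) : ℝ := (1 - (Int.gcd c 2 : ℝ) ^ 2) * (1 - (Int.gcd c 9 : ℝ) ^ 2 / 9)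

/-- The Hermite form of diag(δ, 1) γ is [a', b'; 0, d'] with a' = gcd(c, δ) and a'd' = δ, so the
decay rate a'/d' is gcd(c, δ)²/δ. -/
lemma discNorm_aff_smul_isTheta {δ : ℤ} (hδ : 0 < δ) (γ : SL(2, ℤ)) :
    (fun τ : ℍ => discNorm (aff δ 0 1 (γ • τ))) =Θ[atImInfty]
      fun τ : ℍ => τ.im ^ 12 *
        Real.exp (-4 * Real.pi * ((Int.gcd (γ 1 0) δ : ℝ) ^ 2 / δ) * τ.im) := by
  obtain ⟨γ', a', b', d', ha', hd', -, -, had, hg, h00, h01, h10, h11⟩ :=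
    exists_hermite hδ one_pos 0 γ
  simp only [fun τ => aff_smul hδ one_pos ha' hd' h00 h01 h10 h11 τ, discNorm_smul]
  have hg' : a' = Int.gcd (γ 1 0) δ := by
    rw [hg]
    have hcop : IsCoprime (γ 0 0) (γ 1 0) := ⟨γ 1 1, -γ 0 1, by linear_combination SL_det γ⟩
    rw [zero_mul, add_zero, one_mul, Int.gcd_mul_left_left_of_gcd_eq_one, Int.gcd_comm]
    exact Int.isCoprime_iff_gcd_eq_one.1 hcop
  have h1 : (a' : ℝ) = Int.gcd (γ 1 0) δ := by exact_mod_cast hg'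
  have h2 : (a' * d' : ℝ) = δ := by exact_mod_cast had.trans (mul_one δ)
  have : (d' : ℝ) ≠ 0 := by exact_mod_cast hd'.ne'
  have : (a' : ℝ) ≠ 0 := by exact_mod_cast ha'.ne'
  have key : ((Int.gcd (γ 1 0) δ : ℝ) ^ 2 / δ) = a' / d' := by
    rw [← h1, ← h2]
    field_simp
  rw [key]
  exact discNorm_aff_isTheta ha' hd' b'

/-- The rates gcd(c, δ)²/δ enter with weights 1, 2, -1, -2 at δ = 1, 18, 9, 2; as gcd(c, 18) =
gcd(c, 2) gcd(c, 9), the sum factors as `cuspOrder`. -/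
lemma w_smul_isTheta (γ : SL(2, ℤ)) :
    (fun τ : ℍ => ‖w (γ • τ : ℍ)‖ ^ 48) =Θ[atImInfty]
      fun τ : ℍ => Real.exp (-4 * Real.pi * cuspOrder (γ 1 0) * τ.im) := by
  have h := ((discNorm_aff_smul_isTheta (δ := 1) (by norm_num) γ).mul
    ((discNorm_aff_smul_isTheta (δ := 18) (by norm_num) γ).pow 2)).div
    ((discNorm_aff_smul_isTheta (δ := 9) (by norm_num) γ).mul
    ((discNorm_aff_smul_isTheta (δ := 2) (by norm_num) γ).pow 2))
  have h' := (isTheta_const_mul_left (c := ((9 : ℝ) ^ 12)⁻¹) (by norm_num)).2 h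
  refine isTheta_congr h' (fun τ => ?_) (fun τ => ?_)
  · simp only [← norm_w_pow_eq]
    field_simp
  · have hy : τ.im ≠ 0 := τ.im_pos.ne'
    have h18 : Int.gcd (γ 1 0) 18 = Int.gcd (γ 1 0) 2 * Int.gcd (γ 1 0) 9 := by
      rw [show (18 : ℤ) = 2 * 9 by norm_num]
      exact Nat.Coprime.gcd_mul _ (by norm_num)
    simp only [mul_pow, ← Real.exp_nat_mul]
    rw [show ∀ y e1 e2 e3 e4 : ℝ, y * e1 * (y ^ 2 * e2) / (y * e3 * (y ^ 2 * e4)) =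
      (y ^ 3 / y ^ 3) * (e1 * e2 / (e3 * e4)) from fun _ _ _ _ _ => by ring,
      div_self (by positivity), one_mul, ← Real.exp_add, ← Real.exp_add, ← Real.exp_sub, h18,
      cuspOrder, Int.gcd_one_right]
    congr 1
    push_cast
    ring

/-- No zeros away from ∞: for c odd the first factor is 0; for c even it is -3, and gcd(c, 9) ≤ 3
makes the second factor nonnegative. -/
lemma cuspOrder_nonpos {c : ℤ} (h : ¬ (18 : ℤ) ∣ c) : cuspOrder c ≤ 0 := by
  have h2 : Int.gcd c 2 = 1 ∨ Int.gcd c 2 = 2 :=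
    (Nat.dvd_prime Nat.prime_two).1 (by simpa using Int.gcd_dvd_natAbs_right c 2)
  rcases h2 with h2 | h2
  · simp [cuspOrder, h2]
  · have h9 : Int.gcd c 9 ∣ 9 := by simpa using Int.gcd_dvd_natAbs_right c 9
    have h9' : Int.gcd c 9 ≠ 9 := by
      intro h9'
      have e2 : (2 : ℤ) ∣ c := by
        have := Int.gcd_dvd_left c 2; rwa [h2] at this
      have e9 : (9 : ℤ) ∣ c := by
        have := Int.gcd_dvd_left c 9; rwa [h9'] at this
      omega
    have h3 : Int.gcd c 9 ≤ 3 := by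
      have : Int.gcd c 9 ≤ 9 := Nat.le_of_dvd (by norm_num) h9
      interval_cases Int.gcd c 9 <;> omega
    have h3' : (Int.gcd c 9 : ℝ) ≤ 3 := by exact_mod_cast h3
    have h0 : (0 : ℝ) ≤ Int.gcd c 9 := by positivity
    rw [cuspOrder, h2]
    push_cast
    nlinarith

lemma cuspOrder_congr {c c' : ℤ} (h : Int.gcd c 18 = Int.gcd c' 18) : cuspOrder c = cuspOrder c' := by
  have key : ∀ k : ℤ, k ∣ 18 → Int.gcd c k = Int.gcd c' k := by
    intro k hk
    obtain ⟨m, hm⟩ := hk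
    have : ∀ x : ℤ, Int.gcd x k = Nat.gcd (Int.gcd x 18) k.natAbs := by
      intro x
      rw [Int.gcd_def, Int.gcd_def, Nat.gcd_assoc, hm, Int.natAbs_mul,
        Nat.gcd_eq_right (Dvd.intro _ rfl)]
    rw [this, this, h]
  rw [cuspOrder, cuspOrder, key 2 (by norm_num), key 9 (by norm_num)]

/-- Growth of `w ∘ γ' ∘ aff a b d` compared with `w ∘ γ`, at a cusp other than `∞`. -/
lemma w_smul_aff_isBigO {γ γ' : SL(2, ℤ)} {a b d : ℤ} (ha : 0 < a) (hd : 0 < d) {n : ℕ}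
    (hn : a * d = n) (h18 : ¬ (18 : ℤ) ∣ γ 1 0) (hg : Int.gcd (γ' 1 0) 18 = Int.gcd (γ 1 0) 18) :
    (fun τ : ℍ => w (γ' • aff a b d τ : ℍ)) =O[atImInfty] fun τ : ℍ => w (γ • τ : ℍ) ^ n := by
  have hn1 : 1 ≤ a := ha
  have hd1 : 1 ≤ d := hd
  refine IsBigO.of_pow (n := 48) (by norm_num) ?_
  have h1 : (fun τ : ℍ => w (γ' • aff a b d τ : ℍ) ^ 48) =O[atImInfty]
      fun τ : ℍ => Real.exp (-4 * Real.pi * cuspOrder (γ 1 0) * (aff a b d τ).im) := by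
    refine IsBigO.of_norm_left ?_
    simp only [norm_pow]
    rw [← cuspOrder_congr hg]
    exact ((w_smul_isTheta γ').1.comp_tendsto (tendsto_aff ha hd b))
  have h2 : (fun τ : ℍ => Real.exp (-4 * Real.pi * cuspOrder (γ 1 0) * τ.im) ^ n) =O[atImInfty]
      fun τ : ℍ => (w (γ • τ : ℍ) ^ n) ^ 48 := by
    refine IsBigO.of_norm_right ?_
    simp only [norm_pow, ← pow_mul]
    simp only [mul_comm n 48, pow_mul]
    exact (w_smul_isTheta γ).2.pow n
  refine (h1.trans (IsBigO.of_bound 1 (Eventually.of_forall fun τ => ?_))).trans h2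
  have hc := cuspOrder_nonpos h18
  have hτ := τ.im_pos
  rw [one_mul, ← Real.exp_nat_mul, Real.norm_of_nonneg (Real.exp_pos _).le,
    Real.norm_of_nonneg (Real.exp_pos _).le, Real.exp_le_exp, im_aff ha hd]
  -- a/d ≤ ad = n because d ≥ 1. As `cuspOrder` is nonpositive, this compares the two growth rates.
  have hle : (a / d : ℝ) ≤ n := by
    have e : (a * d : ℝ) = n := by exact_mod_cast hn
    have e1 : (1 : ℝ) ≤ d := by exact_mod_cast hd1
    have e2 : (0 : ℝ) < a := by exact_mod_cast ha
    rw [div_le_iff₀ (by linarith), ← e]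
    nlinarith [mul_le_mul_of_nonneg_left e1 (by positivity : (0 : ℝ) ≤ a * d)]
  have hpi := Real.pi_pos
  have hk : 0 ≤ -4 * Real.pi * cuspOrder (γ 1 0) * τ.im := by
    have : 0 ≤ 4 * Real.pi * (-cuspOrder (γ 1 0)) * τ.im := by
      have : 0 ≤ -cuspOrder (γ 1 0) := by linarith
      positivity
    linarith
  nlinarith [mul_le_mul_of_nonneg_right hle hk]

/-- Near these cusps w stays away from 0, so lower powers of w are dominated by higher ones. -/
lemma one_isBigO_w_smul {γ : SL(2, ℤ)} (h18 : ¬ (18 : ℤ) ∣ γ 1 0) :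
    (fun _ : ℍ => (1 : ℂ)) =O[atImInfty] fun τ : ℍ => w (γ • τ : ℍ) := by
  refine IsBigO.of_pow (n := 48) (by norm_num) ?_
  have h1 : (fun τ : ℍ => Real.exp (-4 * Real.pi * cuspOrder (γ 1 0) * τ.im)) =O[atImInfty]
      fun τ : ℍ => w (γ • τ : ℍ) ^ 48 := by
    refine IsBigO.of_norm_right ?_
    simp only [norm_pow]
    exact (w_smul_isTheta γ).2
  refine IsBigO.trans (IsBigO.of_bound 1 (Eventually.of_forall fun τ => ?_)) h1
  have hc := cuspOrder_nonpos h18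
  have hτ := τ.im_pos
  have hpi := Real.pi_pos
  have : 0 ≤ 4 * Real.pi * (-cuspOrder (γ 1 0)) * τ.im := by
    have : 0 ≤ -cuspOrder (γ 1 0) := by linarith
    positivity
  rw [one_mul, Real.norm_of_nonneg (Real.exp_pos _).le]
  simp
  linarith

end

/-! ### Theta constants, Gauss sums and the invariance of w under Γ₀(18) -/

section

open Filter Topology UpperHalfPlane Asymptotics MatrixGroups

/-- The theta constant `θ₂(τ) = ∑_{n ∈ ℤ} exp(πi (n + 1/2)² τ)`. -/
def thetaTwo (τ : ℂ) : ℂ := ∑' n : ℤ, Complex.exp (Real.pi * Complex.I * (n + 1 / 2) ^ 2 * τ)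

lemma hasSum_thetaTwo {τ : ℂ} (hτ : 0 < τ.im) :
    HasSum (fun n : ℤ => Complex.exp (Real.pi * Complex.I * (n + 1 / 2) ^ 2 * τ))
      (2 * (Complex.exp (Real.pi * Complex.I * τ / 4) *
        ramanujanPsi (Complex.exp (2 * Real.pi * Complex.I * τ)))) := by
  have hq := norm_exp_two_pi_lt_one hτ
  have h1 : HasSum (fun n : ℕ => Complex.exp (Real.pi * Complex.I * ((n : ℤ) + 1 / 2) ^ 2 * τ))
      (Complex.exp (Real.pi * Complex.I * τ / 4) *
        ramanujanPsi (Complex.exp (2 * Real.pi * Complex.I * τ))) := by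
    refine ((summable_psi hq).hasSum.mul_left _).congr_fun fun n => ?_
    rw [← Complex.exp_nat_mul, ← Complex.exp_add]
    congr 1
    have h2 : ((n * (n + 1) / 2 : ℕ) : ℂ) = n * (n + 1) / 2 := by
      rw [Nat.cast_div (Nat.even_mul_succ_self n).two_dvd two_ne_zero]
      push_cast
      ring
    rw [h2]
    push_cast
    ring
  have h2 : HasSum (fun n : ℕ => Complex.exp
      (Real.pi * Complex.I * ((-((n : ℤ) + 1) : ℤ) + 1 / 2) ^ 2 * τ))
      (Complex.exp (Real.pi * Complex.I * τ / 4) *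
        ramanujanPsi (Complex.exp (2 * Real.pi * Complex.I * τ))) := by
    refine h1.congr_fun fun n => ?_
    congr 1
    push_cast
    ring
  rw [two_mul]
  exact h1.of_nat_of_neg_add_one h2

lemma thetaTwo_eq {τ : ℂ} (hτ : 0 < τ.im) :
    thetaTwo τ = 2 * (Complex.exp (Real.pi * Complex.I * τ / 4) *
        ramanujanPsi (Complex.exp (2 * Real.pi * Complex.I * τ))) := (hasSum_thetaTwo hτ).tsum_eq

lemma thetaTwo_ne_zero {τ : ℂ} (hτ : 0 < τ.im) : thetaTwo τ ≠ 0 := by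
  rw [thetaTwo_eq hτ]
  exact mul_ne_zero two_ne_zero (mul_ne_zero (Complex.exp_ne_zero _)
    (ramanujanPsi_ne_zero (norm_exp_two_pi_lt_one hτ)))

/-- Unlike the formula for w²⁴, this quotient keeps track of roots of unity, and so can show that
the character of w is trivial. -/
lemma w_eq_thetaTwo {τ : ℂ} (hτ : 0 < τ.im) : w τ = thetaTwo (9 * τ) / thetaTwo τ := by
  have h9 : 0 < (9 * τ).im := by simpa using hτ
  rw [eq_div_iff (thetaTwo_ne_zero hτ), thetaTwo_eq hτ, thetaTwo_eq h9, w_eq_hauptDisc hτ,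
    hauptDisc]
  have e9 : Complex.exp (2 * Real.pi * Complex.I * (9 * τ)) =
      Complex.exp (2 * Real.pi * Complex.I * τ) ^ 9 := by
    rw [← Complex.exp_nat_mul]; congr 1; push_cast; ring
  have e1 : Complex.exp (Real.pi * Complex.I * (9 * τ) / 4) =
      Complex.exp (2 * Real.pi * Complex.I * τ) * Complex.exp (Real.pi * Complex.I * τ / 4) := by
    rw [← Complex.exp_add]; congr 1; ring
  have := ramanujanPsi_ne_zero (norm_exp_two_pi_lt_one hτ)
  rw [e9, e1]
  field_simp

/-- The functional equation of `jacobiTheta₂` at z = 1/2; since n² ≡ n mod 2, the twist exp(πin) is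
the shift of τ by 1. -/
lemma thetaTwo_neg_inv {τ : ℂ} (hτ : 0 < τ.im) :
    thetaTwo (-1 / τ) = (-Complex.I * τ) ^ (1 / 2 : ℂ) * jacobiTheta (τ + 1) := by
  have h0 : τ ≠ 0 := by rintro rfl; simp at hτ
  have h1 : jacobiTheta (τ + 1) = jacobiTheta₂ (1 / 2) τ := by
    rw [jacobiTheta, jacobiTheta₂]
    refine tsum_congr fun n => ?_
    rw [jacobiTheta₂_term, Complex.exp_eq_exp_iff_exists_int]
    obtain ⟨k, hk⟩ := (Int.even_mul_succ_self (n - 1)).two_dvd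
    refine ⟨k, ?_⟩
    have hk' : ((n : ℂ) - 1) * n = 2 * k := by
      have : ((n - 1) * n : ℤ) = 2 * k := by rw [← hk]; ring
      exact_mod_cast this
    linear_combination (Real.pi * Complex.I) * hk'
  have h2 : thetaTwo (-1 / τ) = Complex.exp (-Real.pi * Complex.I * (1 / 2) ^ 2 / τ) *
      jacobiTheta₂ (1 / 2 / τ) (-1 / τ) := by
    rw [← jacobiTheta₂_neg_left, thetaTwo, jacobiTheta₂, ← tsum_mul_left]
    refine tsum_congr fun n => ?_
    rw [jacobiTheta₂_term, ← Complex.exp_add]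
    congr 1
    field_simp
    ring
  have h3 : (-Complex.I * τ) ^ (1 / 2 : ℂ) ≠ 0 := by
    rw [Ne, Complex.cpow_eq_zero_iff]
    simp [h0]
  rw [h1, h2, jacobiTheta₂_functional_equation (1 / 2) τ]
  field_simp

/-- 9 · (-1/τ) = -1/(τ/9): after inversion both theta functions tend to 1, and the automorphy
factors leave √(1/9) = 1/3. -/
lemma tendsto_w_S_smul : Tendsto (fun τ : ℍ => w (ModularGroup.S • τ : ℍ)) atImInfty (𝓝 (1 / 3)) := by
  have hJ : Tendsto jacobiTheta (comap Complex.im atTop) (𝓝 1) := by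
    have h1 : Tendsto (fun τ : ℂ => Real.exp (-Real.pi * τ.im)) (comap Complex.im atTop) (𝓝 0) :=
      Real.tendsto_exp_atBot.comp (tendsto_comap.const_mul_atTop_of_neg (neg_lt_zero.2 Real.pi_pos))
    have h2 := isBigO_at_im_infty_jacobiTheta_sub_one.trans_tendsto h1
    simpa using h2.add_const 1
  have t1 : Tendsto (fun τ : ℍ => (τ : ℂ) + 1) atImInfty (comap Complex.im atTop) := by
    rw [tendsto_comap_iff]
    exact (tendsto_comap (f := UpperHalfPlane.im)).congr fun τ => by simp
  have t9 : Tendsto (fun τ : ℍ => (τ : ℂ) / 9 + 1) atImInfty (comap Complex.im atTop) := by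
    rw [tendsto_comap_iff]
    refine ((tendsto_comap (f := UpperHalfPlane.im)).atTop_div_const
      (show (0 : ℝ) < 9 by norm_num)).congr fun τ => ?_
    rw [Function.comp, show (9 : ℂ) = ((9 : ℝ) : ℂ) by norm_num, Complex.add_im,
      Complex.div_ofReal_im]
    simp
  have hlim := ((hJ.comp t9).div (hJ.comp t1) one_ne_zero).const_mul (1 / 3)
  rw [div_one, mul_one] at hlim
  refine hlim.congr fun τ => ?_
  have hτ : 0 < (τ : ℂ).im := τ.im_pos
  have h0 := τ.ne_zero
  have hτ9 : 0 < ((τ : ℂ) / 9).im := by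
    rw [show (9 : ℂ) = ((9 : ℝ) : ℂ) by norm_num, Complex.div_ofReal_im]
    positivity
  have hS : ((ModularGroup.S • τ : ℍ) : ℂ) = -1 / τ := by
    rw [UpperHalfPlane.modular_S_smul]
    simp [neg_div]
  rw [w_eq_thetaTwo (ModularGroup.S • τ : ℍ).im_pos, hS, show (9 : ℂ) * (-1 / τ) = -1 / (τ / 9) by
    field_simp, thetaTwo_neg_inv hτ, thetaTwo_neg_inv hτ9]
  -- The principal branches agree because the two bases differ by the positive factor 9.
  have e : (-Complex.I * τ) ^ (1 / 2 : ℂ) = 3 * (-Complex.I * (τ / 9)) ^ (1 / 2 : ℂ) := by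
    have hne : -Complex.I * (τ / 9 : ℂ) ≠ 0 := by simp [h0]
    have hne' : -Complex.I * (τ : ℂ) ≠ 0 := by simp [h0]
    have hlog : Complex.log (-Complex.I * τ) =
        2 * Complex.log 3 + Complex.log (-Complex.I * (τ / 9)) := by
      rw [show -Complex.I * (τ : ℂ) = ((3 ^ 2 : ℝ) : ℂ) * (-Complex.I * (τ / 9)) by
        push_cast; ring, Complex.log_ofReal_mul (by norm_num) hne, Real.log_pow]
      push_cast
      rw [Complex.ofReal_log (by norm_num)]
      norm_num
    rw [Complex.cpow_def_of_ne_zero hne, Complex.cpow_def_of_ne_zero hne', hlog,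
      show ∀ x y : ℂ, (2 * x + y) * (1 / 2) = x + y * (1 / 2) from fun _ _ => by ring,
      Complex.exp_add, Complex.exp_log three_ne_zero]
  have h3 : (-Complex.I * (τ / 9 : ℂ)) ^ (1 / 2 : ℂ) ≠ 0 := by
    rw [Ne, Complex.cpow_eq_zero_iff]
    simp [h0]
  rw [e]
  simp only [Pi.div_apply, Function.comp]
  rw [mul_assoc 3, mul_left_comm, mul_div_mul_left _ _ h3]
  ring

/-- The summands of a quadratic Gauss sum. -/
def gaussTerm (b : ℤ) (d : ℕ) (n : ℤ) : ℂ :=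
  Complex.exp (Real.pi * Complex.I * (n + 1 / 2) ^ 2 * (b / d))

/-- Writing n = dm + r, the phase depends on r alone; what remains for each r is a Gaussian sum over
m, an `evenKernel`. -/
lemma thetaTwo_eq_sum (b : ℤ) {d : ℕ} (hd : Odd d) {ε : ℝ} (hε : 0 < ε) :
    thetaTwo (b / d + ε * Complex.I) = ∑ r ∈ Finset.range d, gaussTerm b d r *
      HurwitzZeta.evenKernel (((r + 1 / 2) / d : ℝ) : UnitAddCircle) (ε * d ^ 2) := by
  have hd0 : 0 < d := hd.pos
  have hdR : (0 : ℝ) < d := by exact_mod_cast hd0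
  have hdC : (d : ℂ) ≠ 0 := by exact_mod_cast hd0.ne'
  have hdodd : Odd (d : ℤ) := by exact_mod_cast hd
  let f : ℤ → ℂ := fun n => Complex.exp (Real.pi * Complex.I * (n + 1 / 2) ^ 2 * (b / d + ε * Complex.I))
  have key : ∀ r ∈ Finset.range d, HasSum (fun n : ℤ => if n % d = r then f n else 0)
      (gaussTerm b d r *
        HurwitzZeta.evenKernel (((r + 1 / 2) / d : ℝ) : UnitAddCircle) (ε * d ^ 2)) := by
    intro r hr
    have hr' : (r : ℤ) < d := by exact_mod_cast Finset.mem_range.1 hr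
    have hinj : Function.Injective fun m : ℤ => d * m + r := fun m m' h => by
      have : (d : ℤ) ≠ 0 := by exact_mod_cast hd0.ne'
      exact mul_left_cancel₀ this (add_right_cancel h)
    rw [← hinj.hasSum_iff]
    · have h1 := (Complex.hasSum_ofReal.2 (HurwitzZeta.hasSum_int_evenKernel ((r + 1 / 2) / d : ℝ)
        (show 0 < ε * d ^ 2 by positivity))).mul_left (gaussTerm b d r)
      refine h1.congr_fun fun m => ?_
      have hmod : (d * m + r : ℤ) % d = r := by
        rw [Int.mul_add_emod_self_left]
        exact Int.emod_eq_of_lt (by positivity) hr'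
      simp only [Function.comp, hmod, if_true, f, gaussTerm]
      rw [Complex.ofReal_exp, ← Complex.exp_add, Complex.exp_eq_exp_iff_exists_int]
      -- The phases of n = dm + r and of r differ by πi b m(dm + 2r + 1), which is a multiple of 2πi
      -- because d is odd.
      have hdm : Even (m * (d * m + 2 * r + 1)) := by
        rcases Int.even_or_odd m with hm | hm
        · exact hm.mul_right _
        · refine Even.mul_left ?_ _
          have : Odd ((d : ℤ) * m) := hdodd.mul hm
          have h2 : Even (2 * (r : ℤ)) := even_two_mul _
          exact (this.add_even h2).add_one
      obtain ⟨k, hk⟩ := hdm.two_dvd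
      refine ⟨b * k, ?_⟩
      have hk' : (m * (d * m + 2 * r + 1) : ℂ) = 2 * k := by exact_mod_cast hk
      push_cast
      field_simp
      ring_nf
      rw [Complex.I_sq]
      linear_combination (4 * Complex.I * b * d) * hk'
    · intro n hn
      rw [if_neg]
      intro h
      exact hn ⟨n / d, by simp only; rw [← h]; exact Int.mul_ediv_add_emod n d⟩
  have hsum := hasSum_sum key
  rw [thetaTwo, ← hsum.tsum_eq]
  refine tsum_congr fun n => ?_
  have hn0 : 0 ≤ n % d := Int.emod_nonneg _ (by exact_mod_cast hd0.ne')
  have hn1 : n % d < d := Int.emod_lt_of_pos _ (by exact_mod_cast hd0)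
  rw [Finset.sum_eq_single (n % d).toNat]
  · rw [if_pos (by omega)]
  · intro r _ hr
    rw [if_neg (by omega)]
  · intro h
    simp at h
    omega

/-- By the functional equation each kernel times the square root is a `cosKernel` at 1/(ε d²) → ∞,
where it tends to 1. -/
lemma tendsto_sqrt_mul_thetaTwo (b : ℤ) {d : ℕ} (hd : Odd d) :
    Tendsto (fun ε : ℝ => ((ε * d ^ 2) ^ (1 / 2 : ℝ) : ℝ) * thetaTwo (b / d + ε * Complex.I))
      (𝓝[>] 0) (𝓝 (∑ r ∈ Finset.range d, gaussTerm b d r)) := by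
  have hdR : (0 : ℝ) < d := by exact_mod_cast hd.pos
  have hcos : ∀ a : UnitAddCircle, Tendsto (fun ε : ℝ => HurwitzZeta.cosKernel a (1 / (ε * d ^ 2)))
      (𝓝[>] 0) (𝓝 1) := by
    intro a
    obtain ⟨p, hp, hO⟩ := HurwitzZeta.isBigO_atTop_cosKernel_sub a
    have h1 : Tendsto (fun x : ℝ => Real.exp (-p * x)) atTop (𝓝 0) :=
      Real.tendsto_exp_atBot.comp (tendsto_id.const_mul_atTop_of_neg (neg_lt_zero.2 hp))
    have h2 : Tendsto (HurwitzZeta.cosKernel a) atTop (𝓝 1) := by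
      simpa using (hO.trans_tendsto h1).add_const 1
    refine h2.comp ?_
    simp only [one_div]
    refine tendsto_inv_nhdsGT_zero.comp ?_
    refine tendsto_nhdsWithin_iff.2 ⟨?_, ?_⟩
    · have : Tendsto (fun ε : ℝ => ε * d ^ 2) (𝓝 0) (𝓝 (0 * d ^ 2)) := tendsto_id.mul_const _
      rw [zero_mul] at this
      exact this.mono_left nhdsWithin_le_nhds
    · filter_upwards [self_mem_nhdsWithin] with ε hε
      have : 0 < ε := hε
      exact mul_pos this (by positivity)
  have hlim : Tendsto (fun ε : ℝ => ∑ r ∈ Finset.range d, gaussTerm b d r *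
      (HurwitzZeta.cosKernel (((r + 1 / 2) / d : ℝ) : UnitAddCircle) (1 / (ε * d ^ 2)) : ℂ))
      (𝓝[>] 0) (𝓝 (∑ r ∈ Finset.range d, gaussTerm b d r)) := by
    refine tendsto_finsetSum _ fun r _ => ?_
    simpa using ((Complex.continuous_ofReal.tendsto 1).comp
      (hcos (((r + 1 / 2) / d : ℝ) : UnitAddCircle))).const_mul (gaussTerm b d r)
  refine hlim.congr' ?_
  filter_upwards [self_mem_nhdsWithin] with ε hε
  have hε' : 0 < ε := hε
  rw [thetaTwo_eq_sum b hd hε', Finset.mul_sum]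
  refine Finset.sum_congr rfl fun r _ => ?_
  have : (ε * d ^ 2 : ℝ) ^ (1 / 2 : ℝ) ≠ 0 := (Real.rpow_pos_of_pos (by positivity) _).ne'
  rw [HurwitzZeta.evenKernel_functional_equation, mul_left_comm]
  congr 1
  rw [← Complex.ofReal_mul]
  congr 1
  field_simp

/-- (n + 1/2)² = n(n + 1) + 1/4 with n(n + 1) even, so up to a constant the term is an additive
character modulo d, with u playing the role of b/2. -/
lemma gaussTerm_eq (b : ℤ) {d : ℕ} [NeZero d] (n : ℤ) {u : ZMod d} (hu : 2 * u = b) :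
    gaussTerm b d n = Complex.exp (Real.pi * Complex.I * (b / (4 * d))) *
      ZMod.stdAddChar (u * ((n : ZMod d) ^ 2 + (n : ZMod d))) := by
  obtain ⟨k, hk⟩ := (Int.even_mul_succ_self n).two_dvd
  have h1 : u * ((n : ZMod d) ^ 2 + (n : ZMod d)) = ((b * k : ℤ) : ZMod d) := by
    have : ((n : ZMod d) * (n + 1)) = 2 * k := by exact_mod_cast congrArg (Int.cast : ℤ → ZMod d) hk
    push_cast
    rw [← hu]
    linear_combination u * this
  have hk' : (n : ℂ) * (n + 1) = 2 * k := by exact_mod_cast hk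
  have hd : (d : ℂ) ≠ 0 := by exact_mod_cast NeZero.ne d
  rw [h1, ZMod.stdAddChar_coe, ← Complex.exp_add, gaussTerm]
  congr 1
  push_cast
  field_simp
  linear_combination (16 * b) * hk'

lemma sum_range_intCast {d : ℕ} [NeZero d] (g : ZMod d → ℂ) :
    ∑ r ∈ Finset.range d, g ((r : ℤ) : ZMod d) = ∑ x : ZMod d, g x := by
  refine Finset.sum_bij (fun r _ => (r : ZMod d)) (fun _ _ => Finset.mem_univ _) ?_ ?_ ?_
  · intro r hr s hs h
    rw [ZMod.natCast_eq_natCast_iff'] at h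
    rwa [Nat.mod_eq_of_lt (Finset.mem_range.1 hr), Nat.mod_eq_of_lt (Finset.mem_range.1 hs)] at h
  · intro x _
    exact ⟨x.val, Finset.mem_range.2 (ZMod.val_lt x), ZMod.natCast_zmod_val x⟩
  · intro r _
    simp

/-- The product with the conjugate sum is d: substitute x = y + h and sum over y; only h = 0
survives because 2u is a unit. -/
lemma sum_stdAddChar_ne_zero {d : ℕ} [NeZero d] {u : ZMod d} (hu : IsUnit (2 * u)) :
    ∑ x : ZMod d, (ZMod.stdAddChar (u * (x ^ 2 + x)) : ℂ) ≠ 0 := by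
  intro h0
  have h1 : (∑ x : ZMod d, (ZMod.stdAddChar (u * (x ^ 2 + x)) : ℂ)) *
      ∑ y : ZMod d, (ZMod.stdAddChar (-(u * (y ^ 2 + y))) : ℂ) = d := by
    rw [Finset.sum_mul_sum, Finset.sum_comm]
    have h2 : ∀ y : ZMod d, ∑ x : ZMod d, (ZMod.stdAddChar (u * (x ^ 2 + x)) : ℂ) *
        ZMod.stdAddChar (-(u * (y ^ 2 + y))) = ∑ h : ZMod d,
          (ZMod.stdAddChar (u * (h ^ 2 + h)) : ℂ) * ZMod.stdAddChar (y * (2 * u * h)) := by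
      intro y
      rw [← Equiv.sum_comp (Equiv.addRight y)]
      refine Finset.sum_congr rfl fun h _ => ?_
      rw [← AddChar.map_add_eq_mul, ← AddChar.map_add_eq_mul]
      congr 1
      simp
      ring
    rw [Finset.sum_congr rfl fun y _ => h2 y, Finset.sum_comm]
    simp_rw [← Finset.mul_sum, AddChar.sum_mulShift _ (ZMod.isPrimitive_stdAddChar d),
      hu.mul_right_eq_zero]
    simp [ZMod.card]
  rw [h0, zero_mul] at h1
  exact NeZero.ne d (by exact_mod_cast h1.symm)

/-- 9(r + 1/2)² = (3r + 1 + 1/2)², so replacing b by 9b is the substitution r ↦ 3r + 1, a bijection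
modulo d as 3 is invertible. -/
lemma sum_gaussTerm {b : ℤ} {d : ℕ} (hd : Nat.Coprime d 6) (hb : IsCoprime b d) :
    ∑ r ∈ Finset.range d, gaussTerm (9 * b) d r = ∑ r ∈ Finset.range d, gaussTerm b d r ∧
      ∑ r ∈ Finset.range d, gaussTerm b d r ≠ 0 := by
  have hd0 : d ≠ 0 := by rintro rfl; simp at hd
  have : NeZero d := ⟨hd0⟩
  have h2 : IsUnit (2 : ZMod d) := by
    have : IsUnit ((2 : ℕ) : ZMod d) := (ZMod.isUnit_iff_coprime 2 d).2
      (Nat.Coprime.coprime_dvd_left (by norm_num) hd.symm)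
    simpa using this
  have h3 : IsUnit (3 : ZMod d) := by
    have : IsUnit ((3 : ℕ) : ZMod d) := (ZMod.isUnit_iff_coprime 3 d).2
      (Nat.Coprime.coprime_dvd_left (by norm_num) hd.symm)
    simpa using this
  obtain ⟨v, hv⟩ := h2.exists_right_inv
  have hu : 2 * (v * b) = (b : ZMod d) := by rw [← mul_assoc, hv, one_mul]
  have hub : IsUnit (2 * (v * b) : ZMod d) := by
    rw [hu]
    obtain ⟨x, y, hxy⟩ := hb
    refine IsUnit.of_mul_eq_one (x : ZMod d) ?_
    have := congrArg (Int.cast : ℤ → ZMod d) hxy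
    push_cast at this
    rw [ZMod.natCast_self, mul_zero, add_zero] at this
    rw [mul_comm]; exact this
  have e1 : ∑ r ∈ Finset.range d, gaussTerm b d r =
      Complex.exp (Real.pi * Complex.I * (b / (4 * d))) *
        ∑ x : ZMod d, (ZMod.stdAddChar (v * (b : ZMod d) * (x ^ 2 + x)) : ℂ) := by
    rw [← sum_range_intCast, Finset.mul_sum]
    exact Finset.sum_congr rfl fun r _ => gaussTerm_eq b r hu
  have e2 : ∑ r ∈ Finset.range d, gaussTerm (9 * b) d r =
      Complex.exp (Real.pi * Complex.I * (b / (4 * d))) *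
        ∑ x : ZMod d, (ZMod.stdAddChar (v * (b : ZMod d) * ((3 * x + 1) ^ 2 + (3 * x + 1))) : ℂ) := by
    rw [← sum_range_intCast, Finset.mul_sum]
    refine Finset.sum_congr rfl fun r _ => ?_
    have : gaussTerm (9 * b) d r = gaussTerm b d (3 * r + 1) := by
      rw [gaussTerm, gaussTerm]
      congr 1
      push_cast
      ring
    rw [this, gaussTerm_eq b _ hu]
    push_cast
    rfl
  rw [e1, e2]
  refine ⟨?_, mul_ne_zero (Complex.exp_ne_zero _) (sum_stdAddChar_ne_zero hub)⟩
  congr 1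
  refine Function.Bijective.sum_comp (e := fun x : ZMod d => 3 * x + 1) ?_
    (fun x => (ZMod.stdAddChar (v * (b : ZMod d) * (x ^ 2 + x)) : ℂ))
  refine Finite.injective_iff_bijective.1 fun x y h => ?_
  exact h3.mul_left_cancel (add_right_cancel h)

/-- θ₂ at 9(b/d + iε) involves the Gauss sum of 9b and the height 9ε. The two Gauss sums are equal
and nonzero, and the square roots contribute 1/3. -/
lemma tendsto_w_rational {b : ℤ} {d : ℕ} (hd : Nat.Coprime d 6) (hb : IsCoprime b d) :
    Tendsto (fun ε : ℝ => w (b / d + ε * Complex.I)) (𝓝[>] 0) (𝓝 (1 / 3)) := by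
  have hodd : Odd d := by
    refine Nat.coprime_two_right.1 ?_
    exact hd.coprime_dvd_right (by norm_num)
  have hdR : (0 : ℝ) < d := by exact_mod_cast hodd.pos
  have hdN : 0 < d := hodd.pos
  obtain ⟨h1, h2⟩ := sum_gaussTerm hd hb
  have t9 : Tendsto (fun ε : ℝ => 9 * ε) (𝓝[>] 0) (𝓝[>] 0) := by
    refine tendsto_nhdsWithin_iff.2 ⟨?_, ?_⟩
    · have : Tendsto (fun ε : ℝ => 9 * ε) (𝓝 0) (𝓝 (9 * 0)) := tendsto_id.const_mul _
      rw [mul_zero] at this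
      exact this.mono_left nhdsWithin_le_nhds
    · filter_upwards [self_mem_nhdsWithin] with ε hε
      have : 0 < ε := hε
      exact mul_pos (by norm_num) this
  have hlim := (((tendsto_sqrt_mul_thetaTwo (9 * b) hodd).comp t9).div
    (tendsto_sqrt_mul_thetaTwo b hodd) h2).const_mul (1 / 3)
  rw [h1, div_self h2, mul_one] at hlim
  refine hlim.congr' ?_
  filter_upwards [self_mem_nhdsWithin] with ε hε
  have hε' : 0 < ε := hε
  have him : 0 < (b / d + ε * Complex.I : ℂ).im := by
    rw [show (b / d : ℂ) = ((b / d : ℝ) : ℂ) by push_cast; rfl, Complex.add_im, Complex.ofReal_im]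
    simpa using hε'
  have e9 : ((9 * ε * d ^ 2 : ℝ)) ^ (1 / 2 : ℝ) = 3 * (ε * d ^ 2) ^ (1 / 2 : ℝ) := by
    rw [mul_assoc, Real.mul_rpow (by norm_num) (by positivity)]
    congr 1
    rw [show (9 : ℝ) = 3 ^ (2 : ℝ) by norm_num, ← Real.rpow_mul (by norm_num)]
    norm_num
  have hne : (((ε * d ^ 2 : ℝ) ^ (1 / 2 : ℝ) : ℝ) : ℂ) ≠ 0 := by
    exact_mod_cast (Real.rpow_pos_of_pos (by positivity) _).ne'
  simp only [Pi.div_apply, Function.comp]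
  rw [e9, w_eq_thetaTwo him, show (9 : ℂ) * (b / d + ε * Complex.I) =
    ((9 * b : ℤ) : ℂ) / d + ((9 * ε : ℝ) : ℂ) * Complex.I by push_cast; ring, Complex.ofReal_mul,
    Complex.ofReal_ofNat, mul_assoc (3 : ℂ), mul_div_assoc, mul_div_mul_left _ _ hne]
  ring

lemma mobius_SL (γ : SL(2, ℤ)) {z : ℂ} (hz : 0 < z.im) :
    mobius γ.1 z = ((γ • (⟨z, hz⟩ : ℍ) : ℍ) : ℂ) := by
  rw [coe_SL_smul]; rfl

lemma differentiableOn_w_mobius (γ : SL(2, ℤ)) :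
    DifferentiableOn ℂ (fun z => w (mobius γ.1 z)) {z | 0 < z.im} := by
  refine differentiableOn_w.comp (DifferentiableOn.div (by fun_prop) (by fun_prop)
    fun z hz => SL_denom_ne_zero γ ⟨z, hz⟩) fun z hz => ?_
  rw [mobius_SL γ hz]
  exact (γ • (⟨z, hz⟩ : ℍ) : ℍ).im_pos

/-- The quotient is holomorphic of constant modulus 1, hence constant by the maximum principle. -/
lemma exists_w_smul_eq {γ : SL(2, ℤ)} (h : (18 : ℤ) ∣ γ 1 0) :
    ∃ χ : ℂ, ∀ τ : ℍ, w (γ • τ : ℍ) = χ * w τ := by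
  have hd : DifferentiableOn ℂ (fun z => w (mobius γ.1 z) / w z) {z | 0 < z.im} :=
    (differentiableOn_w_mobius γ).div differentiableOn_w fun z hz => w_ne_zero hz
  have hnorm : ∀ z ∈ {z : ℂ | 0 < z.im}, ‖w (mobius γ.1 z) / w z‖ = 1 := by
    intro z hz
    have := norm_w_smul h ⟨z, hz⟩
    rw [mobius_SL γ hz, norm_div, this]
    exact div_self (norm_ne_zero_iff.2 (w_ne_zero hz))
  have hI : Complex.I ∈ {z : ℂ | 0 < z.im} := by simp
  have hc := Complex.eqOn_of_isPreconnected_of_isMaxOn_norm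
    (convex_halfSpace_im_gt 0).isPreconnected
    (isOpen_lt continuous_const Complex.continuous_im) hd hI fun z hz => by
      simp only [Set.mem_ofPred_eq, Function.comp]
      rw [hnorm z hz, hnorm _ hI]
  refine ⟨w (mobius γ.1 Complex.I) / w Complex.I, fun τ => ?_⟩
  have := hc τ.im_pos
  simp only [Function.const] at this
  rw [div_eq_iff (w_ne_zero τ.im_pos), mobius_SL γ τ.im_pos] at this
  exact this

/-- The function `w` is invariant under `Γ₀(18)`. -/
theorem w_smul {γ : SL(2, ℤ)} (h : (18 : ℤ) ∣ γ 1 0) (τ : ℍ) : w (γ • τ : ℍ) = w τ := by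
  obtain ⟨χ, hχ⟩ := exists_w_smul_eq h
  suffices χ = 1 by rw [hχ, this, one_mul]
  have hdet := SL_det γ
  obtain ⟨c, hc⟩ := h
  have hcop : IsCoprime (γ 1 1) 6 := ⟨γ 0 0, -3 * γ 0 1 * c, by
    linear_combination hdet + γ 0 1 * hc⟩
  have hd0 : γ 1 1 ≠ 0 := by
    intro h0
    rw [h0] at hcop
    exact absurd (Int.isCoprime_iff_gcd_eq_one.1 hcop) (by decide)
  set d : ℕ := (γ 1 1).natAbs with hd
  have hdcop : Nat.Coprime d 6 := Int.isCoprime_iff_gcd_eq_one.1 hcop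
  -- The sign moves into the numerator, so that γ(0) is a fraction with positive denominator d, as
  -- `tendsto_w_rational` requires.
  set s : ℤ := (γ 1 1).sign
  have hs : s * s = 1 := by
    rcases Int.lt_or_gt_of_ne hd0 with h | h
    · simp [s, Int.sign_eq_neg_one_of_neg h]
    · simp [s, Int.sign_eq_one_of_pos h]
  have hsd : s * γ 1 1 = d := Int.sign_mul_self_eq_natAbs _
  have hdR : (0 : ℝ) < d := by exact_mod_cast Int.natAbs_pos.2 hd0
  have hbcop : IsCoprime (s * γ 0 1) d := ⟨-(s * γ 1 0), γ 0 0 * s, by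
    rw [← hsd]; linear_combination hdet + (γ 0 0 * γ 1 1 - γ 0 1 * γ 1 0 ) * hs⟩
  have hlim1 := tendsto_w_rational hdcop hbcop
  -- With S the inversion, the path γ(0) + iε is the image under γS of σ = x + i/(d²ε), which tends
  -- to i∞ as ε → 0. Along it w(γSσ) = χ w(Sσ), and the two sides tend to 1/3 and χ/3.
  set x : ℝ := γ 1 0 / γ 1 1
  have hpos : ∀ ε : ℝ, 0 < ε → 0 < ε⁻¹ * (1 / (d : ℝ) ^ 2) := fun ε hε => by positivity
  have hcoe : ∀ ε : ℝ, 0 < ε → ((ofComplex (x + (ε⁻¹ * (1 / (d : ℝ) ^ 2) : ℝ) * Complex.I) : ℍ) : ℂ)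
      = x + (ε⁻¹ * (1 / (d : ℝ) ^ 2) : ℝ) * Complex.I := by
    intro ε hε
    rw [ofComplex_apply_of_im_pos (by
      rw [Complex.add_im, Complex.ofReal_im, Complex.im_ofReal_mul, Complex.I_im, mul_one, zero_add]
      exact hpos ε hε)]
  have hpath : Tendsto (fun ε : ℝ => ofComplex (x + (ε⁻¹ * (1 / (d : ℝ) ^ 2) : ℝ) * Complex.I))
      (𝓝[>] 0) atImInfty := by
    rw [atImInfty, tendsto_comap_iff]
    have h1 : Tendsto (fun ε : ℝ => ε⁻¹ * (1 / (d : ℝ) ^ 2)) (𝓝[>] 0) atTop :=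
      tendsto_inv_nhdsGT_zero.atTop_mul_const (by positivity)
    refine h1.congr' ?_
    filter_upwards [self_mem_nhdsWithin] with ε hε
    rw [Function.comp, ← coe_im, hcoe ε hε, Complex.add_im, Complex.ofReal_im,
      Complex.im_ofReal_mul, Complex.I_im, mul_one, zero_add]
  have hlim2 := (tendsto_w_S_smul.comp hpath).const_mul χ
  have heq : (1 / 3 : ℂ) = χ * (1 / 3) := by
    refine tendsto_nhds_unique hlim1 (hlim2.congr' ?_)
    filter_upwards [self_mem_nhdsWithin] with ε hε
    have hε' : 0 < ε := hε
    simp only [Function.comp]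
    rw [← hχ]
    congr 1
    set σ : ℍ := ofComplex (x + (ε⁻¹ * (1 / (d : ℝ) ^ 2) : ℝ) * Complex.I)
    have hσ : (σ : ℂ) = x + (ε⁻¹ * (1 / (d : ℝ) ^ 2) : ℝ) * Complex.I := hcoe ε hε
    have hS : ((ModularGroup.S • σ : ℍ) : ℂ) = -1 / σ := by
      rw [UpperHalfPlane.modular_S_smul]
      simp [neg_div]
    have hn := SL_denom_ne_zero γ (ModularGroup.S • σ)
    have hσ0 := σ.ne_zero
    rw [coe_SL_smul, div_eq_iff hn, hS]
    have hD : (γ 1 1 : ℂ) ≠ 0 := by exact_mod_cast hd0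
    have hs' : (s : ℂ) * s = 1 := by exact_mod_cast hs
    have hs0 : (s : ℂ) ≠ 0 := left_ne_zero_of_mul_eq_one hs'
    have hd' : (d : ℂ) = s * γ 1 1 := by exact_mod_cast hsd.symm
    have hdetC : (γ 0 0 * γ 1 1 - γ 0 1 * γ 1 0 : ℂ) = 1 := by exact_mod_cast hdet
    have hεC : (ε : ℂ) ≠ 0 := by exact_mod_cast hε'.ne'
    have hσ' : (σ : ℂ) = γ 1 0 / γ 1 1 + Complex.I / (γ 1 1 ^ 2 * ε) := by
      rw [hσ]
      push_cast [x]
      rw [hd', mul_pow, pow_two (s : ℂ), hs']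
      field_simp
    have e1 : (γ 1 1 : ℂ) * σ - γ 1 0 = Complex.I / (γ 1 1 * ε) := by
      rw [hσ']; field_simp; ring
    have e2 : (γ 0 1 : ℂ) * σ - γ 0 0 =
        (γ 0 1 / γ 1 1 + ε * Complex.I) * (Complex.I / (γ 1 1 * ε)) := by
      rw [hσ']; field_simp; ring_nf; rw [Complex.I_sq]; linear_combination (-ε * γ 1 1) * hdetC
    rw [← e1] at e2
    have e3 : ((s * γ 0 1 : ℤ) : ℂ) / d = γ 0 1 / γ 1 1 := by
      rw [hd']; push_cast; rw [mul_div_mul_left _ _ hs0]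
    rw [e3]
    have e4 : ∀ y z : ℂ, y * (-1 / σ) + z = (z * σ - y) / σ := fun y z => by field_simp; ring
    rw [e4, e4, e2, mul_div_assoc]
  have h3 : (1 / 3 : ℂ) ≠ 0 := by norm_num
  exact (mul_right_cancel₀ h3 (by rw [one_mul]; exact heq)).symm

end

/-! ### Convergent power series; invariant functions as integral polynomials in w -/

section

open Filter Topology UpperHalfPlane Asymptotics MatrixGroups
open scoped PowerSeries ModularForm

/-- The ring of complex power series converging on the open unit disc. -/
def ConvSeries : Subring ℂ⟦X⟧ where
  carrier := {S | ∀ t : ℂ, ‖t‖ < 1 → Summable fun k => S.coeff k * t ^ k}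
  mul_mem' {S S'} hS hS' t ht := by
    have h := (summable_norm_sum_mul_antidiagonal_of_summable_norm (hS t ht).norm
      (hS' t ht).norm).of_norm
    refine h.congr fun n => ?_
    rw [PowerSeries.coeff_mul, Finset.sum_mul]
    refine Finset.sum_congr rfl fun x hx => ?_
    rw [← Finset.HasAntidiagonal.mem_antidiagonal.1 hx, pow_add]
    ring
  one_mem' t ht := by
    refine summable_of_ne_finset_zero (s := {0}) fun k hk => ?_
    rw [PowerSeries.coeff_one, if_neg (by simpa using hk), zero_mul]
  add_mem' {S S'} hS hS' t ht := by
    simpa [add_mul] using (hS t ht).add (hS' t ht)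
  zero_mem' t ht := by simp [summable_zero]
  neg_mem' {S} hS t ht := by simpa using (hS t ht).neg

/-- The sum of a power series at a point. -/
def evalSeries (S : ℂ⟦X⟧) (t : ℂ) : ℂ := ∑' k, S.coeff k * t ^ k

lemma ConvSeries.hasSum {S : ℂ⟦X⟧} (hS : S ∈ ConvSeries) {t : ℂ} (ht : ‖t‖ < 1) :
    HasSum (fun k => S.coeff k * t ^ k) (evalSeries S t) := (hS t ht).hasSum

lemma mem_convSeries_of_hasSum {S : ℂ⟦X⟧} {f : ℂ → ℂ}
    (h : ∀ t : ℂ, ‖t‖ < 1 → HasSum (fun k => S.coeff k * t ^ k) (f t)) :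
    S ∈ ConvSeries ∧ ∀ t : ℂ, ‖t‖ < 1 → evalSeries S t = f t :=
  ⟨fun t ht => (h t ht).summable, fun t ht => (h t ht).tsum_eq⟩

/-- Evaluation of convergent power series at a point of the unit disc. -/
def ConvSeries.ev (t : ℂ) (ht : ‖t‖ < 1) : ConvSeries →+* ℂ where
  toFun S := evalSeries S t
  map_one' := by
    rw [evalSeries, tsum_eq_single 0 fun k hk => by
      rw [Subring.coe_one, PowerSeries.coeff_one, if_neg hk, zero_mul]]
    simp
  map_zero' := by simp [evalSeries]
  map_add' S S' := by
    rw [evalSeries, evalSeries, evalSeries, ← (S.2 t ht).tsum_add (S'.2 t ht)]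
    simp [add_mul]
  map_mul' S S' := by
    rw [evalSeries, evalSeries, evalSeries,
      tsum_mul_tsum_eq_tsum_sum_antidiagonal_of_summable_norm (S.2 t ht).norm (S'.2 t ht).norm]
    refine tsum_congr fun n => ?_
    rw [Subring.coe_mul, PowerSeries.coeff_mul, Finset.sum_mul]
    refine Finset.sum_congr rfl fun x hx => ?_
    rw [← Finset.HasAntidiagonal.mem_antidiagonal.1 hx, pow_add]
    ring

lemma ConvSeries.ev_apply {t : ℂ} (ht : ‖t‖ < 1) (S : ConvSeries) :
    ConvSeries.ev t ht S = evalSeries S t := rfl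

lemma hasFPowerSeriesOnBall_evalSeries {S : ℂ⟦X⟧} (hS : S ∈ ConvSeries) :
    HasFPowerSeriesOnBall (evalSeries S)
      (FormalMultilinearSeries.ofScalars ℂ fun k => S.coeff k) 0 1 where
  r_le := by
    refine le_of_forall_lt_imp_le_of_dense fun r hr => ?_
    lift r to NNReal using hr.ne_top
    apply FormalMultilinearSeries.le_radius_of_summable
    simpa [FormalMultilinearSeries.ofScalars_norm] using
      (hS (r : ℝ) (by simpa using hr)).norm
  r_pos := one_pos
  hasSum {y} hy := by
    rw [← ENNReal.coe_one, Metric.eball_coe, NNReal.coe_one, mem_ball_zero_iff] at hy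
    simpa [FormalMultilinearSeries.ofScalars_apply_eq, mul_comm] using ConvSeries.hasSum hS hy

/-- The identity theorem. The point t = 0 is left out because exp(2πiτ/n) never takes this value. -/
lemma series_eq_zero_of_evalSeries {S : ℂ⟦X⟧} (hS : S ∈ ConvSeries)
    (h : ∀ t : ℂ, ‖t‖ < 1 → t ≠ 0 → evalSeries S t = 0) : S = 0 := by
  have hp := (hasFPowerSeriesOnBall_evalSeries hS).hasFPowerSeriesAt
  have h1 : ∀ᶠ t in 𝓝[≠] (0 : ℂ), evalSeries S t = 0 := by
    filter_upwards [self_mem_nhdsWithin,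
      nhdsWithin_le_nhds (Metric.ball_mem_nhds (0 : ℂ) one_pos)] with t ht ht'
    exact h t (mem_ball_zero_iff.1 ht') ht
  have h2 := hp.analyticAt.frequently_zero_iff_eventually_zero.1 h1.frequently
  have h3 := hp.eq_zero_of_eventually h2
  rw [FormalMultilinearSeries.ofScalars_series_eq_zero] at h3
  ext k
  exact congrFun h3 k

lemma series_ext_of_evalSeries {S S' : ℂ⟦X⟧} (hS : S ∈ ConvSeries) (hS' : S' ∈ ConvSeries)
    (h : ∀ t : ℂ, ‖t‖ < 1 → t ≠ 0 → evalSeries S t = evalSeries S' t) : S = S' := by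
  rw [← sub_eq_zero]
  refine series_eq_zero_of_evalSeries (sub_mem hS hS') fun t ht ht0 => ?_
  have := map_sub (ConvSeries.ev t ht) ⟨S, hS⟩ ⟨S', hS'⟩
  simp only [ConvSeries.ev_apply] at this
  rw [h t ht ht0, sub_self] at this
  exact this

lemma differentiableOn_evalSeries {S : ℂ⟦X⟧} (hS : S ∈ ConvSeries) :
    DifferentiableOn ℂ (evalSeries S) (Metric.ball 0 1) := by
  have := (hasFPowerSeriesOnBall_evalSeries hS).differentiableOn
  rwa [← ENNReal.coe_one, Metric.eball_coe, NNReal.coe_one] at this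

lemma evalSeries_isBigO {S : ℂ⟦X⟧} (hS : S ∈ ConvSeries) {k : ℕ} (hk : (PowerSeries.X ^ k) ∣ S) :
    evalSeries S =O[𝓝 0] fun t => t ^ k := by
  have h := (hasFPowerSeriesOnBall_evalSeries hS).hasFPowerSeriesAt.isBigO_sub_partialSum_pow k
  refine IsBigO.of_norm_right ?_
  simp only [norm_pow]
  refine h.congr_left fun t => ?_
  rw [zero_add, sub_eq_self, FormalMultilinearSeries.partialSum]
  refine Finset.sum_eq_zero fun i hi => ?_
  simp [PowerSeries.X_pow_dvd_iff.1 hk i (Finset.mem_range.1 hi)]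

open Classical in
/-- `ψ(q)` as a formal power series. -/
def psiSeries : ℤ⟦X⟧ := PowerSeries.mk fun k => if ∃ n : ℕ, n * (n + 1) / 2 = k then 1 else 0

lemma triangular_injective : Function.Injective fun n : ℕ => n * (n + 1) / 2 := by
  refine StrictMono.injective (strictMono_nat_of_lt_succ fun n => ?_)
  have h : (n + 1) * (n + 1 + 1) = n * (n + 1) + 2 * (n + 1) := by ring
  rw [h, Nat.add_mul_div_left _ _ two_pos]
  omega

lemma constantCoeff_psiSeries : PowerSeries.constantCoeff psiSeries = 1 := by
  rw [← PowerSeries.coeff_zero_eq_constantCoeff_apply, psiSeries, PowerSeries.coeff_mk, if_pos]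
  exact ⟨0, rfl⟩

/-- The coefficients of `w` at infinity. -/
def wSeries : ℤ⟦X⟧ :=
  PowerSeries.X * (PowerSeries.expand 9 (by norm_num) psiSeries * psiSeries.invOfUnit 1)

lemma wSeries_mul_psiSeries :
    wSeries * psiSeries = PowerSeries.X * PowerSeries.expand 9 (by norm_num) psiSeries := by
  have : psiSeries.invOfUnit 1 * psiSeries = 1 := by
    rw [mul_comm]
    exact PowerSeries.mul_invOfUnit _ _ (by simpa using constantCoeff_psiSeries)
  rw [wSeries, mul_assoc, mul_assoc, this, mul_one]

lemma coeff_one_wSeries : wSeries.coeff 1 = 1 := by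
  have h := congrArg PowerSeries.constantCoeff (PowerSeries.mul_invOfUnit psiSeries 1
    (by simpa using constantCoeff_psiSeries))
  rw [map_mul, constantCoeff_psiSeries, one_mul, map_one] at h
  rw [wSeries, show (1 : ℕ) = 0 + 1 from rfl, PowerSeries.coeff_succ_X_mul,
    PowerSeries.coeff_zero_eq_constantCoeff_apply, map_mul, PowerSeries.constantCoeff_expand,
    constantCoeff_psiSeries, h, one_mul]

lemma coeff_zero_wSeries : wSeries.coeff 0 = 0 := by
  rw [wSeries, PowerSeries.coeff_zero_X_mul]

/-- The base change of an integral power series to `ℂ`. -/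
abbrev toComplex : ℤ⟦X⟧ →+* ℂ⟦X⟧ := PowerSeries.map (Int.castRingHom ℂ)

lemma hasSum_psiSeries {t : ℂ} (ht : ‖t‖ < 1) :
    HasSum (fun k => (toComplex psiSeries).coeff k * t ^ k) (ramanujanPsi t) := by
  rw [← triangular_injective.hasSum_iff]
  · refine (summable_psi ht).hasSum.congr_fun fun n => ?_
    simp [psiSeries]
  · intro k hk
    rw [PowerSeries.coeff_map, psiSeries, PowerSeries.coeff_mk,
      if_neg (show ¬ ∃ n : ℕ, n * (n + 1) / 2 = k from hk)]
    simp

lemma hasSum_expand {S : ℂ⟦X⟧} {f : ℂ → ℂ}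
    (h : ∀ t : ℂ, ‖t‖ < 1 → HasSum (fun k => S.coeff k * t ^ k) (f t)) {n : ℕ} (hn : n ≠ 0)
    {t : ℂ} (ht : ‖t‖ < 1) :
    HasSum (fun k => (PowerSeries.expand n hn S).coeff k * t ^ k) (f (t ^ n)) := by
  have hinj : Function.Injective fun k : ℕ => n * k := fun _ _ h =>
    Nat.eq_of_mul_eq_mul_left (Nat.pos_of_ne_zero hn) h
  rw [← hinj.hasSum_iff]
  · refine (h _ (norm_pow_lt_one ht hn)).congr_fun fun k => ?_
    simp [PowerSeries.coeff_expand_mul, pow_mul]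
  · intro k hk
    rw [PowerSeries.coeff_expand_of_not_dvd _ _ _ fun ⟨m, hm⟩ => hk ⟨m, hm.symm⟩, zero_mul]

lemma hasSum_rescale {S : ℂ⟦X⟧} {f : ℂ → ℂ}
    (h : ∀ t : ℂ, ‖t‖ < 1 → HasSum (fun k => S.coeff k * t ^ k) (f t)) {z : ℂ} (hz : ‖z‖ = 1)
    {t : ℂ} (ht : ‖t‖ < 1) :
    HasSum (fun k => (PowerSeries.rescale z S).coeff k * t ^ k) (f (z * t)) := by
  refine (h (z * t) (by rwa [norm_mul, hz, one_mul])).congr_fun fun k => ?_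
  rw [PowerSeries.coeff_rescale, mul_pow]
  ring

-- The Taylor series of `hauptDisc` and the integral series have the same product with ψ, and ψ can
-- be cancelled; no convergence statement about the inverse series of ψ is required.
open scoped Nat in
lemma hasSum_wSeries {t : ℂ} (ht : ‖t‖ < 1) :
    HasSum (fun k => (toComplex wSeries).coeff k * t ^ k) (hauptDisc t) := by
  let H : ℂ⟦X⟧ := PowerSeries.mk fun k => (k ! : ℂ)⁻¹ * iteratedDeriv k hauptDisc 0
  have hH : ∀ t : ℂ, ‖t‖ < 1 → HasSum (fun k => H.coeff k * t ^ k) (hauptDisc t) := by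
    intro t ht
    refine (Complex.hasSum_taylorSeries_on_ball (r := 1) differentiableOn_hauptDisc
      (mem_ball_zero_iff.2 ht)).congr_fun fun k => ?_
    simp [H]
    ring
  suffices h : toComplex wSeries = H by rw [h]; exact hH t ht
  have mH := mem_convSeries_of_hasSum hH
  have mP := mem_convSeries_of_hasSum (fun t ht => hasSum_psiSeries ht)
  have m9 := mem_convSeries_of_hasSum (fun t ht =>
    hasSum_expand (fun t ht => hasSum_psiSeries ht) (n := 9) (by norm_num) ht)
  have mX : (PowerSeries.X : ℂ⟦X⟧) ∈ ConvSeries ∧ ∀ t : ℂ, ‖t‖ < 1 → evalSeries .X t = t := by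
    refine mem_convSeries_of_hasSum (f := id) fun t ht => ?_
    convert hasSum_single (f := fun k => (PowerSeries.X : ℂ⟦X⟧).coeff k * t ^ k) 1 ?_ using 1
    · simp
    · intro k hk
      rw [PowerSeries.coeff_X, if_neg hk, zero_mul]
  have key : H * toComplex psiSeries =
      PowerSeries.X * PowerSeries.expand 9 (by norm_num) (toComplex psiSeries) := by
    refine series_ext_of_evalSeries (mul_mem mH.1 mP.1) (mul_mem mX.1 m9.1) fun t ht _ => ?_
    have e1 := map_mul (ConvSeries.ev t ht) ⟨_, mH.1⟩ ⟨_, mP.1⟩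
    have e2 := map_mul (ConvSeries.ev t ht) ⟨_, mX.1⟩ ⟨_, m9.1⟩
    simp only [ConvSeries.ev_apply] at e1 e2
    rw [mH.2 t ht, mP.2 t ht] at e1
    rw [mX.2 t ht, m9.2 t ht] at e2
    have := ramanujanPsi_ne_zero ht
    refine e1.trans (Eq.trans ?_ e2.symm)
    rw [hauptDisc]
    field_simp
  have key2 := congrArg toComplex wSeries_mul_psiSeries
  rw [map_mul, map_mul, PowerSeries.map_X, PowerSeries.map_expand, ← key] at key2
  refine mul_right_cancel₀ (fun h0 => ?_) key2
  have := congrArg PowerSeries.constantCoeff h0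
  rw [← PowerSeries.coeff_zero_eq_constantCoeff_apply, PowerSeries.coeff_map,
    PowerSeries.coeff_zero_eq_constantCoeff_apply, constantCoeff_psiSeries] at this
  simp at this

lemma toComplex_wSeries_mem : toComplex wSeries ∈ ConvSeries :=
  (mem_convSeries_of_hasSum fun _ ht => hasSum_wSeries ht).1

/-- The parameter `q = exp(2πiτ)`. -/
def nome (τ : ℍ) : ℂ := Complex.exp (2 * Real.pi * Complex.I * τ)

lemma norm_nome_lt_one (τ : ℍ) : ‖nome τ‖ < 1 := norm_exp_two_pi_lt_one τ.im_pos

lemma w_eq_evalSeries (τ : ℍ) : w τ = evalSeries (toComplex wSeries) (nome τ) := by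
  rw [w_eq_hauptDisc τ.im_pos]
  exact (hasSum_wSeries (norm_nome_lt_one τ)).tsum_eq.symm

lemma tendsto_nome : Tendsto nome atImInfty (𝓝 0) := by
  simpa [nome, Function.Periodic.qParam] using! UpperHalfPlane.qParam_tendsto_atImInfty one_pos

/-- q/w = ψ(q)/ψ(q⁹) is continuous at q = 0. -/
lemma nome_isBigO_w : nome =O[atImInfty] fun τ : ℍ => w τ := by
  have h0 : ContinuousAt (fun q : ℂ => ramanujanPsi q / ramanujanPsi (q ^ 9)) 0 := by
    have hc : ContinuousAt ramanujanPsi 0 := (differentiableOn_ramanujanPsi.differentiableAt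
      (Metric.ball_mem_nhds 0 one_pos)).continuousAt
    refine hc.div (ContinuousAt.comp_of_eq hc (continuousAt_id.pow 9) (by simp)) ?_
    exact ramanujanPsi_ne_zero (by simp)
  have h1 := ((h0.tendsto.comp tendsto_nome).isBigO_one ℂ).mul
    (isBigO_refl (fun τ : ℍ => w τ) atImInfty)
  refine (h1.congr_left fun τ => ?_).trans (IsBigO.of_bound 1 (Eventually.of_forall fun τ => by simp))
  simp only [Function.comp]
  have e := w_eq_hauptDisc τ.im_pos
  have n1 := ramanujanPsi_ne_zero (norm_nome_lt_one τ)
  have n9 := ramanujanPsi_ne_zero (norm_pow_lt_one (norm_nome_lt_one τ) (k := 9) (by norm_num))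
  rw [show w τ = nome τ * ramanujanPsi (nome τ ^ 9) / ramanujanPsi (nome τ) from e]
  field_simp

lemma map_eval₂_int {R S : Type*} [CommRing R] [CommRing S] (f : R →+* S) (x : R)
    (P : Polynomial ℤ) : f (P.eval₂ (Int.castRingHom R) x) = P.eval₂ (Int.castRingHom S) (f x) := by
  rw [Polynomial.hom_eval₂, RingHom.eq_intCast' (f.comp _)]

/-- An integral power series agrees to any order with a polynomial in `wSeries`. -/
lemma exists_polynomial_approx (φ : ℤ⟦X⟧) (m : ℕ) :
    ∃ P : Polynomial ℤ, P.natDegree ≤ m ∧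
      PowerSeries.X ^ (m + 1) ∣ φ - P.eval₂ (Int.castRingHom ℤ⟦X⟧) wSeries := by
  have hW : (PowerSeries.X : ℤ⟦X⟧) ∣ wSeries := ⟨_, rfl⟩
  induction m with
  | zero =>
    refine ⟨Polynomial.C (φ.coeff 0), by simp, ?_⟩
    rw [zero_add, pow_one, PowerSeries.X_dvd_iff, Polynomial.eval₂_C]
    simp
  | succ m ih =>
    obtain ⟨P, hP, hd⟩ := ih
    -- As w begins with X, w^(m+1) begins with X^(m+1) with coefficient 1; adding c w^(m+1) corrects
    -- the next coefficient without leaving ℤ.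
    set c := (φ - P.eval₂ (Int.castRingHom ℤ⟦X⟧) wSeries).coeff (m + 1)
    refine ⟨P + Polynomial.C c * Polynomial.X ^ (m + 1), ?_, ?_⟩
    · refine (Polynomial.natDegree_add_le _ _).trans (max_le (hP.trans m.le_succ) ?_)
      exact Polynomial.natDegree_C_mul_X_pow_le _ _
    · rw [PowerSeries.X_pow_dvd_iff]
      intro k hk
      rw [Polynomial.eval₂_add, Polynomial.eval₂_mul, Polynomial.eval₂_C, Polynomial.eval₂_X_pow, ← sub_sub,
        map_sub, show Int.castRingHom ℤ⟦X⟧ c = PowerSeries.C c from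
          (RingHom.congr_fun (RingHom.eq_intCast' PowerSeries.C) c).symm, PowerSeries.coeff_C_mul]
      have hWm : PowerSeries.X ^ (m + 1) ∣ wSeries ^ (m + 1) := pow_dvd_pow_of_dvd hW _
      rcases (Nat.lt_succ_iff.1 hk).lt_or_eq with hk' | rfl
      · rw [PowerSeries.X_pow_dvd_iff.1 hd k hk', PowerSeries.X_pow_dvd_iff.1 hWm k hk']
        ring
      · have : (wSeries ^ (m + 1)).coeff (m + 1) = 1 := by
          rw [wSeries, mul_pow, PowerSeries.coeff_X_pow_mul', if_pos le_rfl, Nat.sub_self,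
            PowerSeries.coeff_zero_eq_constantCoeff_apply, map_pow]
          have := coeff_one_wSeries
          rw [wSeries, show (1 : ℕ) = 0 + 1 from rfl, PowerSeries.coeff_succ_X_mul,
            PowerSeries.coeff_zero_eq_constantCoeff_apply] at this
          rw [this, one_pow]
        rw [this, mul_one, sub_self]

/-- A function on the upper half plane invariant under `Γ₀(18)`, with an integral `q`-expansion,
whose poles at the cusps are dominated by those of a power of `w`, is an integral polynomial
in `w`. -/
theorem exists_polynomial_of_invariant {φ : ℤ⟦X⟧} (hφ : toComplex φ ∈ ConvSeries) {m : ℕ}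
    (hinv : ∀ γ : SL(2, ℤ), (18 : ℤ) ∣ γ 1 0 → ∀ τ : ℍ,
      evalSeries (toComplex φ) (nome (γ • τ)) = evalSeries (toComplex φ) (nome τ))
    (hgrow : ∀ γ : SL(2, ℤ), ¬ (18 : ℤ) ∣ γ 1 0 →
      (fun τ : ℍ => evalSeries (toComplex φ) (nome (γ • τ))) =O[atImInfty]
        fun τ : ℍ => w (γ • τ : ℍ) ^ m) :
    ∃ P : Polynomial ℤ, ∀ τ : ℍ,
      evalSeries (toComplex φ) (nome τ) = P.eval₂ (Int.castRingHom ℂ) (w τ) := by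
  obtain ⟨P, hPdeg, hPdvd⟩ := exists_polynomial_approx φ m
  refine ⟨P, ?_⟩
  set F : ℍ → ℂ := fun τ => evalSeries (toComplex φ) (nome τ)
  have haeval : toComplex (P.eval₂ (Int.castRingHom ℤ⟦X⟧) wSeries) =
      P.eval₂ (Int.castRingHom ℂ⟦X⟧) (toComplex wSeries) := map_eval₂_int _ _ _
  have hPmem : toComplex (P.eval₂ (Int.castRingHom ℤ⟦X⟧) wSeries) ∈ ConvSeries := by
    rw [haeval, Polynomial.eval₂_eq_sum_range]
    exact sum_mem fun i _ => mul_mem (intCast_mem _ _) (pow_mem toComplex_wSeries_mem i)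
  have hPev : ∀ τ : ℍ, evalSeries (toComplex (P.eval₂ (Int.castRingHom ℤ⟦X⟧) wSeries)) (nome τ) =
      P.eval₂ (Int.castRingHom ℂ) (w τ) := by
    intro τ
    have h1 := map_eval₂_int (ConvSeries.ev (nome τ) (norm_nome_lt_one τ))
      ⟨_, toComplex_wSeries_mem⟩ P
    have h2 := map_eval₂_int ConvSeries.subtype ⟨_, toComplex_wSeries_mem⟩ P
    rw [Subring.subtype_apply, Subring.subtype_apply] at h2
    simp only [ConvSeries.ev_apply] at h1
    rw [← w_eq_evalSeries] at h1
    rw [← h1, h2, haeval]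
  -- Division by w^m controls all cusps at once: at ∞ the numerator is O(q w^m), and elsewhere both
  -- its terms are O(w^m). So g is a form of weight 0, hence constant, and it tends to 0 at ∞.
  let g : ℍ → ℂ := fun τ => (F τ - P.eval₂ (Int.castRingHom ℂ) (w τ)) / w τ ^ m
  have hsub : ∀ τ : ℍ, evalSeries (toComplex (φ - P.eval₂ (Int.castRingHom ℤ⟦X⟧) wSeries)) (nome τ) =
      F τ - P.eval₂ (Int.castRingHom ℂ) (w τ) := by
    intro τ
    have := map_sub (ConvSeries.ev (nome τ) (norm_nome_lt_one τ)) ⟨_, hφ⟩ ⟨_, hPmem⟩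
    simp only [ConvSeries.ev_apply] at this
    rw [hPev] at this
    rw [map_sub]
    exact this
  have hmem : toComplex (φ - P.eval₂ (Int.castRingHom ℤ⟦X⟧) wSeries) ∈ ConvSeries := by
    rw [map_sub]; exact sub_mem hφ hPmem
  have hginf : Tendsto g atImInfty (𝓝 0) := by
    have h1 : (fun τ : ℍ => F τ - P.eval₂ (Int.castRingHom ℂ) (w τ)) =O[atImInfty]
        fun τ => nome τ * w τ ^ m := by
      have h2 := (evalSeries_isBigO hmem (k := m + 1) (by
        simpa using map_dvd toComplex hPdvd)).comp_tendsto tendsto_nome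
      refine (h2.congr (fun τ => hsub τ) fun τ => pow_succ' (nome τ) m).trans ?_
      exact (isBigO_refl _ _).mul (nome_isBigO_w.pow m)
    have h3 : g =O[atImInfty] nome := by
      refine (h1.mul (isBigO_refl (fun τ : ℍ => (w τ ^ m)⁻¹) _)).congr (fun τ => rfl) fun τ => ?_
      have := pow_ne_zero m (w_ne_zero τ.im_pos)
      field_simp
    exact h3.trans_tendsto tendsto_nome
  have hgbdd : ∀ γ : SL(2, ℤ), IsBoundedAtImInfty fun τ => g (γ • τ) := by
    intro γ
    by_cases h18 : (18 : ℤ) ∣ γ 1 0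
    · have : (fun τ => g (γ • τ)) = g := by
        funext τ
        simp only [g, F, hinv γ h18 τ, w_smul h18]
      rw [this]
      exact hginf.isBigO_one ℝ
    · have h1 := one_isBigO_w_smul h18
      have hP : (fun τ : ℍ => P.eval₂ (Int.castRingHom ℂ) (w (γ • τ : ℍ))) =O[atImInfty]
          fun τ : ℍ => w (γ • τ : ℍ) ^ m := by
        simp only [Polynomial.eval₂_eq_sum_range]
        refine IsBigO.fun_sum fun i hi => ?_
        have hi' : i ≤ m := (Nat.lt_succ_iff.1 (Finset.mem_range.1 hi)).trans hPdeg
        have e1 : (fun τ : ℍ => w (γ • τ : ℍ) ^ i) =O[atImInfty]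
            fun τ : ℍ => w (γ • τ : ℍ) ^ m := by
          refine ((h1.pow (m - i)).mul (isBigO_refl (fun τ : ℍ => w (γ • τ : ℍ) ^ i) _)).congr
            (fun τ => by simp) fun τ => ?_
          rw [← pow_add, Nat.sub_add_cancel hi']
        exact e1.const_mul_left ((P.coeff i : ℤ) : ℂ)
      have h3 := ((hgrow γ h18).sub hP).mul
        (isBigO_refl (fun τ : ℍ => (w (γ • τ : ℍ) ^ m)⁻¹) atImInfty)
      refine (h3.trans (IsBigO.of_bound 1 (Eventually.of_forall fun τ => ?_)) :
        (fun τ : ℍ => g (γ • τ)) =O[atImInfty] (1 : ℍ → ℝ))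
      rw [mul_inv_cancel₀ (pow_ne_zero m (w_ne_zero (γ • τ : ℍ).im_pos))]
      simp
  have hghol : DifferentiableOn ℂ (g ∘ ofComplex) {z | 0 < z.im} := by
    have hq : DifferentiableOn ℂ (fun z : ℂ => evalSeries (toComplex φ)
        (Complex.exp (2 * Real.pi * Complex.I * z))) {z | 0 < z.im} :=
      (differentiableOn_evalSeries hφ).comp (by fun_prop)
        fun z hz => mem_ball_zero_iff.2 (norm_exp_two_pi_lt_one hz)
    have hPw : DifferentiableOn ℂ (fun z : ℂ => P.eval₂ (Int.castRingHom ℂ) (w z)) {z | 0 < z.im} := by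
      simp only [Polynomial.eval₂_eq_sum_range]
      exact DifferentiableOn.fun_sum fun i _ => (differentiableOn_w.pow i).const_mul _
    refine ((hq.sub hPw).div (differentiableOn_w.pow m)
      fun z hz => pow_ne_zero m (w_ne_zero hz)).congr fun z hz => ?_
    simp only [Function.comp, g, F, nome, ofComplex_apply_of_im_pos hz]
    rfl
  have hslash : ∀ γ ∈ (CongruenceSubgroup.Gamma0 18 : Subgroup (GL (Fin 2) ℝ)),
      g ∣[(0 : ℤ)] γ = g := by
    rintro _ ⟨γ, hγ, rfl⟩
    have h18 : (18 : ℤ) ∣ γ 1 0 :=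
      (ZMod.intCast_zmod_eq_zero_iff_dvd _ 18).1 (CongruenceSubgroup.Gamma0_mem.1 hγ)
    funext τ
    refine (ModularForm.SL_slash_apply (k := 0) g γ τ).trans ?_
    simp only [neg_zero, zpow_zero, mul_one, g, F, hinv γ h18 τ, w_smul h18]
  have hcusp : ∀ {c : OnePoint ℝ},
      IsCusp c (CongruenceSubgroup.Gamma0 18 : Subgroup (GL (Fin 2) ℝ)) → c.IsBoundedAt g 0 := by
    intro c hc
    rw [Subgroup.IsArithmetic.isCusp_iff_isCusp_SL2Z] at hc
    rw [OnePoint.isBoundedAt_iff_forall_SL2Z hc]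
    intro γ _
    have : g ∣[(0 : ℤ)] γ = fun τ => g (γ • τ) := by
      funext τ
      rw [ModularForm.SL_slash_apply]
      simp
    exact this ▸ hgbdd γ
  let G : ModularForm (CongruenceSubgroup.Gamma0 18) 0 :=
    ⟨⟨g, hslash⟩, UpperHalfPlane.mdifferentiable_iff.2 hghol, hcusp⟩
  obtain ⟨c, hc⟩ := ModularForm.eq_const_of_weight_zero G
  have hc' : g = Function.const ℍ c := hc
  have hc0 : c = 0 := by
    rw [hc'] at hginf
    exact tendsto_nhds_unique tendsto_const_nhds hginf
  intro τ
  have := congrFun hc' τ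
  simp only [g, Function.const, hc0, div_eq_zero_iff, pow_ne_zero m (w_ne_zero τ.im_pos),
    or_false, sub_eq_zero] at this
  exact this

end

/-! ### Cosets, integrality of the coset product, and its reduction modulo p -/

section

open Filter Topology UpperHalfPlane Asymptotics MatrixGroups
open scoped PowerSeries ModularForm

lemma prod_comp_eq_of_injOn {ι M : Type*} [CommMonoid M] [DecidableEq ι] {s : Finset ι}
    {f : ι → ι} (hf : ∀ i ∈ s, f i ∈ s) (hinj : Set.InjOn f s) (g : ι → M) :
    ∏ i ∈ s, g (f i) = ∏ i ∈ s, g i := by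
  have him : s.image f = s :=
    Finset.eq_of_subset_of_card_le (Finset.image_subset_iff.2 hf)
      (Finset.card_image_of_injOn hinj).ge
  rw [← Finset.prod_image (f := g) hinj, him]

/-- The `b` for which `[a, b; 0, n / a]` is a primitive matrix in Hermite normal form. -/
def primitiveShifts (n a : ℕ) : Finset ℕ :=
  (Finset.range (n / a)).filter fun b => Nat.gcd a (Nat.gcd b (n / a)) = 1

/-- The pairs `(a, b)` for which `[a, b; 0, n / a]` is a primitive matrix of determinant `n` in
Hermite normal form. -/
def cosets (n : ℕ) : Finset (Σ _ : ℕ, ℕ) := n.divisors.sigma (primitiveShifts n)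

lemma mem_cosets {n : ℕ} {i : Σ _ : ℕ, ℕ} : i ∈ cosets n ↔
    (i.1 ∣ n ∧ n ≠ 0) ∧ i.2 < n / i.1 ∧ Nat.gcd i.1 (Nat.gcd i.2 (n / i.1)) = 1 := by
  rw [cosets, Finset.mem_sigma, Nat.mem_divisors, primitiveShifts, Finset.mem_filter,
    Finset.mem_range]

section Twist

variable {R S : Type*} [CommRing R] [CommRing S]

/-- The power series `∑ z ^ m c_m t ^ (k m)`, where `c_m` are the coefficients of `w`. -/
def wTwist (z : R) (k : ℕ) : R⟦X⟧ :=
  PowerSeries.mk fun m => if k ∣ m then z ^ (m / k) * (wSeries.coeff (m / k) : ℤ) else 0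

lemma map_wTwist (f : R →+* S) (z : R) (k : ℕ) :
    PowerSeries.map f (wTwist z k) = wTwist (f z) k := by
  ext m
  simp only [wTwist, PowerSeries.coeff_map, PowerSeries.coeff_mk]
  split_ifs <;> simp

lemma wTwist_eq (z : R) {k : ℕ} (hk : k ≠ 0) : wTwist z k = PowerSeries.expand k hk
    (PowerSeries.rescale z (PowerSeries.map (Int.castRingHom R) wSeries)) := by
  ext m
  rw [wTwist, PowerSeries.coeff_mk, PowerSeries.coeff_expand]
  split_ifs <;> simp

lemma coeff_wTwist_self (z : R) {k : ℕ} (hk : k ≠ 0) : (wTwist z k).coeff k = z := by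
  rw [wTwist, PowerSeries.coeff_mk, if_pos dvd_rfl, Nat.div_self (Nat.pos_of_ne_zero hk),
    coeff_one_wSeries]
  simp

lemma coeff_wTwist_of_lt (z : R) {k m : ℕ} (hm : m < k) : (wTwist z k).coeff m = 0 := by
  rw [wTwist, PowerSeries.coeff_mk]
  split_ifs with h
  · rw [Nat.eq_zero_of_dvd_of_lt h hm, Nat.zero_div, coeff_zero_wSeries]
    simp
  · rfl

/-- The leading term of the series is z t^k. -/
lemma wTwist_inj {z z' : R} (hz : z ≠ 0) (hz' : z' ≠ 0) {k k' : ℕ} (hk : k ≠ 0) (hk' : k' ≠ 0)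
    (h : wTwist z k = wTwist z' k') : k = k' ∧ z = z' := by
  have hkk : k = k' := by
    refine le_antisymm (not_lt.1 fun hlt => hz' ?_) (not_lt.1 fun hlt => hz ?_)
    · rw [← coeff_wTwist_self z' hk', ← h, coeff_wTwist_of_lt z hlt]
    · rw [← coeff_wTwist_self z hk, h, coeff_wTwist_of_lt z' hlt]
  subst hkk
  exact ⟨rfl, by rw [← coeff_wTwist_self z hk, h, coeff_wTwist_self z' hk]⟩

/-- The product `∏ (X - w(ατ))` over the cosets, as a polynomial with coefficients power series
in `t = exp(2πiτ/n)`; here `z` stands for `exp(2πi/n)`. -/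
def twistProd (n : ℕ) (z : R) : Polynomial R⟦X⟧ :=
  ∏ i ∈ cosets n, (Polynomial.X - Polynomial.C (wTwist (z ^ (i.1 * i.2)) (i.1 ^ 2)))

lemma map_twistProd (f : R →+* S) (n : ℕ) (z : R) :
    (twistProd n z).map (PowerSeries.map f) = twistProd n (f z) := by
  simp [twistProd, Polynomial.map_prod, map_wTwist]

/-- Replacing z by z^k amounts to b ↦ kb mod n/a, a permutation of the shifts that preserves gcd(a,
b, n/a) = 1. -/
lemma twistProd_pow {n : ℕ} {z : R} (hz : z ^ n = 1) {k : ℕ} (hk : k.Coprime n) :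
    twistProd n (z ^ k) = twistProd n z := by
  classical
  have key : ∀ a b, a ∣ n → z ^ (a * (k * b % (n / a))) = (z ^ k) ^ (a * b) := by
    intro a b ha
    rw [← pow_mul, show k * (a * b) = a * (k * b) by ring]
    conv_rhs => rw [← Nat.div_add_mod (k * b) (n / a)]
    rw [mul_add, pow_add, ← mul_assoc, Nat.mul_div_cancel' ha, pow_mul z n, hz, one_pow, one_mul]
  unfold twistProd
  symm
  rw [← prod_comp_eq_of_injOn (s := cosets n)
    (f := fun i : (Σ _ : ℕ, ℕ) => ⟨i.1, k * i.2 % (n / i.1)⟩)]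
  · refine Finset.prod_congr rfl fun i hi => ?_
    simp only [key i.1 i.2 (mem_cosets.1 hi).1.1]
  · rintro ⟨a, b⟩ hi
    rw [mem_cosets] at hi ⊢
    dsimp only at hi ⊢
    obtain ⟨⟨ha, hn⟩, hb, hg⟩ := hi
    have hkd : k.Coprime (n / a) := hk.coprime_dvd_right (Nat.div_dvd_of_dvd ha)
    refine ⟨⟨ha, hn⟩, Nat.mod_lt _ (by omega), ?_⟩
    rwa [← Nat.gcd_rec, Nat.gcd_comm (n / a), hkd.gcd_mul_left_cancel] 
  · rintro ⟨a, b⟩ hi ⟨a', b'⟩ hi' h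
    rw [Finset.mem_coe, mem_cosets] at hi hi'
    dsimp only at hi hi' h
    obtain ⟨rfl, h⟩ := Sigma.mk.inj_iff.1 h
    have h := eq_of_heq h
    have hkd : (n / a).gcd k = 1 := (hk.coprime_dvd_right (Nat.div_dvd_of_dvd hi.1.1)).symm
    have := (Nat.ModEq.cancel_left_of_coprime hkd h).eq_of_lt_of_lt hi.2.1 hi'.2.1
    rw [this]

end Twist

/-- By `twistProd_pow` the coefficient is fixed by the Galois group of the cyclotomic field, so it
is rational; it is also an algebraic integer. -/
lemma coeff_twistProd_mem_range {n : ℕ} (hn : n ≠ 0) {K : Type*} [Field K] [NumberField K]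
    [IsCyclotomicExtension {n} ℚ K] {z : NumberField.RingOfIntegers K}
    (hz : IsPrimitiveRoot z n) (i m : ℕ) :
    ∃ c : ℤ, ((twistProd n z).coeff i).coeff m = c := by
  have : NeZero n := ⟨hn⟩
  have := IsCyclotomicExtension.isGalois {n} ℚ K
  set x := ((twistProd n z).coeff i).coeff m
  have hzK : IsPrimitiveRoot (z : K) n :=
    hz.map_of_injective NumberField.RingOfIntegers.coe_injective
  have hx : (x : K) = ((twistProd n (z : K)).coeff i).coeff m := by
    rw [← map_twistProd (algebraMap (NumberField.RingOfIntegers K) K), Polynomial.coeff_map,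
      PowerSeries.coeff_map]
  have hfix : ∀ f : K ≃ₐ[ℚ] K, f (x : K) = x := by
    intro f
    obtain ⟨k, -, hk, hk'⟩ := hzK.isPrimitiveRoot_iff.1
      (hzK.map_of_injective f.injective)
    have h := map_twistProd (f : K →+* K) n (z : K)
    rw [show (f : K →+* K) (z : K) = (z : K) ^ k from hk'.symm, twistProd_pow hzK.pow_eq_one hk]
      at h
    rw [hx]
    conv_rhs => rw [← h, Polynomial.coeff_map, PowerSeries.coeff_map]
    rfl
  obtain ⟨r, hr⟩ := (IsGalois.mem_range_algebraMap_iff_fixed (F := ℚ) (x : K)).2 hfix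
  have hint : IsIntegral ℤ r := by
    rw [← isIntegral_algebraMap_iff (algebraMap ℚ K).injective, hr]
    exact x.isIntegral_coe
  obtain ⟨c, hc⟩ := IsIntegrallyClosed.isIntegral_iff.1 hint
  refine ⟨c, NumberField.RingOfIntegers.coe_injective ?_⟩
  change (x : K) = _
  rw [← hr, ← hc]
  simp

/-- The residue field at a maximal ideal containing p; there is one because 1/p is not integral. -/
lemma exists_ringHom_charP (K : Type) [Field K] [NumberField K] {p : ℕ} (hp : p.Prime) :
    ∃ (L : Type) (_ : Field L) (_ : CharP L p), Nonempty (NumberField.RingOfIntegers K →+* L) := by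
  have hne : Ideal.span {(p : NumberField.RingOfIntegers K)} ≠ ⊤ := by
    rw [Ne, Ideal.span_singleton_eq_top]
    intro h
    obtain ⟨y, hy⟩ := h.exists_right_inv
    have h1 : IsIntegral ℤ ((p : ℚ)⁻¹) := by
      rw [← isIntegral_algebraMap_iff (algebraMap ℚ K).injective]
      convert y.isIntegral_coe using 1
      have h2 := congrArg (algebraMap (NumberField.RingOfIntegers K) K) hy
      rw [map_mul, map_natCast, map_one] at h2
      rw [map_inv₀, map_natCast]
      exact (eq_inv_of_mul_eq_one_right h2).symm
    obtain ⟨m, hm⟩ := IsIntegrallyClosed.isIntegral_iff.1 h1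
    have h3 : (p : ℤ) * m = 1 := by
      have : (p : ℚ) * m = 1 := by
        rw [show (m : ℚ) = (p : ℚ)⁻¹ from hm]
        exact mul_inv_cancel₀ (by exact_mod_cast hp.ne_zero)
      exact_mod_cast this
    exact (Nat.prime_iff_prime_int.1 hp).not_isUnit (IsUnit.of_mul_eq_one _ h3)
  obtain ⟨M, hM, hle⟩ := Ideal.exists_le_maximal _ hne
  let _ : Field (NumberField.RingOfIntegers K ⧸ M) := Ideal.Quotient.field M
  have hp0 : (p : NumberField.RingOfIntegers K ⧸ M) = 0 := by
    rw [← map_natCast (Ideal.Quotient.mk M)]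
    exact Ideal.Quotient.eq_zero_iff_mem.2 (hle (Ideal.mem_span_singleton_self _))
  exact ⟨_, inferInstance, ringChar.of_eq (CharP.ringChar_of_prime_eq_zero hp hp0),
    ⟨Ideal.Quotient.mk M⟩⟩

/-- The coset product has rational integral coefficients, and reduces modulo a prime `n` to the
product with `exp(2πi/n)` replaced by `1`. -/
theorem exists_integral_twistProd {n : ℕ} (hn : n ≠ 0) {ζ : ℂ} (hζ : IsPrimitiveRoot ζ n) :
    ∃ Q : Polynomial ℤ⟦X⟧, Q.map toComplex = twistProd n ζ ∧
      (n.Prime → ∃ (L : Type) (_ : Field L) (_ : CharP L n),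
        Q.map (PowerSeries.map (Int.castRingHom L)) = twistProd n (1 : L)) := by
  have : NeZero n := ⟨hn⟩
  let K := CyclotomicField n ℚ
  have : IsCyclotomicExtension {n} ℚ K := CyclotomicField.isCyclotomicExtension n ℚ
  have : NumberField K := IsCyclotomicExtension.numberField {n} ℚ K
  let φ : K →+* ℂ := Classical.arbitrary _
  have hζ₀ := IsCyclotomicExtension.zeta_spec n ℚ K
  -- The embedding sends the standard generator to some primitive root; its j-th power is the one
  -- that goes to the prescribed ζ.
  obtain ⟨j, -, hj, hjζ⟩ := (hζ₀.map_of_injective φ.injective).isPrimitiveRoot_iff.1 hζ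
  have hζK : IsPrimitiveRoot (IsCyclotomicExtension.zeta n ℚ K ^ j) n := hζ₀.pow_of_coprime j hj
  let z : NumberField.RingOfIntegers K := hζK.toInteger
  have hz : IsPrimitiveRoot z n := hζK.toInteger_isPrimitiveRoot
  choose c hc using fun i m => coeff_twistProd_mem_range hn hz i m
  let Q : Polynomial ℤ⟦X⟧ := ∑ i ∈ Finset.range ((twistProd n z).natDegree + 1),
    Polynomial.monomial i (PowerSeries.mk (c i))
  have hQ : Q.map (PowerSeries.map (Int.castRingHom (NumberField.RingOfIntegers K))) =
      twistProd n z := by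
    conv_rhs => rw [(twistProd n z).as_sum_range]
    rw [Polynomial.map_sum]
    refine Finset.sum_congr rfl fun i _ => ?_
    rw [Polynomial.map_monomial]
    congr 1
    ext m
    simp [hc]
  have hQf : ∀ {S : Type} [CommRing S] (f : NumberField.RingOfIntegers K →+* S),
      Q.map (PowerSeries.map (Int.castRingHom S)) = twistProd n (f z) := by
    intro S _ f
    rw [← map_twistProd f, ← hQ, Polynomial.map_map, ← PowerSeries.map_comp,
      RingHom.eq_intCast' (f.comp _)]
  refine ⟨Q, ?_, fun hp => ?_⟩
  · rw [toComplex, hQf (φ.comp (algebraMap (NumberField.RingOfIntegers K) K)), ← hjζ, ← map_pow]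
    rfl
  · obtain ⟨L, _, hL, ⟨f⟩⟩ := exists_ringHom_charP K hp
    refine ⟨L, _, hL, ?_⟩
    rw [hQf f]
    congr 1
    have : Fact n.Prime := ⟨hp⟩
    -- In characteristic n, z^n - 1 = (z - 1)^n, so the image of z is 1.
    have h1 : f z ^ n = 1 := by rw [← map_pow, hz.pow_eq_one, map_one]
    rw [← sub_eq_zero] at h1 ⊢
    rw [← one_pow n, ← sub_pow_char] at h1
    exact (pow_eq_zero_iff hn).1 h1

/-- Write w(t) for the series. The p cosets with a = 1 all give X - w(t), whose p-th power is X^p -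
w(t^p) by Frobenius; the coset with a = p gives X - w(t^(p²)) = X - w(t^p)^p. Here w(t^p) is the
expansion of w(τ), the future Y. -/
lemma twistProd_one_of_prime {p : ℕ} [hp : Fact p.Prime] (L : Type*) [Field L] [CharP L p] :
    twistProd p (1 : L) =
      (Polynomial.X ^ p - Polynomial.C (wTwist 1 p)) *
        (Polynomial.X - Polynomial.C (wTwist 1 p ^ p)) := by
  have hfrob : ∀ k : ℕ, k ≠ 0 → wTwist (1 : L) k ^ p = wTwist 1 (p * k) := by
    intro k hk
    rw [← MvPowerSeries.map_frobenius_expand p hp.out.ne_zero (f := wTwist (1 : L) k)]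
    change PowerSeries.map (frobenius L p) (PowerSeries.expand p hp.out.ne_zero (wTwist 1 k)) = _
    rw [PowerSeries.map_expand, map_wTwist, map_one, wTwist_eq 1 hk,
      wTwist_eq 1 (mul_ne_zero hp.out.ne_zero hk), PowerSeries.expand_mul]
  have hp0 := hp.out.pos
  rw [twistProd, cosets, Finset.prod_sigma, hp.out.divisors,
    Finset.prod_pair hp.out.one_lt.ne]
  have h1 : primitiveShifts p 1 = Finset.range p := by simp [primitiveShifts]
  have h2 : primitiveShifts p p = {0} := by
    ext b
    simp only [primitiveShifts, Nat.div_self hp0, Finset.mem_filter, Finset.mem_range,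
      Finset.mem_singleton, Nat.lt_one_iff, Nat.gcd_one_right, and_true]
  rw [h1, h2]
  rw [Finset.prod_singleton]
  simp only [one_pow, Finset.prod_const, Finset.card_range]
  rw [hfrob p hp.out.ne_zero, ← sq]
  have : CharP L⟦X⟧ p := charP_of_injective_ringHom PowerSeries.C_injective p
  rw [sub_pow_char, ← Polynomial.C_pow, hfrob 1 one_ne_zero, mul_one]

end

/-! ### The functions w((aτ + b)/d): expansions, action of SL₂(ℤ), growth -/

section

open Filter Topology UpperHalfPlane Asymptotics MatrixGroups
open scoped PowerSeries ModularForm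

/-- The parameter `exp(2πiτ/n)`. -/
def rootNome (n : ℕ) (τ : ℍ) : ℂ := Complex.exp (2 * Real.pi * Complex.I * (τ / n))

/-- The root of unity `exp(2πi/n)`. -/
def unityRoot (n : ℕ) : ℂ := Complex.exp (2 * Real.pi * Complex.I / n)

lemma isPrimitiveRoot_unityRoot {n : ℕ} (hn : n ≠ 0) : IsPrimitiveRoot (unityRoot n) n :=
  Complex.isPrimitiveRoot_exp n hn

lemma norm_unityRoot_pow (n k : ℕ) : ‖unityRoot n ^ k‖ = 1 := by
  rw [norm_pow, unityRoot, show 2 * (Real.pi : ℂ) * Complex.I / n =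
    ((2 * Real.pi / n : ℝ) : ℂ) * Complex.I by push_cast; ring, Complex.norm_exp_ofReal_mul_I,
    one_pow]

lemma unityRoot_pow_ne_zero (n k : ℕ) : unityRoot n ^ k ≠ 0 := pow_ne_zero _ (Complex.exp_ne_zero _)

lemma rootNome_pow {n : ℕ} (hn : n ≠ 0) (τ : ℍ) : rootNome n τ ^ n = nome τ := by
  have : (n : ℂ) ≠ 0 := by exact_mod_cast hn
  rw [rootNome, nome, ← Complex.exp_nat_mul]
  congr 1
  field_simp

lemma norm_rootNome_lt_one {n : ℕ} (hn : n ≠ 0) (τ : ℍ) : ‖rootNome n τ‖ < 1 := by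
  rw [← pow_lt_one_iff_of_nonneg (norm_nonneg _) hn, ← norm_pow, rootNome_pow hn]
  exact norm_nome_lt_one τ

lemma exists_rootNome_eq {n : ℕ} (hn : n ≠ 0) {t : ℂ} (ht : ‖t‖ < 1) (ht0 : t ≠ 0) :
    ∃ τ : ℍ, rootNome n τ = t := by
  have hπ : (Real.pi : ℂ) ≠ 0 := by exact_mod_cast Real.pi_ne_zero
  have hn' : (n : ℂ) ≠ 0 := by exact_mod_cast hn
  have him : (n * Complex.log t / (2 * Real.pi * Complex.I)).im =
      -(n * Real.log ‖t‖ / (2 * Real.pi)) := by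
    have : n * Complex.log t / (2 * Real.pi * Complex.I) =
        ((n / (2 * Real.pi) : ℝ) : ℂ) * (-(Complex.I * Complex.log t)) := by
      push_cast
      field_simp
      rw [Complex.I_sq]
      ring
    rw [this, Complex.im_ofReal_mul, Complex.neg_im, Complex.I_mul_im, Complex.log_re]
    ring
  refine ⟨⟨n * Complex.log t / (2 * Real.pi * Complex.I), ?_⟩, ?_⟩
  · rw [him, neg_pos]
    have h1 := Real.log_neg (norm_pos_iff.2 ht0) ht
    have h2 : (0 : ℝ) < n := by exact_mod_cast Nat.pos_of_ne_zero hn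
    exact div_neg_of_neg_of_pos (mul_neg_of_pos_of_neg h2 h1) (by positivity)
  · rw [rootNome]
    conv_rhs => rw [← Complex.exp_log ht0]
    congr 1
    change 2 * Real.pi * Complex.I * (n * Complex.log t / (2 * Real.pi * Complex.I) / n) = _
    field_simp

lemma series_ext_of_rootNome {n : ℕ} (hn : n ≠ 0) {S S' : ℂ⟦X⟧} (hS : S ∈ ConvSeries)
    (hS' : S' ∈ ConvSeries)
    (h : ∀ τ, evalSeries S (rootNome n τ) = evalSeries S' (rootNome n τ)) : S = S' := by
  refine series_ext_of_evalSeries hS hS' fun t ht ht0 => ?_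
  obtain ⟨τ, rfl⟩ := exists_rootNome_eq hn ht ht0
  exact h τ

lemma hasSum_wTwist {z : ℂ} (hz : ‖z‖ = 1) {k : ℕ} (hk : k ≠ 0) {t : ℂ} (ht : ‖t‖ < 1) :
    HasSum (fun m => (wTwist z k).coeff m * t ^ m) (hauptDisc (z * t ^ k)) := by
  rw [wTwist_eq z hk]
  exact hasSum_expand (f := fun s => hauptDisc (z * s))
    (fun t ht => hasSum_rescale (fun t ht => hasSum_wSeries ht) hz ht) hk ht

lemma wTwist_mem {z : ℂ} (hz : ‖z‖ = 1) (k : ℕ) : wTwist z k ∈ ConvSeries := by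
  rcases eq_or_ne k 0 with rfl | hk
  · convert ConvSeries.zero_mem
    ext m
    simp only [wTwist, PowerSeries.coeff_mk, Nat.div_zero, coeff_zero_wSeries]
    simp
  · exact (mem_convSeries_of_hasSum fun _ ht => hasSum_wTwist hz hk ht).1

/-- The function `τ ↦ w((aτ + b)/(n/a))`. -/
def cosetFun (n : ℕ) (i : Σ _ : ℕ, ℕ) (τ : ℍ) : ℂ := w (aff i.1 i.2 (n / i.1 : ℕ) τ)

/-- The expansion of `cosetFun` in the parameter `exp(2πiτ/n)`. -/
def cosetSeries (n : ℕ) (i : Σ _ : ℕ, ℕ) : ConvSeries :=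
  ⟨wTwist (unityRoot n ^ (i.1 * i.2)) (i.1 ^ 2), wTwist_mem (norm_unityRoot_pow _ _) _⟩

lemma pos_of_mem_cosets {n : ℕ} {i : Σ _ : ℕ, ℕ} (hi : i ∈ cosets n) : 0 < i.1 :=
  Nat.pos_of_dvd_of_pos (mem_cosets.1 hi).1.1 (Nat.pos_of_ne_zero (mem_cosets.1 hi).1.2)

/-- With n = ad one has a/d = a²/n and b/d = ab/n, whence the exponents a² of t and ab of the root
of unity. -/
lemma evalSeries_cosetSeries {n : ℕ} {i : Σ _ : ℕ, ℕ} (hi : i ∈ cosets n) (τ : ℍ) :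
    evalSeries (cosetSeries n i) (rootNome n τ) = cosetFun n i τ := by
  have ha := pos_of_mem_cosets hi
  obtain ⟨⟨⟨d, hd⟩, hn⟩, hb, -⟩ := mem_cosets.1 hi
  have hdiv : n / i.1 = d := by rw [hd, Nat.mul_div_cancel_left _ ha]
  have hd0 : 0 < d := by omega
  refine (hasSum_wTwist (norm_unityRoot_pow _ _) (pow_ne_zero 2 ha.ne')
    (norm_rootNome_lt_one hn τ)).tsum_eq.trans ?_
  rw [cosetFun, w_eq_hauptDisc (UpperHalfPlane.im_pos _), coe_aff (by exact_mod_cast ha)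
    (by rw [hdiv]; exact_mod_cast hd0), hdiv]
  congr 1
  have ha' : (i.1 : ℂ) ≠ 0 := by exact_mod_cast ha.ne'
  have hd' : (d : ℂ) ≠ 0 := by exact_mod_cast hd0.ne'
  rw [unityRoot, rootNome, ← Complex.exp_nat_mul, ← Complex.exp_nat_mul, ← Complex.exp_add]
  congr 1
  rw [hd]
  push_cast
  field_simp
  ring

lemma ev_cosetSeries {n : ℕ} {i : Σ _ : ℕ, ℕ} (hi : i ∈ cosets n) (τ : ℍ) :
    ConvSeries.ev (rootNome n τ) (norm_rootNome_lt_one (mem_cosets.1 hi).1.2 τ)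
      (cosetSeries n i) = cosetFun n i τ := evalSeries_cosetSeries hi τ

/-- The leading term ζ^(ab) t^(a²) determines a, and then b because ab < n. -/
lemma cosetSeries_injOn (n : ℕ) : Set.InjOn (cosetSeries n) (cosets n) := by
  rintro ⟨a, b⟩ hi ⟨a', b'⟩ hj h
  have hi0 := pos_of_mem_cosets (Finset.mem_coe.1 hi)
  have hj0 := pos_of_mem_cosets (Finset.mem_coe.1 hj)
  obtain ⟨⟨hd, hn⟩, hb, -⟩ := mem_cosets.1 (Finset.mem_coe.1 hi)
  obtain ⟨-, hb', -⟩ := mem_cosets.1 (Finset.mem_coe.1 hj)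
  dsimp only at hi0 hj0 hd hb hb'
  obtain ⟨h1, h2⟩ := wTwist_inj (unityRoot_pow_ne_zero _ _) (unityRoot_pow_ne_zero _ _)
    (pow_ne_zero 2 hi0.ne') (pow_ne_zero 2 hj0.ne') (congrArg Subtype.val h)
  dsimp only at h1 h2
  obtain rfl : a = a' := Nat.pow_left_injective two_ne_zero h1
  have hlt : ∀ c, c < n / a → a * c < n := fun c hc =>
    (Nat.mul_lt_mul_of_pos_left hc hi0).trans_eq (Nat.mul_div_cancel' hd)
  have := (isPrimitiveRoot_unityRoot hn).pow_inj (hlt b hb) (hlt b' hb') h2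
  rw [Nat.eq_of_mul_eq_mul_left hi0 this]

lemma cosetFun_injOn (n : ℕ) : Set.InjOn (cosetFun n) (cosets n) := by
  intro i hi j hj h
  refine cosetSeries_injOn n hi hj (Subtype.ext ?_)
  refine series_ext_of_rootNome (mem_cosets.1 hi).1.2 (cosetSeries n i).2 (cosetSeries n j).2
    fun τ => ?_
  rw [evalSeries_cosetSeries hi, evalSeries_cosetSeries hj, h]

/-- The role of gcd(n, 6) = 1: passing between cosets does not change gcd(c, 18), which decides both
membership in Γ₀(18) and the order at the cusp. -/
lemma gcd_eighteen_mul {n : ℕ} (hn : n.Coprime 6) {m : ℕ} (hm : m ∣ n) (x : ℤ) :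
    Int.gcd (m * x) 18 = Int.gcd x 18 := by
  have h18 : m.Coprime 18 := by
    refine (hn.coprime_dvd_left hm).mul_right (?_ : m.Coprime 3)
    exact (hn.coprime_dvd_left hm).coprime_dvd_right (by norm_num)
  rw [Int.gcd, Int.gcd, Int.natAbs_mul, Int.natAbs_natCast]
  exact h18.gcd_mul_left_cancel _

/-- The action of `SL₂(ℤ)` on the cosets. -/
lemma exists_coset_smul {n : ℕ} (hn : n.Coprime 6) {i : Σ _ : ℕ, ℕ} (hi : i ∈ cosets n)
    (γ : SL(2, ℤ)) : ∃ j ∈ cosets n, ∃ γ' : SL(2, ℤ),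
      Int.gcd (γ' 1 0) 18 = Int.gcd (γ 1 0) 18 ∧
      ∀ τ : ℍ, aff i.1 i.2 (n / i.1 : ℕ) (γ • τ) = γ' • aff j.1 j.2 (n / j.1 : ℕ) τ := by
  have ha := pos_of_mem_cosets hi
  obtain ⟨a, b⟩ := i
  obtain ⟨⟨hd, hn0⟩, hb, hg⟩ := mem_cosets.1 hi
  dsimp only at ha hd hb hg ⊢
  obtain ⟨d, rfl⟩ := hd
  rw [Nat.mul_div_cancel_left _ ha] at hb hg ⊢
  have hd0 : 0 < d := by omega
  have haZ : (0 : ℤ) < a := by exact_mod_cast ha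
  have hdZ : (0 : ℤ) < d := by exact_mod_cast hd0
  obtain ⟨γ', a', b', d', ha', hd', hb0, hbd, hdet, -, h00, h01, h10, h11⟩ :=
    exists_hermite haZ hdZ b γ
  lift a' to ℕ using ha'.le
  lift b' to ℕ using hb0
  lift d' to ℕ using hd'.le
  have hdet' : a' * d' = a * d := by exact_mod_cast hdet
  have ha'' : 0 < a' := by exact_mod_cast ha'
  have hdiv : a * d / a' = d' := by rw [← hdet', Nat.mul_div_cancel_left _ ha'']
  refine ⟨⟨a', b'⟩, mem_cosets.2 ⟨⟨⟨d', hdet'.symm⟩, hn0⟩, ?_, ?_⟩, γ', ?_, fun τ => ?_⟩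
  · rw [hdiv]; exact_mod_cast hbd
  · dsimp only
    rw [hdiv, ← Nat.dvd_one, ← hg]
    -- e divides every entry of [a, b; 0, d] γ, hence, after multiplication by γ⁻¹, every entry of
    -- [a, b; 0, d].
    set e := Nat.gcd a' (Nat.gcd b' d')
    have ea : (e : ℤ) ∣ a' := Int.natCast_dvd_natCast.2 (Nat.gcd_dvd_left _ _)
    have eb : (e : ℤ) ∣ b' :=
      Int.natCast_dvd_natCast.2 ((Nat.gcd_dvd_right _ _).trans (Nat.gcd_dvd_left _ _))
    have ed : (e : ℤ) ∣ d' :=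
      Int.natCast_dvd_natCast.2 ((Nat.gcd_dvd_right _ _).trans (Nat.gcd_dvd_right _ _))
    have k00 : (e : ℤ) ∣ a * γ 0 0 + b * γ 1 0 := h00 ▸ ea.mul_left _
    have k01 : (e : ℤ) ∣ a * γ 0 1 + b * γ 1 1 := h01 ▸ dvd_add (eb.mul_left _) (ed.mul_left _)
    have k10 : (e : ℤ) ∣ d * γ 1 0 := h10 ▸ ea.mul_left _
    have k11 : (e : ℤ) ∣ d * γ 1 1 := h11 ▸ dvd_add (eb.mul_left _) (ed.mul_left _)
    have hdetγ := SL_det γ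
    refine Nat.dvd_gcd ?_ (Nat.dvd_gcd ?_ ?_) <;> rw [← Int.natCast_dvd_natCast]
    · rw [show (a : ℤ) = (a * γ 0 0 + b * γ 1 0) * γ 1 1 - (a * γ 0 1 + b * γ 1 1) * γ 1 0 by
        linear_combination -(a : ℤ) * hdetγ]
      exact dvd_sub (k00.mul_right _) (k01.mul_right _)
    · rw [show (b : ℤ) = (a * γ 0 1 + b * γ 1 1) * γ 0 0 - (a * γ 0 0 + b * γ 1 0) * γ 0 1 by
        linear_combination -(b : ℤ) * hdetγ]
      exact dvd_sub (k01.mul_right _) (k00.mul_right _)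
    · rw [show (d : ℤ) = d * γ 1 1 * γ 0 0 - d * γ 1 0 * γ 0 1 by
        linear_combination -(d : ℤ) * hdetγ]
      exact dvd_sub (k11.mul_right _) (k10.mul_right _)
  · rw [← gcd_eighteen_mul hn ⟨d', hdet'.symm⟩ (γ' 1 0), mul_comm, ← h10,
      gcd_eighteen_mul hn (dvd_mul_left d a)]
  · rw [hdiv]
    exact aff_smul haZ hdZ ha' hd' h00 h01 h10 h11 τ

lemma eighteen_dvd_of_gcd_eq {x y : ℤ} (h : Int.gcd x 18 = Int.gcd y 18) (hy : (18 : ℤ) ∣ y) :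
    (18 : ℤ) ∣ x := by
  have h1 : (18 : ℤ) ∣ Int.gcd y 18 := Int.dvd_coe_gcd hy dvd_rfl
  rw [← h] at h1
  exact h1.trans (Int.gcd_dvd_left _ _)

/-- The product `∏ (X - w(ατ))` over the cosets. -/
def cosetPoly (n : ℕ) (τ : ℍ) : Polynomial ℂ :=
  ∏ i ∈ cosets n, (Polynomial.X - Polynomial.C (cosetFun n i τ))

/-- The matrix γ' of `exists_coset_smul` is again in Γ₀(18) and is absorbed by w, so γ permutes the
factors; the map on cosets is injective since the coset functions are distinct. -/
lemma cosetPoly_smul {n : ℕ} (hn : n.Coprime 6) {γ : SL(2, ℤ)} (hγ : (18 : ℤ) ∣ γ 1 0) (τ : ℍ) :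
    cosetPoly n (γ • τ) = cosetPoly n τ := by
  classical
  have h : ∀ i ∈ cosets n, ∃ j ∈ cosets n, ∀ τ, cosetFun n i (γ • τ) = cosetFun n j τ := by
    intro i hi
    obtain ⟨j, hj, γ', hg, h⟩ := exists_coset_smul hn hi γ
    refine ⟨j, hj, fun τ => ?_⟩
    rw [cosetFun, h, w_smul (eighteen_dvd_of_gcd_eq hg hγ)]
    rfl
  choose! f hf hfτ using h
  have hinj : Set.InjOn f (cosets n) := by
    intro i hi j hj hij
    refine cosetFun_injOn n hi hj (funext fun τ => ?_)
    rw [← smul_inv_smul γ τ, hfτ i hi, hfτ j hj, hij]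
  rw [cosetPoly, cosetPoly, ← prod_comp_eq_of_injOn hf hinj
    (fun i => Polynomial.X - Polynomial.C (cosetFun n i τ))]
  exact Finset.prod_congr rfl fun i hi => by rw [hfτ i hi]

lemma coeff_prod_isBigO {ι α : Type*} {l : Filter α} {g : α → ℂ} (hg : (fun _ => (1 : ℂ)) =O[l] g)
    (s : Finset ι) {f : ι → α → ℂ} (hf : ∀ i ∈ s, f i =O[l] g) (k : ℕ) :
    (fun x => (∏ i ∈ s, (Polynomial.X - Polynomial.C (f i x))).coeff k) =O[l]
      fun x => g x ^ s.card := by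
  classical
  induction s using Finset.induction_on generalizing k with
  | empty =>
    simp only [Finset.prod_empty, Finset.card_empty, pow_zero, Polynomial.coeff_one]
    exact isBigO_const_const _ one_ne_zero _
  | insert i s hi ih =>
    have ih' := ih fun j hj => hf j (Finset.mem_insert_of_mem hj)
    simp only [Finset.prod_insert hi, Finset.card_insert_of_notMem hi, sub_mul,
      Polynomial.coeff_sub, Polynomial.coeff_C_mul, pow_succ']
    refine IsBigO.sub ?_ ((hf i (Finset.mem_insert_self _ _)).mul (ih' k))
    cases k with
    | zero => simpa using isBigO_zero _ _
    | succ k =>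
      simp only [Polynomial.coeff_X_mul]
      simpa using hg.mul (ih' k)

/-- Each root is bounded by w^n at this cusp. The exponent is crude, since some power of w is all
that is required. -/
lemma coeff_cosetPoly_isBigO {n : ℕ} (hn : n.Coprime 6) {γ : SL(2, ℤ)}
    (hγ : ¬ (18 : ℤ) ∣ γ 1 0) (k : ℕ) :
    (fun τ : ℍ => (cosetPoly n (γ • τ)).coeff k) =O[atImInfty]
      fun τ : ℍ => w (γ • τ : ℍ) ^ (n * (cosets n).card) := by
  simp only [pow_mul]
  refine coeff_prod_isBigO (g := fun τ : ℍ => w (γ • τ : ℍ) ^ n)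
    (by simpa using (one_isBigO_w_smul hγ).pow n) _ (fun i hi => ?_) k
  obtain ⟨j, hj, γ', hg, h⟩ := exists_coset_smul hn hi γ
  have hj0 := pos_of_mem_cosets hj
  obtain ⟨⟨hd, hn0⟩, hb, -⟩ := mem_cosets.1 hj
  refine (w_smul_aff_isBigO (γ := γ) (γ' := γ') (a := j.1) (d := (n / j.1 : ℕ)) (b := j.2)
    (by exact_mod_cast hj0) (by exact_mod_cast (by omega : 0 < n / j.1)) ?_ hγ hg).congr_left
    fun τ => ?_
  · exact_mod_cast Nat.mul_div_cancel' hd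
  · rw [cosetFun, h]

lemma map_ev_twistProd {n : ℕ} (hn : n ≠ 0) (τ : ℍ) (k : ℕ) :
    (twistProd n (unityRoot n)).coeff k ∈ ConvSeries ∧
      evalSeries ((twistProd n (unityRoot n)).coeff k) (rootNome n τ) =
        (cosetPoly n τ).coeff k := by
  let P : Polynomial ConvSeries :=
    ∏ i ∈ cosets n, (Polynomial.X - Polynomial.C (cosetSeries n i))
  have h1 : twistProd n (unityRoot n) = P.map ConvSeries.subtype := by
    simp only [P, Polynomial.map_prod, Polynomial.map_sub, Polynomial.map_X, Polynomial.map_C]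
    rfl
  have h2 : cosetPoly n τ = P.map (ConvSeries.ev (rootNome n τ) (norm_rootNome_lt_one hn τ)) := by
    simp only [P, Polynomial.map_prod, Polynomial.map_sub, Polynomial.map_X, Polynomial.map_C]
    exact Finset.prod_congr rfl fun i hi => by rw [← ev_cosetSeries hi]
  rw [h1, h2, Polynomial.coeff_map, Polynomial.coeff_map]
  exact ⟨(P.coeff k).2, rfl⟩

/-- The expansion of `w(τ)` in the parameter `exp(2πiτ/n)`. -/
lemma evalSeries_wTwist_one {n : ℕ} (hn : n ≠ 0) (τ : ℍ) :
    evalSeries (wTwist 1 n) (rootNome n τ) = w τ := by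
  rw [w_eq_hauptDisc τ.im_pos]
  refine (hasSum_wTwist norm_one hn (norm_rootNome_lt_one hn τ)).tsum_eq.trans ?_
  rw [rootNome_pow hn, one_mul]
  rfl

/-- The coefficients of the coset product are series in `exp(2πiτ)`. -/
lemma coeff_twistProd_eq_zero {n : ℕ} (hn : n.Coprime 6) (hn0 : n ≠ 0) (k : ℕ) {m : ℕ}
    (hm : ¬ n ∣ m) : ((twistProd n (unityRoot n)).coeff k).coeff m = 0 := by
  set S := (twistProd n (unityRoot n)).coeff k
  have hS : S ∈ ConvSeries := (map_ev_twistProd hn0 UpperHalfPlane.I k).1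
  have hz : ‖unityRoot n‖ = 1 := by simpa using norm_unityRoot_pow n 1
  have hR := mem_convSeries_of_hasSum fun t ht =>
    hasSum_rescale (fun t ht => ConvSeries.hasSum hS ht) hz ht
  -- τ ↦ τ + 1 belongs to Γ₀(18) and multiplies the parameter by ζ, so invariance reads ζ^m c_m =
  -- c_m.
  have hT : ∀ τ : ℍ, rootNome n (ModularGroup.T • τ) = unityRoot n * rootNome n τ := by
    intro τ
    rw [rootNome, rootNome, unityRoot, ← Complex.exp_add, UpperHalfPlane.modular_T_smul,
      UpperHalfPlane.coe_vadd]
    congr 1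
    push_cast
    ring
  have h : PowerSeries.rescale (unityRoot n) S = S := by
    refine series_ext_of_rootNome hn0 hR.1 hS fun τ => ?_
    rw [hR.2 _ (norm_rootNome_lt_one hn0 τ), ← hT, (map_ev_twistProd hn0 _ k).2,
      (map_ev_twistProd hn0 _ k).2, cosetPoly_smul hn (by simp [ModularGroup.T])]
  have h1 := congrArg (PowerSeries.coeff m) h
  rw [PowerSeries.coeff_rescale] at h1
  by_contra h0
  exact hm ((isPrimitiveRoot_unityRoot hn0).dvd_of_pow_eq_one m (mul_eq_right₀ h0 |>.1 h1))

/-- The coefficients of the coset product are integral polynomials in `w`. -/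
theorem exists_coeff_cosetPoly_eq {n : ℕ} (hn : n.Coprime 6) (hn0 : n ≠ 0) (k : ℕ)
    {Q : Polynomial ℤ⟦X⟧} (hQ : Q.map toComplex = twistProd n (unityRoot n)) :
    ∃ P : Polynomial ℤ, ∀ τ : ℍ,
      (cosetPoly n τ).coeff k = P.eval₂ (Int.castRingHom ℂ) (w τ) := by
  set S := Q.coeff k
  have hS : toComplex S = (twistProd n (unityRoot n)).coeff k := by
    rw [← hQ, Polynomial.coeff_map]
  -- Only exponents divisible by n occur, so the series in exp(2πiτ/n) is a series in exp(2πiτ).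
  let φ : ℤ⟦X⟧ := PowerSeries.mk fun m => S.coeff (n * m)
  have hinj : Function.Injective fun m : ℕ => n * m := fun _ _ h =>
    Nat.eq_of_mul_eq_mul_left (Nat.pos_of_ne_zero hn0) h
  have hsum : ∀ t : ℂ, ‖t‖ < 1 →
      HasSum (fun m => (toComplex φ).coeff m * (t ^ n) ^ m) (evalSeries (toComplex S) t) := by
    intro t ht
    have h1 : HasSum _ _ := ConvSeries.hasSum (hS ▸ (map_ev_twistProd hn0 UpperHalfPlane.I k).1) ht
    rw [← hinj.hasSum_iff] at h1
    · refine h1.congr_fun fun m => ?_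
      simp [φ, pow_mul]
    · intro m hm
      rw [hS, coeff_twistProd_eq_zero hn hn0 k fun ⟨c, hc⟩ => hm ⟨c, hc.symm⟩, zero_mul]
  have hφ : toComplex φ ∈ ConvSeries := by
    intro s hs
    obtain ⟨t, rfl⟩ := IsAlgClosed.exists_pow_nat_eq s (Nat.pos_of_ne_zero hn0)
    rw [norm_pow, pow_lt_one_iff_of_nonneg (norm_nonneg _) hn0] at hs
    exact (hsum t hs).summable
  have hev : ∀ τ : ℍ, evalSeries (toComplex φ) (nome τ) = (cosetPoly n τ).coeff k := by
    intro τ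
    rw [← (map_ev_twistProd hn0 τ k).2, ← hS, ← rootNome_pow hn0]
    exact (hsum _ (norm_rootNome_lt_one hn0 τ)).tsum_eq
  obtain ⟨P, hP⟩ := exists_polynomial_of_invariant hφ (m := n * (cosets n).card)
    (fun γ hγ τ => by rw [hev, hev, cosetPoly_smul hn hγ])
    (fun γ hγ => by simpa only [hev] using coeff_cosetPoly_isBigO hn hγ k)
  exact ⟨P, fun τ => by rw [← hP, hev]⟩

end

/-! ### Removal of σ, transitivity on the cosets, minimal degree of a relation -/

section

open Filter Topology UpperHalfPlane Asymptotics MatrixGroups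
open scoped PowerSeries ModularForm

/-- σ_a lies in Γ₀(18), so the invariance of w removes it. -/
lemma w_mobius_alpha {σ : ℤ → Matrix.SpecialLinearGroup (Fin 2) ℤ} (hσ : IsDiagonalLift σ)
    {n : ℕ} (hn : n.Coprime 6) {i : Σ _ : ℕ, ℕ} (hi : i ∈ cosets n) (τ : ℍ) :
    w (mobius (alpha σ n i.1 i.2) τ) = cosetFun n i τ := by
  have ha := pos_of_mem_cosets hi
  obtain ⟨⟨hd, hn0⟩, hb, -⟩ := mem_cosets.1 hi
  have hd0 : 0 < n / i.1 := by omega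
  have hcop : IsCoprime (i.1 : ℤ) 6 := by
    have := Nat.isCoprime_iff_coprime.2 (hn.coprime_dvd_left hd)
    exact_mod_cast this
  have h18 : (18 : ℤ) ∣ σ i.1 1 0 := (Int.modEq_zero_iff_dvd).1 (hσ i.1 hcop).2.2.1
  have hdC : (((n / i.1 : ℕ) : ℤ) : ℂ) ≠ 0 := by exact_mod_cast hd0.ne'
  rw [cosetFun, ← w_smul h18]
  congr 1
  rw [coe_SL_smul, coe_aff (by exact_mod_cast ha) (by exact_mod_cast hd0), mobius, alpha]
  simp only [Matrix.mul_apply, Fin.sum_univ_two, Matrix.of_apply, Matrix.cons_val', Matrix.cons_val_zero,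
    Matrix.cons_val_one, Matrix.cons_val_fin_one, mul_zero, add_zero]
  conv_rhs => rw [← mul_div_mul_right _ _ hdC, add_mul, add_mul, mul_assoc, mul_assoc,
    div_mul_cancel₀ _ hdC]
  push_cast
  congr 1 <;> ring

lemma cosetProduct_eq {σ : ℤ → Matrix.SpecialLinearGroup (Fin 2) ℤ} (hσ : IsDiagonalLift σ)
    {n : ℕ} (hn : n.Coprime 6) (τ : ℍ) : cosetProduct σ n τ = cosetPoly n τ := by
  rw [cosetPoly, cosets, Finset.prod_sigma]
  refine Finset.prod_congr rfl fun a ha => Finset.prod_congr rfl fun b hb => ?_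
  rw [← w_mobius_alpha hσ hn (i := ⟨a, b⟩) (Finset.mem_sigma.2 ⟨ha, hb⟩)]

lemma top_mem_cosets {n : ℕ} (hn : n ≠ 0) : (⟨n, 0⟩ : Σ _ : ℕ, ℕ) ∈ cosets n := by
  rw [mem_cosets]
  simp [Nat.div_self (Nat.pos_of_ne_zero hn), hn]

lemma bot_mem_cosets {n : ℕ} (hn : n ≠ 0) : (⟨1, 0⟩ : Σ _ : ℕ, ℕ) ∈ cosets n := by
  rw [mem_cosets]
  simp [hn, Nat.pos_of_ne_zero hn]

/-- If `gcd(a, b, d) = 1`, then some `a k - b` is coprime to `d`. -/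
lemma exists_isCoprime_mul_sub {a b d : ℕ} (hd : d ≠ 0) (h : Nat.gcd a (Nat.gcd b d) = 1) :
    ∃ k : ℤ, IsCoprime (d : ℤ) (a * k - b) := by
  -- A prime of d that does not divide b divides k, so ak - b ≡ -b there; a prime dividing both d
  -- and b divides neither a nor k.
  refine ⟨((∏ p ∈ d.primeFactors.filter (fun p => ¬ p ∣ b), p : ℕ) : ℤ), ?_⟩
  set k := ∏ p ∈ d.primeFactors.filter (fun p => ¬ p ∣ b), p
  rw [Int.isCoprime_iff_gcd_eq_one, Int.gcd]
  refine Nat.Coprime.gcd_eq_one (Nat.coprime_of_dvd fun p hp hpd hpx => ?_)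
  rw [Int.natAbs_natCast] at hpd
  rw [← Int.natCast_dvd] at hpx
  by_cases hpb : p ∣ b
  · have hpa : ¬ p ∣ a := fun hpa => hp.one_lt.ne' (Nat.dvd_one.1
      (h ▸ Nat.dvd_gcd hpa (Nat.dvd_gcd hpb hpd)))
    have hak : (p : ℤ) ∣ (a * k : ℕ) := by
      have := dvd_add hpx (Int.natCast_dvd_natCast.2 hpb)
      simpa using this
    rcases (hp.dvd_mul.1 (Int.natCast_dvd_natCast.1 hak)) with h1 | h1
    · exact hpa h1
    · obtain ⟨q, hq, hpq⟩ := (hp.prime.dvd_finsetProd_iff _).1 h1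
      rw [Finset.mem_filter] at hq
      rw [(Nat.prime_dvd_prime_iff_eq hp (Nat.prime_of_mem_primeFactors hq.1)).1 hpq] at hpb
      exact hq.2 hpb
  · have hpk : p ∣ k := Finset.dvd_prod_of_mem _
      (Finset.mem_filter.2 ⟨Nat.mem_primeFactors.2 ⟨hp, hpd, hd⟩, hpb⟩)
    refine hpb (Int.natCast_dvd_natCast.1 ?_)
    have := dvd_sub ((Int.natCast_dvd_natCast.2 hpk).mul_left (a : ℤ)) hpx
    simpa using this

lemma exists_SL {a b c d : ℤ} (h : a * d - b * c = 1) :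
    ∃ γ : SL(2, ℤ), γ 0 0 = a ∧ γ 0 1 = b ∧ γ 1 0 = c ∧ γ 1 1 = d :=
  ⟨⟨!![a, b; c, d], by rw [Matrix.det_fin_two_of, h]⟩, rfl, rfl, rfl, rfl⟩

/-- `Γ₀(18)` acts transitively on the cosets. -/
lemma exists_cosetFun_top_smul {n : ℕ} (hn : n.Coprime 6) {i : Σ _ : ℕ, ℕ} (hi : i ∈ cosets n) :
    ∃ γ : SL(2, ℤ), (18 : ℤ) ∣ γ 1 0 ∧ ∀ τ : ℍ, cosetFun n ⟨n, 0⟩ (γ • τ) = cosetFun n i τ := by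
  have ha := pos_of_mem_cosets hi
  obtain ⟨a, b⟩ := i
  obtain ⟨⟨hd, hn0⟩, hb, hg⟩ := mem_cosets.1 hi
  dsimp only at ha hd hb hg
  obtain ⟨d, rfl⟩ := hd
  rw [Nat.mul_div_cancel_left _ ha] at hb hg
  have hd0 : 0 < d := by omega
  obtain ⟨k, hk⟩ := exists_isCoprime_mul_sub hd0.ne' hg
  have h18 : IsCoprime (d : ℤ) 18 := by
    rw [Int.isCoprime_iff_gcd_eq_one, ← mul_one (d : ℤ), gcd_eighteen_mul hn (dvd_mul_left d a)]
    rfl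
  obtain ⟨u, v, huv⟩ := h18.mul_right hk
  -- The equation to solve is [n, 0; 0, 1] γ = γ' [a, b; 0, d]. The first row (1, k) of γ forces the
  -- first row (d, ak - b) of γ'; as d is coprime to 18(ak - b), the latter can be completed with a
  -- lower left entry divisible by 18.
  obtain ⟨γ', f00, f01, f10, f11⟩ := exists_SL (a := d) (b := a * k - b) (c := -(18 * v)) (d := u)
    (by linear_combination huv)
  obtain ⟨γ, e00, e01, e10, e11⟩ := exists_SL (a := 1) (b := k) (c := -(18 * v) * a)
    (d := -(18 * v) * b + u * d) (by linear_combination huv)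
  refine ⟨γ, ⟨-v * a, by rw [e10]; ring⟩, fun τ => ?_⟩
  have hdiv : a * d / (a * d) = 1 := Nat.div_self (Nat.pos_of_ne_zero hn0)
  have haZ : (0 : ℤ) < a := by exact_mod_cast ha
  have hdZ : (0 : ℤ) < d := by exact_mod_cast hd0
  simp only [cosetFun]
  rw [aff_smul (a' := a) (b' := b) (d' := (a * d / a : ℕ)) (γ' := γ')
    (by exact_mod_cast Nat.pos_of_ne_zero hn0) (by rw [hdiv]; exact one_pos) haZ, w_smul]
  · exact ⟨-v, by rw [f10]; ring⟩
  · rw [Nat.mul_div_cancel_left _ ha]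
    exact hdZ
  · rw [e00, e10, f00]; push_cast; ring
  · rw [e01, e11, f00, f01, Nat.mul_div_cancel_left _ ha]; push_cast; ring
  · rw [hdiv, e10, f10]; push_cast; ring
  · rw [hdiv, e11, f10, f11, Nat.mul_div_cancel_left _ ha]; push_cast; ring

-- Without its largest power of the variable, P has a nonzero constant term, which survives the
-- substitution of a series without constant term.
open Polynomial in
lemma eval₂_C_injective {R : Type*} [CommRing R] [IsDomain R] {V : R⟦X⟧}
    (h0 : PowerSeries.constantCoeff V = 0) (hV : V ≠ 0) :
    Function.Injective (eval₂RingHom PowerSeries.C V) := by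
  rw [injective_iff_map_eq_zero]
  intro P hP
  by_contra hne
  obtain ⟨P', hP', hnd⟩ := exists_eq_pow_rootMultiplicity_mul_and_not_dvd P hne 0
  rw [C_0, sub_zero] at hP' hnd
  rw [hP', map_mul, map_pow, coe_eval₂RingHom, eval₂_X] at hP
  rcases mul_eq_zero.1 hP with h | h
  · exact hV (by by_contra hV'; exact pow_ne_zero _ hV' h)
  · have := congrArg PowerSeries.constantCoeff h
    rw [hom_eval₂, h0, map_zero, ← eval_map, PowerSeries.constantCoeff_comp_C, Polynomial.map_id,
      ← coeff_zero_eq_eval_zero] at this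
    exact hnd (X_dvd_iff.2 this)

/-- Constant power series. -/
def ConvSeries.C : ℂ →+* ConvSeries :=
  PowerSeries.C.codRestrict ConvSeries fun c t _ =>
    summable_of_ne_finset_zero (s := {0}) fun k hk => by
      rw [PowerSeries.coeff_C, if_neg (by simpa using hk), zero_mul]

lemma ConvSeries.ev_C {t : ℂ} (ht : ‖t‖ < 1) (c : ℂ) : ConvSeries.ev t ht (ConvSeries.C c) = c := by
  rw [ConvSeries.ev_apply]
  refine (tsum_eq_single 0 fun k hk => ?_).trans ?_
  · rw [show ((ConvSeries.C c : ConvSeries) : ℂ⟦X⟧) = PowerSeries.C c from rfl,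
      PowerSeries.coeff_C, if_neg hk, zero_mul]
  · rw [show ((ConvSeries.C c : ConvSeries) : ℂ⟦X⟧) = PowerSeries.C c from rfl]
    simp

/-- The expansion of a polynomial in `w(τ)` in the parameter `exp(2πiτ/n)`. -/
def polyInW (n : ℕ) : Polynomial ℂ →+* ConvSeries :=
  Polynomial.eval₂RingHom ConvSeries.C ⟨wTwist 1 n, wTwist_mem norm_one n⟩

lemma ev_polyInW {n : ℕ} (hn : n ≠ 0) (τ : ℍ) (P : Polynomial ℂ) :
    ConvSeries.ev (rootNome n τ) (norm_rootNome_lt_one hn τ) (polyInW n P) = P.eval (w τ) := by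
  rw [polyInW, Polynomial.coe_eval₂RingHom, Polynomial.hom_eval₂, ConvSeries.ev_apply,
    evalSeries_wTwist_one hn,
    show (ConvSeries.ev (rootNome n τ) _).comp ConvSeries.C = RingHom.id ℂ from
      RingHom.ext fun c => ConvSeries.ev_C (norm_rootNome_lt_one hn τ) c]
  rfl

lemma constantCoeff_wTwist {R : Type*} [CommRing R] (z : R) {n : ℕ} (hn : n ≠ 0) :
    PowerSeries.constantCoeff (wTwist z n) = 0 := by
  rw [← PowerSeries.coeff_zero_eq_constantCoeff_apply,
    coeff_wTwist_of_lt z (Nat.pos_of_ne_zero hn)]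

lemma wTwist_ne_zero {R : Type*} [CommRing R] {z : R} (hz : z ≠ 0) {n : ℕ} (hn : n ≠ 0) :
    wTwist z n ≠ 0 := fun h => hz (by rw [← coeff_wTwist_self z hn, h, map_zero])

lemma polyInW_injective {n : ℕ} (hn : n ≠ 0) : Function.Injective (polyInW n) := by
  have h := eval₂_C_injective (constantCoeff_wTwist (1 : ℂ) hn) (wTwist_ne_zero one_ne_zero hn)
  have h2 : (ConvSeries.subtype.comp (polyInW n)) =
      Polynomial.eval₂RingHom PowerSeries.C (wTwist 1 n) := by
    refine Polynomial.ringHom_ext (fun a => ?_) ?_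
    · simp [polyInW]; rfl
    · simp [polyInW]
  rw [← h2] at h
  exact Function.Injective.of_comp (f := ConvSeries.subtype) h

lemma ConvSeries.ext_of_rootNome {n : ℕ} (hn : n ≠ 0) {S S' : ConvSeries}
    (h : ∀ τ, ConvSeries.ev (rootNome n τ) (norm_rootNome_lt_one hn τ) S =
      ConvSeries.ev (rootNome n τ) (norm_rootNome_lt_one hn τ) S') : S = S' :=
  Subtype.ext (series_ext_of_rootNome hn S.2 S'.2 h)

/-- w is transcendental over ℂ, its expansion being a nonzero series without constant term. -/
lemma eq_of_forall_eval_w {P P' : Polynomial ℂ} (h : ∀ τ : ℍ, P.eval (w τ) = P'.eval (w τ)) :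
    P = P' :=
  polyInW_injective one_ne_zero <| ConvSeries.ext_of_rootNome one_ne_zero fun τ => by
    rw [ev_polyInW one_ne_zero, ev_polyInW one_ne_zero, h]

/-- A relation between `w(τ)` and `w(nτ)` holds between `w(τ)` and `w(ατ)` for all cosets. -/
lemma eval_cosetSeries_eq_zero {n : ℕ} (hn : n.Coprime 6) (hn0 : n ≠ 0)
    {f : Polynomial (Polynomial ℂ)}
    (hf : (f.map (polyInW n)).eval (cosetSeries n ⟨n, 0⟩) = 0) {i : Σ _ : ℕ, ℕ}
    (hi : i ∈ cosets n) : (f.map (polyInW n)).eval (cosetSeries n i) = 0 := by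
  have key : ∀ j ∈ cosets n, ∀ τ : ℍ,
      ConvSeries.ev (rootNome n τ) (norm_rootNome_lt_one hn0 τ)
        ((f.map (polyInW n)).eval (cosetSeries n j)) =
      (f.map (Polynomial.evalRingHom (w τ))).eval (cosetFun n j τ) := by
    intro j hj τ
    rw [Polynomial.eval_map, Polynomial.hom_eval₂, ev_cosetSeries hj, Polynomial.eval_map]
    congr 1
    exact RingHom.ext fun P => ev_polyInW hn0 τ P
  refine ConvSeries.ext_of_rootNome hn0 fun τ => ?_
  obtain ⟨γ, hγ, h⟩ := exists_cosetFun_top_smul hn hi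
  -- Moving τ by γ carries w(nτ) to the i-th coset function and leaves w(τ) alone.
  rw [key i hi, ← h, ← w_smul hγ, ← key _ (top_mem_cosets hn0), hf, map_zero, map_zero]

/-- All coset functions are roots of f, and they are distinct elements of the domain `ConvSeries`.
-/
lemma card_le_natDegree {n : ℕ} (hn : n.Coprime 6) (hn0 : n ≠ 0)
    {f : Polynomial (Polynomial ℂ)} (hf0 : f ≠ 0)
    (hf : (f.map (polyInW n)).eval (cosetSeries n ⟨n, 0⟩) = 0) :
    (cosets n).card ≤ f.natDegree := by
  classical
  by_contra! hlt
  have h0 := Polynomial.eq_zero_of_natDegree_lt_card_of_eval_eq_zero' (f.map (polyInW n))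
    ((cosets n).image (cosetSeries n)) (by
      intro x hx
      obtain ⟨i, hi, rfl⟩ := Finset.mem_image.1 hx
      exact eval_cosetSeries_eq_zero hn hn0 hf hi) (by
      rw [Finset.card_image_of_injOn (cosetSeries_injOn n)]
      exact (Polynomial.natDegree_map_le).trans_lt hlt)
  exact hf0 ((Polynomial.map_eq_zero_iff (polyInW_injective hn0)).1 h0)

end

/-! ### The modular polynomial over ℤ[Y] and its irreducibility -/

section

open UpperHalfPlane
open scoped PowerSeries Polynomial

/-- The expansion of an integral polynomial in `w(τ)` in the parameter `exp(2πiτ/n)`. -/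
def intPolyInW (n : ℕ) : ℤ[X] →+* ConvSeries :=
  (polyInW n).comp (Polynomial.mapRingHom (Int.castRingHom ℂ))

lemma mapRingHom_int_injective :
    Function.Injective (Polynomial.mapRingHom (Int.castRingHom ℂ)) :=
  Polynomial.map_injective _ Int.cast_injective

lemma intPolyInW_injective {n : ℕ} (hn : n ≠ 0) : Function.Injective (intPolyInW n) :=
  (polyInW_injective hn).comp mapRingHom_int_injective

lemma map_intPolyInW (n : ℕ) (B : ℤ[X][X]) : B.map (intPolyInW n) =
    (B.map (Polynomial.mapRingHom (Int.castRingHom ℂ))).map (polyInW n) := by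
  rw [Polynomial.map_map, intPolyInW]

lemma ev_intPolyInW {n : ℕ} (hn : n ≠ 0) (τ : ℍ) (P : ℤ[X]) :
    ConvSeries.ev (rootNome n τ) (norm_rootNome_lt_one hn τ) (intPolyInW n P) =
      P.eval₂ (Int.castRingHom ℂ) (w τ) := by
  rw [intPolyInW, RingHom.comp_apply, ev_polyInW hn, Polynomial.coe_mapRingHom, Polynomial.eval_map]

lemma coe_intPolyInW (n : ℕ) (P : ℤ[X]) : (intPolyInW n P : ℂ⟦X⟧) =
    toComplex (P.eval₂ (Int.castRingHom ℤ⟦X⟧) (wTwist 1 n)) := by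
  have : (toComplex.comp (Polynomial.eval₂RingHom (Int.castRingHom ℤ⟦X⟧) (wTwist 1 n))) =
      ConvSeries.subtype.comp (intPolyInW n) := by
    refine Polynomial.ringHom_ext (fun a => by simp) ?_
    simp [intPolyInW, polyInW, map_wTwist]
  exact (RingHom.congr_fun this P).symm

lemma toComplex_injective : Function.Injective toComplex :=
  PowerSeries.map_injective _ Int.cast_injective

/-- `B` is the polynomial `∏ (X - w(ατ))`, with its coefficients written as polynomials
in `w(τ)`. -/
def IsCosetPolynomial (n : ℕ) (B : ℤ[X][X]) : Prop :=
  B.map (intPolyInW n) = ∏ i ∈ cosets n, (Polynomial.X - Polynomial.C (cosetSeries n i))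

/-- The congruence may be checked on expansions: over a field of characteristic n = p, sending Y to
the reduced series of w is injective, and `twistProd_one_of_prime` computes the image. -/
theorem exists_isCosetPolynomial {n : ℕ} (hn : n.Coprime 6) (hn0 : n ≠ 0) :
    ∃ B : ℤ[X][X], IsCosetPolynomial n B ∧ (n.Prime → (n : ℤ[X][X]) ∣
      B - (Polynomial.X ^ n - Polynomial.C Polynomial.X) *
        (Polynomial.X - Polynomial.C (Polynomial.X ^ n))) := by
  obtain ⟨Q, hQ, hp⟩ := exists_integral_twistProd hn0 (isPrimitiveRoot_unityRoot hn0)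
  choose P hP using fun k => exists_coeff_cosetPoly_eq hn hn0 k hQ
  have hdeg : ∀ τ, (cosetPoly n τ).natDegree = (cosets n).card := fun τ => by
    rw [cosetPoly, Polynomial.natDegree_prod_of_monic _ _ fun i _ => Polynomial.monic_X_sub_C _]
    simp
  let B : ℤ[X][X] := ∑ k ∈ Finset.range ((cosets n).card + 1), Polynomial.monomial k (P k)
  have hBev : ∀ k (τ : ℍ), (B.coeff k).eval₂ (Int.castRingHom ℂ) (w τ) = (cosetPoly n τ).coeff k := by
    intro k τ
    simp only [B, Polynomial.finsetSum_coeff, Polynomial.coeff_monomial, Finset.sum_ite_eq',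
      Finset.mem_range]
    split_ifs with hk
    · exact (hP k τ).symm
    · rw [Polynomial.eval₂_zero, Polynomial.coeff_eq_zero_of_natDegree_lt]
      rw [hdeg]
      omega
  have hcoeff : ∀ k, (intPolyInW n (B.coeff k) : ℂ⟦X⟧) = (twistProd n (unityRoot n)).coeff k := by
    intro k
    refine series_ext_of_rootNome hn0 (Subtype.prop _) (map_ev_twistProd hn0 I k).1 fun τ => ?_
    rw [(map_ev_twistProd hn0 τ k).2, ← hBev]
    exact ev_intPolyInW hn0 τ _
  refine ⟨B, ?_, fun hprime => ?_⟩
  · refine Polynomial.map_injective ConvSeries.subtype Subtype.val_injective ?_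
    have h1 : twistProd n (unityRoot n) = (∏ i ∈ cosets n,
        (Polynomial.X - Polynomial.C (cosetSeries n i))).map ConvSeries.subtype := by
      simp only [Polynomial.map_prod, Polynomial.map_sub, Polynomial.map_X, Polynomial.map_C]
      rfl
    rw [← h1]
    ext1 k
    rw [Polynomial.coeff_map, Polynomial.coeff_map, ← hcoeff]
    rfl
  · obtain ⟨L, _, hL, hQL⟩ := hp hprime
    have : Fact n.Prime := ⟨hprime⟩
    have hBQ : B.map (Polynomial.eval₂RingHom (Int.castRingHom ℤ⟦X⟧) (wTwist 1 n)) = Q := by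
      ext1 k
      refine toComplex_injective ?_
      rw [Polynomial.coeff_map, Polynomial.coe_eval₂RingHom, ← coe_intPolyInW, hcoeff, ← hQ,
        Polynomial.coeff_map]
    set E : ℤ[X][X] := (Polynomial.X ^ n - Polynomial.C Polynomial.X) *
        (Polynomial.X - Polynomial.C (Polynomial.X ^ n)) with hE
    have hcomp : (PowerSeries.map (Int.castRingHom L)).comp
        (Polynomial.eval₂RingHom (Int.castRingHom ℤ⟦X⟧) (wTwist 1 n)) =
        (Polynomial.eval₂RingHom PowerSeries.C (wTwist (1 : L) n)).comp
          (Polynomial.mapRingHom (Int.castRingHom L)) := by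
      refine Polynomial.ringHom_ext (fun a => by simp) ?_
      simp [map_wTwist]
    have hinj := eval₂_C_injective (constantCoeff_wTwist (1 : L) hn0)
      (wTwist_ne_zero one_ne_zero hn0)
    have hBE : B.map (Polynomial.mapRingHom (Int.castRingHom L)) =
        E.map (Polynomial.mapRingHom (Int.castRingHom L)) := by
      refine Polynomial.map_injective _ hinj ?_
      rw [Polynomial.map_map, ← hcomp, ← Polynomial.map_map, hBQ, hQL, twistProd_one_of_prime,
        Polynomial.map_map]
      simp [hE]
    have hdvd : Polynomial.C (Polynomial.C (n : ℤ)) ∣ B - E := by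
      rw [Polynomial.C_dvd_iff_dvd_coeff]
      intro i
      rw [Polynomial.C_dvd_iff_dvd_coeff]
      intro j
      rw [← CharP.intCast_eq_zero_iff L n]
      have h := congrArg (fun R : L[X][X] => (R.coeff i).coeff j) hBE
      simp only [Polynomial.coeff_map, Polynomial.coe_mapRingHom] at h
      rw [Polynomial.coeff_sub, Polynomial.coeff_sub, Int.cast_sub, sub_eq_zero]
      exact h
    simpa using hdvd

section

variable {n : ℕ} {B : ℤ[X][X]}

lemma IsCosetPolynomial.monic (hn0 : n ≠ 0) (hB : IsCosetPolynomial n B) : B.Monic := by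
  refine Polynomial.monic_of_injective (intPolyInW_injective hn0) ?_
  rw [hB]
  exact Polynomial.monic_prod_X_sub_C _ _

lemma IsCosetPolynomial.natDegree_eq (hn0 : n ≠ 0) (hB : IsCosetPolynomial n B) :
    B.natDegree = (cosets n).card := by
  rw [← Polynomial.natDegree_map_eq_of_injective (intPolyInW_injective hn0), hB,
    Polynomial.natDegree_prod_of_monic _ _ fun i _ => Polynomial.monic_X_sub_C _]
  simp

lemma IsCosetPolynomial.eval_eq_zero (hB : IsCosetPolynomial n B) {i : Σ _ : ℕ, ℕ}
    (hi : i ∈ cosets n) : (B.map (intPolyInW n)).eval (cosetSeries n i) = 0 := by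
  rw [hB, Polynomial.eval_prod]
  exact Finset.prod_eq_zero hi (by simp)

lemma IsCosetPolynomial.map_eval₂_eq (hn0 : n ≠ 0) (hB : IsCosetPolynomial n B) (τ : ℍ) :
    B.map (Polynomial.eval₂RingHom (Int.castRingHom ℂ) (w τ)) = cosetPoly n τ := by
  have h := congrArg (Polynomial.map
    (ConvSeries.ev (rootNome n τ) (norm_rootNome_lt_one hn0 τ))) hB
  rw [Polynomial.map_map] at h
  rw [show Polynomial.eval₂RingHom (Int.castRingHom ℂ) (w τ) =
    (ConvSeries.ev (rootNome n τ) (norm_rootNome_lt_one hn0 τ)).comp (intPolyInW n) from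
    RingHom.ext fun P => (ev_intPolyInW hn0 τ P).symm]
  refine h.trans ?_
  simp only [Polynomial.map_prod, Polynomial.map_sub, Polynomial.map_X, Polynomial.map_C]
  exact Finset.prod_congr rfl fun i hi => by rw [ev_cosetSeries hi]

lemma cosets_card_pos (hn0 : n ≠ 0) : 0 < (cosets n).card :=
  Finset.card_pos.2 ⟨_, top_mem_cosets hn0⟩

lemma one_lt_cosets_card (hn : 1 < n) : 1 < (cosets n).card :=
  Finset.one_lt_card.2 ⟨_, top_mem_cosets (by omega), _, bot_mem_cosets (by omega), fun h =>
    hn.ne' (Sigma.mk.inj_iff.1 h).1⟩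

/-- One of two monic factors vanishes at w(nτ), and then has full degree by `card_le_natDegree`. -/
theorem IsCosetPolynomial.irreducible (hn : n.Coprime 6) (hn0 : n ≠ 0)
    (hB : IsCosetPolynomial n B) :
    Irreducible (B.map (Polynomial.mapRingHom (Int.castRingHom ℂ))) := by
  have hmonic := (hB.monic hn0).map (Polynomial.mapRingHom (Int.castRingHom ℂ))
  have hdeg : (B.map (Polynomial.mapRingHom (Int.castRingHom ℂ))).natDegree =
      (cosets n).card := by
    rw [(hB.monic hn0).natDegree_map, hB.natDegree_eq hn0]
  rw [hmonic.irreducible_iff_natDegree]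
  refine ⟨fun h => ?_, fun f g hf hg hfg => ?_⟩
  · rw [h, Polynomial.natDegree_one] at hdeg
    exact (cosets_card_pos hn0).ne hdeg
  · have h0 := hB.eval_eq_zero (top_mem_cosets hn0)
    rw [map_intPolyInW, ← hfg, Polynomial.map_mul, Polynomial.eval_mul] at h0
    have hsum : f.natDegree + g.natDegree = (cosets n).card := by
      rw [← hdeg, ← hfg, hf.natDegree_mul hg]
    rcases mul_eq_zero.1 h0 with h | h
    · have := card_le_natDegree hn hn0 hf.ne_zero h
      omega
    · have := card_le_natDegree hn hn0 hg.ne_zero h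
      omega

/-- A relation between `w(τ)` and `w(nτ)` is a multiple of the modular equation. -/
theorem IsCosetPolynomial.dvd (hn : n.Coprime 6) (hn0 : n ≠ 0) (hB : IsCosetPolynomial n B)
    {D : ℤ[X][X]} (hD : (D.map (intPolyInW n)).eval (cosetSeries n ⟨n, 0⟩) = 0) : B ∣ D := by
  have hmonic := hB.monic hn0
  rw [← Polynomial.modByMonic_eq_zero_iff_dvd hmonic]
  by_contra hne
  -- The remainder is again a relation, of degree too small to be nonzero.
  have hr : ((D %ₘ B).map (intPolyInW n)).eval (cosetSeries n ⟨n, 0⟩) = 0 := by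
    rw [Polynomial.modByMonic_eq_sub_mul_div, Polynomial.map_sub, Polynomial.map_mul,
      Polynomial.eval_sub, Polynomial.eval_mul, hD, hB.eval_eq_zero (top_mem_cosets hn0),
      zero_mul, sub_zero]
  rw [map_intPolyInW] at hr
  have h1 := card_le_natDegree hn hn0 (fun h => hne
    ((Polynomial.map_eq_zero_iff mapRingHom_int_injective).1 h)) hr
  have h2 := Polynomial.natDegree_modByMonic_lt D hmonic fun h => by
    have := hB.natDegree_eq hn0
    rw [h, Polynomial.natDegree_one] at this
    exact (cosets_card_pos hn0).ne this
  have h3 := Polynomial.natDegree_map_le (f := Polynomial.mapRingHom (Int.castRingHom ℂ))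
    (p := D %ₘ B)
  rw [hB.natDegree_eq hn0] at h2
  omega

end

end

/-! ### The number of cosets is ψ(n) -/

section

/-- Coprimality to g has period g, so each of the k blocks contributes φ(g). -/
lemma card_filter_coprime_range (g k : ℕ) :
    ((Finset.range (g * k)).filter g.Coprime).card = k * g.totient := by
  rw [← Nat.count_eq_card_filter_range]
  induction k with
  | zero => simp
  | succ k ih =>
    rw [mul_add_one, Nat.count_add, ih, add_one_mul, Nat.totient, ← Nat.count_eq_card_filter_range]
    simp

/-- The number of `b < d` with `gcd(a, b, d) = 1`. -/
def shiftCount (a d : ℕ) : ℕ := d / Nat.gcd a d * (Nat.gcd a d).totient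

lemma card_primitiveShifts (n a : ℕ) :
    (primitiveShifts n a).card = shiftCount a (n / a) := by
  rw [shiftCount, ← card_filter_coprime_range, Nat.mul_div_cancel' (Nat.gcd_dvd_right _ _)]
  refine congrArg Finset.card (Finset.filter_congr fun b _ => ?_)
  rw [Nat.Coprime, Nat.gcd_comm b, Nat.gcd_assoc]

lemma card_cosets (n : ℕ) : (cosets n).card = ∑ a ∈ n.divisors, shiftCount a (n / a) := by
  rw [cosets, Finset.card_sigma]
  exact Finset.sum_congr rfl fun a _ => card_primitiveShifts n a

lemma shiftCount_mul {a d a' d' : ℕ} (h : (a * d).Coprime (a' * d')) :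
    shiftCount (a * a') (d * d') = shiftCount a d * shiftCount a' d' := by
  have haa : a.Coprime a' := h.coprime_mul_right.coprime_mul_right_right
  have had : a.Coprime d' := h.coprime_mul_right.coprime_mul_left_right
  have hda : d.Coprime a' := h.coprime_mul_left.coprime_mul_right_right
  have hdd : d.Coprime d' := h.coprime_mul_left.coprime_mul_left_right
  have hg : Nat.gcd (a * a') (d * d') = Nat.gcd a d * Nat.gcd a' d' := by
    rw [hdd.gcd_mul, hda.symm.gcd_mul_right_cancel, had.gcd_mul_left_cancel]
  have hcop : (Nat.gcd a d).Coprime (Nat.gcd a' d') :=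
    (haa.coprime_dvd_left (Nat.gcd_dvd_left _ _)).coprime_dvd_right (Nat.gcd_dvd_left _ _)
  rw [shiftCount, hg, Nat.totient_mul hcop,
    Nat.mul_div_mul_comm (Nat.gcd_dvd_right _ _) (Nat.gcd_dvd_right _ _), shiftCount, shiftCount]
  ring

lemma card_cosets_mul {m n : ℕ} (h : m.Coprime n) :
    (cosets (m * n)).card = (cosets m).card * (cosets n).card := by
  rw [card_cosets, card_cosets, card_cosets, Nat.divisors_mul, Finset.mul_def,
    Finset.sum_image, Finset.sum_mul_sum, Finset.sum_product]
  · refine Finset.sum_congr rfl fun a ha => Finset.sum_congr rfl fun b hb => ?_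
    have ha' := Nat.dvd_of_mem_divisors ha
    have hb' := Nat.dvd_of_mem_divisors hb
    rw [← shiftCount_mul (by rwa [Nat.mul_div_cancel' ha', Nat.mul_div_cancel' hb']),
      Nat.div_mul_div_comm ha' hb']
  · exact_mod_cast h.mul_injOn_divisors

/-- For j ≥ 1 the gcd is p^i with 1 ≤ i ≤ j, and p^(j-i) φ(p^i) = φ(p^j). -/
lemma shiftCount_prime_pow {p : ℕ} (hp : p.Prime) (k j : ℕ) :
    shiftCount (p ^ (k + 1)) (p ^ j) = (p ^ j).totient := by
  rcases j with _ | j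
  · simp [shiftCount]
  · have hg : Nat.gcd (p ^ (k + 1)) (p ^ (j + 1)) = p ^ (min k j + 1) := by
      rcases le_total k j with h | h
      · rw [Nat.gcd_eq_left (pow_dvd_pow p (by omega)), min_eq_left h]
      · rw [Nat.gcd_eq_right (pow_dvd_pow p (by omega)), min_eq_right h]
    rw [shiftCount, hg, Nat.totient_prime_pow_succ hp, Nat.totient_prime_pow_succ hp,
      Nat.pow_div (by omega) hp.pos, ← mul_assoc, ← pow_add]
    congr 2
    omega

/-- The divisor a = 1 contributes p^(e+1); the others contribute φ(p^e), …, φ(1), with sum p^e. -/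
lemma card_cosets_prime_pow {p : ℕ} (hp : p.Prime) (e : ℕ) :
    (cosets (p ^ (e + 1))).card = p ^ (e + 1) + p ^ e := by
  rw [card_cosets, Nat.sum_divisors_prime_pow hp, Finset.sum_range_succ', add_comm]
  congr 1
  · simp [shiftCount]
  · rw [← Nat.sum_totient (p ^ e), Nat.sum_divisors_prime_pow hp,
      ← Finset.sum_range_reflect (fun k => (p ^ k).totient)]
    refine Finset.sum_congr rfl fun k hk => ?_
    have := Finset.mem_range.1 hk
    rw [Nat.pow_div (by omega) hp.pos, shiftCount_prime_pow hp]
    congr 2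
    omega

lemma psi_mul {m n : ℕ} (h : m.Coprime n) : psi (m * n) = psi m * psi n := by
  rw [psi, psi, psi, h.primeFactors_mul, Finset.prod_union h.disjoint_primeFactors]
  push_cast
  ring

theorem card_cosets_eq_psi (n : ℕ) : ((cosets n).card : ℚ) = psi n := by
  induction n using Nat.recOnPosPrimePosCoprime with
  | prime_pow p e hp he =>
    obtain ⟨e, rfl⟩ := Nat.exists_eq_succ_of_ne_zero he.ne'
    have : (p : ℚ) ≠ 0 := by exact_mod_cast hp.ne_zero
    rw [Nat.succ_eq_add_one, card_cosets_prime_pow hp, psi,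
      Nat.primeFactors_prime_pow e.succ_ne_zero hp, Finset.prod_singleton]
    push_cast
    field_simp
    ring
  | zero => simp [card_cosets, psi]
  | one => simp [card_cosets, psi, shiftCount]
  | coprime m n hm hn h ihm ihn =>
    rw [card_cosets_mul h, psi_mul h, Nat.cast_mul, ihm, ihn]

end

/-! ### Bivariate polynomials: symmetry, degrees, uniqueness -/

section

open UpperHalfPlane
open scoped Polynomial

/-- Bivariate polynomials as polynomials in `X` over `ℤ[Y]`. -/
def toBivariate : MvPolynomial (Fin 2) ℤ →+* ℤ[X][X] :=
  MvPolynomial.eval₂Hom (Int.castRingHom _) ![Polynomial.X, Polynomial.C Polynomial.X]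

/-- Polynomials in `X` over `ℤ[Y]` as bivariate polynomials. -/
def ofBivariate : ℤ[X][X] →+* MvPolynomial (Fin 2) ℤ :=
  Polynomial.eval₂RingHom (Polynomial.eval₂RingHom (Int.castRingHom _) (MvPolynomial.X 1))
    (MvPolynomial.X 0)

@[simp] lemma toBivariate_X_zero : toBivariate (MvPolynomial.X 0) = Polynomial.X := by
  simp [toBivariate]

@[simp] lemma toBivariate_X_one :
    toBivariate (MvPolynomial.X 1) = Polynomial.C Polynomial.X := by
  simp [toBivariate]

@[simp] lemma ofBivariate_X : ofBivariate Polynomial.X = MvPolynomial.X 0 := by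
  simp [ofBivariate]

@[simp] lemma ofBivariate_C_X : ofBivariate (Polynomial.C Polynomial.X) = MvPolynomial.X 1 := by
  simp [ofBivariate]

lemma toBivariate_ofBivariate (B : ℤ[X][X]) : toBivariate (ofBivariate B) = B := by
  have : toBivariate.comp ofBivariate = RingHom.id _ := by
    refine Polynomial.ringHom_ext' (Polynomial.ringHom_ext' (RingHom.ext_int _ _) ?_) ?_ <;> simp
  exact RingHom.congr_fun this B

lemma mvRingHom_ext {R : Type*} [CommRing R] {f g : MvPolynomial (Fin 2) ℤ →+* R}
    (h0 : f (MvPolynomial.X 0) = g (MvPolynomial.X 0))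
    (h1 : f (MvPolynomial.X 1) = g (MvPolynomial.X 1)) : f = g := by
  refine MvPolynomial.ringHom_ext (fun r => by simp) fun i => ?_
  fin_cases i
  exacts [h0, h1]

lemma ofBivariate_toBivariate (F : MvPolynomial (Fin 2) ℤ) :
    ofBivariate (toBivariate F) = F := by
  have : ofBivariate.comp toBivariate = RingHom.id _ := mvRingHom_ext (by simp) (by simp)
  exact RingHom.congr_fun this F

lemma natDegree_toBivariate (F : MvPolynomial (Fin 2) ℤ) :
    (toBivariate F).natDegree = F.degreeOf 0 := by
  let f : MvPolynomial (Fin 1) ℤ →+* ℤ[X] :=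
    MvPolynomial.eval₂Hom (Int.castRingHom _) fun _ => Polynomial.X
  let g : ℤ[X] →+* MvPolynomial (Fin 1) ℤ :=
    Polynomial.eval₂RingHom (Int.castRingHom _) (MvPolynomial.X 0)
  have hgf : g.comp f = RingHom.id _ := by
    refine MvPolynomial.ringHom_ext (fun r => by simp) fun i => ?_
    rw [Subsingleton.elim i 0]
    simp [f, g]
  have hf : Function.Injective f := fun x y h => by
    have := congrArg g h
    rwa [← RingHom.comp_apply, ← RingHom.comp_apply, hgf] at this
  have h : toBivariate = (Polynomial.mapRingHom f).comp
      (MvPolynomial.finSuccEquiv ℤ 1 : MvPolynomial (Fin 2) ℤ →+* _) := by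
    refine mvRingHom_ext ?_ ?_
    · simp [MvPolynomial.finSuccEquiv_X_zero]
    · have := MvPolynomial.finSuccEquiv_X_succ (R := ℤ) (n := 1) (j := 0)
      rw [Fin.succ_zero_eq_one] at this
      simp [this, f]
  rw [h, RingHom.comp_apply, Polynomial.coe_mapRingHom, Polynomial.natDegree_map_eq_of_injective hf,
    ← MvPolynomial.natDegree_finSuccEquiv]
  rfl

/-- The exchange of `X` and `Y`. -/
abbrev swapXY : MvPolynomial (Fin 2) ℤ →ₐ[ℤ] MvPolynomial (Fin 2) ℤ :=
  MvPolynomial.rename (Equiv.swap (0 : Fin 2) 1)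

lemma swapXY_swapXY (F : MvPolynomial (Fin 2) ℤ) : swapXY (swapXY F) = F := by
  rw [MvPolynomial.rename_rename, ← Equiv.coe_trans, ← Equiv.Perm.mul_def, Equiv.swap_mul_self]
  exact MvPolynomial.rename_id_apply _

lemma asPolyInX_eq (F : MvPolynomial (Fin 2) ℤ) :
    asPolyInX F = ((toBivariate F).map (Polynomial.mapRingHom (Int.castRingHom ℂ))).map
      (algebraMap ℂ[X] (RatFunc ℂ)) := by
  have : (MvPolynomial.aeval ![Polynomial.X, Polynomial.C RatFunc.X] :
      MvPolynomial (Fin 2) ℤ →ₐ[ℤ] Polynomial (RatFunc ℂ)).toRingHom =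
      ((Polynomial.mapRingHom (algebraMap ℂ[X] (RatFunc ℂ))).comp
        (Polynomial.mapRingHom (Polynomial.mapRingHom (Int.castRingHom ℂ)))).comp toBivariate :=
    mvRingHom_ext (by simp) (by simp)
  exact RingHom.congr_fun this F

lemma asPolyInY_eq (F : MvPolynomial (Fin 2) ℤ) : asPolyInY F = asPolyInX (swapXY F) := by
  have : (MvPolynomial.aeval ![Polynomial.C RatFunc.X, Polynomial.X] :
      MvPolynomial (Fin 2) ℤ →ₐ[ℤ] Polynomial (RatFunc ℂ)).toRingHom =
      (MvPolynomial.aeval ![Polynomial.X, Polynomial.C RatFunc.X] :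
      MvPolynomial (Fin 2) ℤ →ₐ[ℤ] Polynomial (RatFunc ℂ)).toRingHom.comp
        (swapXY : MvPolynomial (Fin 2) ℤ →+* _) :=
    mvRingHom_ext (by simp) (by simp)
  exact RingHom.congr_fun this F

/-- The value `F(x, y)`. -/
def evalXY (x y : ℂ) : MvPolynomial (Fin 2) ℤ →+* ℂ :=
  MvPolynomial.eval₂Hom (Int.castRingHom ℂ) ![x, y]

lemma evalXY_swapXY (x y : ℂ) (F : MvPolynomial (Fin 2) ℤ) :
    evalXY x y (swapXY F) = evalXY y x F := by
  have : (evalXY x y).comp (swapXY : MvPolynomial (Fin 2) ℤ →+* _) = evalXY y x :=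
    mvRingHom_ext (by simp [evalXY]) (by simp [evalXY])
  exact RingHom.congr_fun this F

lemma ev_eval_toBivariate {n : ℕ} {i : Σ _ : ℕ, ℕ} (hi : i ∈ cosets n) (τ : ℍ)
    (F : MvPolynomial (Fin 2) ℤ) :
    ConvSeries.ev (rootNome n τ) (norm_rootNome_lt_one (mem_cosets.1 hi).1.2 τ)
        (((toBivariate F).map (intPolyInW n)).eval (cosetSeries n i)) =
      evalXY (cosetFun n i τ) (w τ) F := by
  have : ((ConvSeries.ev (rootNome n τ) (norm_rootNome_lt_one (mem_cosets.1 hi).1.2 τ)).comp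
      ((Polynomial.evalRingHom (cosetSeries n i)).comp
        (Polynomial.mapRingHom (intPolyInW n)))).comp toBivariate =
      evalXY (cosetFun n i τ) (w τ) := by
    refine mvRingHom_ext ?_ ?_
    · simp [evalXY, ev_cosetSeries hi]
    · simp [evalXY, ev_intPolyInW (mem_cosets.1 hi).1.2]
  exact RingHom.congr_fun this F

section

variable {n : ℕ} {F : MvPolynomial (Fin 2) ℤ}

/-- The coset (1, 0) gives F(w(τ/n), w(τ)) = 0; replacing τ by nτ gives F(w(τ), w(nτ)) = 0. -/
lemma swapXY_eval_eq_zero (hn0 : n ≠ 0) (hF : IsCosetPolynomial n (toBivariate F)) :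
    ((toBivariate (swapXY F)).map (intPolyInW n)).eval (cosetSeries n ⟨n, 0⟩) = 0 := by
  refine ConvSeries.ext_of_rootNome hn0 fun τ => ?_
  have hnZ : (0 : ℤ) < n := by exact_mod_cast Nat.pos_of_ne_zero hn0
  have hnC : (n : ℂ) ≠ 0 := by exact_mod_cast hn0
  have h := ev_eval_toBivariate (bot_mem_cosets hn0) (aff n 0 1 τ) F
  rw [hF.eval_eq_zero (bot_mem_cosets hn0), map_zero] at h
  rw [ev_eval_toBivariate (top_mem_cosets hn0), evalXY_swapXY, map_zero, h]
  congr 2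
  · rw [cosetFun]
    congr 1
    rw [coe_aff (by simp) (by simpa using Nat.pos_of_ne_zero hn0), coe_aff hnZ one_pos]
    simp [hnC]
  · rw [cosetFun]
    simp [Nat.div_self (Nat.pos_of_ne_zero hn0)]

/-- F divides its transpose, and the cofactor times its own transpose is 1, so the cofactor is a
constant ±1. The minus sign does occur for n = 1, where F = X - Y. -/
lemma swapXY_eq_or (hn : n.Coprime 6) (hn0 : n ≠ 0) (hF : IsCosetPolynomial n (toBivariate F)) :
    swapXY F = F ∨ swapXY F = -F := by
  obtain ⟨G, hG⟩ := hF.dvd hn hn0 (swapXY_eval_eq_zero hn0 hF)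
  have h1 : swapXY F = F * ofBivariate G := by
    rw [← ofBivariate_toBivariate (swapXY F), hG, map_mul, ofBivariate_toBivariate]
  have hF0 : F ≠ 0 := fun h => (hF.monic hn0).ne_zero (by rw [h, map_zero])
  have h2 : F * (ofBivariate G * swapXY (ofBivariate G)) = F * 1 := by
    rw [← mul_assoc, ← h1, ← map_mul, ← h1, swapXY_swapXY, mul_one]
  have h3 := mul_left_cancel₀ hF0 h2
  obtain ⟨c, hc, hGc⟩ := MvPolynomial.isUnit_iff_eq_C_of_isReduced.1 (IsUnit.of_mul_eq_one _ h3)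
  rcases Int.isUnit_iff.1 hc with rfl | rfl
  · left; rw [h1, hGc]; simp
  · right; rw [h1, hGc]; simp

theorem swapXY_eq (hn : n.Coprime 6) (h1 : 1 < n) (hF : IsCosetPolynomial n (toBivariate F)) :
    swapXY F = F := by
  have hn0 : n ≠ 0 := by omega
  refine (swapXY_eq_or hn hn0 hF).resolve_right fun h => ?_
  -- otherwise `F(X, X) = 0`, so that `X - Y` divides `F`
  have hdiag : (toBivariate F).eval Polynomial.X = 0 := by
    have hc : ((Polynomial.evalRingHom Polynomial.X).comp toBivariate).comp
        (swapXY : MvPolynomial (Fin 2) ℤ →+* _) =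
        (Polynomial.evalRingHom Polynomial.X).comp toBivariate :=
      mvRingHom_ext (by simp) (by simp)
    have h2 := RingHom.congr_fun hc F
    simp only [RingHom.comp_apply, RingHom.coe_coe, h, map_neg, Polynomial.coe_evalRingHom] at h2
    exact neg_eq_self.1 h2
  have hirr := hF.irreducible hn hn0
  have hroot : ((toBivariate F).map (Polynomial.mapRingHom (Int.castRingHom ℂ))).IsRoot
      Polynomial.X := by
    have h2 := Polynomial.eval₂_at_apply (p := toBivariate F)
      (Polynomial.mapRingHom (Int.castRingHom ℂ)) Polynomial.X
    rw [hdiag, map_zero, Polynomial.coe_mapRingHom, Polynomial.map_X] at h2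
    rwa [Polynomial.IsRoot, Polynomial.eval_map]
  obtain ⟨g, hg⟩ := Polynomial.dvd_iff_isRoot.2 hroot
  have hgu := (hirr.isUnit_or_isUnit hg).resolve_left (Polynomial.not_isUnit_X_sub_C _)
  have hdeg : ((toBivariate F).map (Polynomial.mapRingHom (Int.castRingHom ℂ))).natDegree =
      (cosets n).card := by
    rw [(hF.monic hn0).natDegree_map, hF.natDegree_eq hn0]
  rw [hg, Polynomial.natDegree_mul (Polynomial.X_sub_C_ne_zero _) hgu.ne_zero,
    Polynomial.natDegree_X_sub_C, Polynomial.natDegree_eq_zero_of_isUnit hgu] at hdeg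
  exact (one_lt_cosets_card h1).ne hdeg

/-- Gauss's lemma for a monic polynomial over ℂ[Y]. -/
lemma irreducible_asPolyInX (hn : n.Coprime 6) (hn0 : n ≠ 0)
    (hF : IsCosetPolynomial n (toBivariate F)) : Irreducible (asPolyInX F) := by
  rw [asPolyInX_eq]
  exact (((hF.monic hn0).map _).irreducible_iff_irreducible_map_fraction_map).1
    (hF.irreducible hn hn0)

lemma asPolyInX_neg (F : MvPolynomial (Fin 2) ℤ) : asPolyInX (-F) = -asPolyInX F :=
  map_neg (MvPolynomial.aeval (R := ℤ) ![Polynomial.X, Polynomial.C RatFunc.X]) F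

lemma irreducible_asPolyInY (hn : n.Coprime 6) (hn0 : n ≠ 0)
    (hF : IsCosetPolynomial n (toBivariate F)) : Irreducible (asPolyInY F) := by
  have h := irreducible_asPolyInX hn hn0 hF
  rw [asPolyInY_eq]
  rcases swapXY_eq_or hn hn0 hF with h1 | h1
  · rwa [h1]
  · rw [h1, asPolyInX_neg]
    exact (Associated.neg_left (Associated.refl _)).irreducible_iff.2 h

lemma degreeOf_zero_eq (hn0 : n ≠ 0) (hF : IsCosetPolynomial n (toBivariate F)) :
    (F.degreeOf 0 : ℚ) = psi n := by
  rw [← natDegree_toBivariate, hF.natDegree_eq hn0, card_cosets_eq_psi]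

/-- Symmetry up to sign suffices to exchange the degrees, so n = 1 needs no separate treatment. -/
lemma degreeOf_one_eq (hn : n.Coprime 6) (hn0 : n ≠ 0)
    (hF : IsCosetPolynomial n (toBivariate F)) : (F.degreeOf 1 : ℚ) = psi n := by
  rw [← degreeOf_zero_eq hn0 hF]
  have h := MvPolynomial.degreeOf_rename_of_injective (p := F)
    (Equiv.swap (0 : Fin 2) 1).injective 1
  rw [Equiv.swap_apply_right] at h
  rcases swapXY_eq_or hn hn0 hF with h1 | h1
  · rw [← h, h1]
  · rw [← h, h1, MvPolynomial.degreeOf_neg]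

lemma coeff_asPolyInX (F : MvPolynomial (Fin 2) ℤ) (i : ℕ) : (asPolyInX F).coeff i =
    algebraMap ℂ[X] (RatFunc ℂ) (((toBivariate F).coeff i).map (Int.castRingHom ℂ)) := by
  rw [asPolyInX_eq, Polynomial.coeff_map, Polynomial.coeff_map, Polynomial.coe_mapRingHom]

lemma isModularPolynomial_iff {σ : ℤ → Matrix.SpecialLinearGroup (Fin 2) ℤ}
    (hσ : IsDiagonalLift σ) (hn : n.Coprime 6) (hn0 : n ≠ 0)
    (hF : IsCosetPolynomial n (toBivariate F)) (Ψ : Polynomial (RatFunc ℂ)) :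
    IsModularPolynomial σ n Ψ ↔ Ψ = asPolyInX F := by
  have hcoeff : ∀ (i : ℕ) (τ : ℍ), (cosetProduct σ n τ).coeff i =
      (((toBivariate F).coeff i).map (Int.castRingHom ℂ)).eval (w τ) := by
    intro i τ
    rw [cosetProduct_eq hσ hn, ← hF.map_eval₂_eq hn0, Polynomial.coeff_map, Polynomial.eval_map,
      Polynomial.coe_eval₂RingHom]
  constructor
  · intro h
    ext1 i
    rw [coeff_asPolyInX]
    set P := ((toBivariate F).coeff i).map (Int.castRingHom ℂ)
    set r := Ψ.coeff i
    -- The extra factor `r.denom` makes the identity hold also where the denominator vanishes at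
    -- w(τ) and the hypothesis says nothing; it is cancelled afterwards.
    have h1 : r.num * r.denom = P * r.denom * r.denom := by
      refine eq_of_forall_eval_w fun τ => ?_
      rw [Polynomial.eval_mul, Polynomial.eval_mul, Polynomial.eval_mul]
      by_cases h0 : r.denom.eval (w τ) = 0
      · rw [h0, mul_zero, mul_zero]
      · have h2 := h i τ h0
        rw [hcoeff, RatFunc.eval, Polynomial.eval₂_id, Polynomial.eval₂_id, div_eq_iff h0] at h2
        rw [h2]
    have h2 := mul_right_cancel₀ r.denom_ne_zero h1
    have hd : algebraMap ℂ[X] (RatFunc ℂ) r.denom ≠ 0 :=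
      (map_ne_zero_iff _ (RatFunc.algebraMap_injective ℂ)).2 r.denom_ne_zero
    rw [← RatFunc.num_div_denom r, h2, map_mul, mul_div_cancel_right₀ _ hd]
  · rintro rfl i τ -
    rw [hcoeff, coeff_asPolyInX, RatFunc.eval_algebraMap, Polynomial.eval₂_id]
    rfl

end

end

end OrderSix

end

theorem theorem6 (σ : ℤ → Matrix.SpecialLinearGroup (Fin 2) ℤ)
    (hσ : OrderSix.IsDiagonalLift σ) (n : ℕ) (hn : Nat.Coprime n 6) :
    ∃ F : MvPolynomial (Fin 2) ℤ,
      (∀ Ψ : Polynomial (RatFunc ℂ),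
        OrderSix.IsModularPolynomial σ n Ψ ↔ Ψ = OrderSix.asPolyInX F) ∧
      ((F.degreeOf 0 : ℚ) = OrderSix.psi n ∧ (F.degreeOf 1 : ℚ) = OrderSix.psi n) ∧
      (Irreducible (OrderSix.asPolyInX F) ∧ Irreducible (OrderSix.asPolyInY F)) ∧
      (1 < n → MvPolynomial.rename (Equiv.swap (0 : Fin 2) 1) F = F) ∧
      (n.Prime → 5 ≤ n →
        (n : MvPolynomial (Fin 2) ℤ) ∣
          F - (MvPolynomial.X 0 ^ n - MvPolynomial.X 1) *
            (MvPolynomial.X 0 - MvPolynomial.X 1 ^ n)) := by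
  have hn0 : n ≠ 0 := by rintro rfl; norm_num at hn
  obtain ⟨B, hB, hK⟩ := OrderSix.exists_isCosetPolynomial hn hn0
  have hF : OrderSix.IsCosetPolynomial n (OrderSix.toBivariate (OrderSix.ofBivariate B)) := by
    rwa [OrderSix.toBivariate_ofBivariate]
  refine ⟨OrderSix.ofBivariate B, OrderSix.isModularPolynomial_iff hσ hn hn0 hF,
    ⟨OrderSix.degreeOf_zero_eq hn0 hF, OrderSix.degreeOf_one_eq hn hn0 hF⟩,
    ⟨OrderSix.irreducible_asPolyInX hn hn0 hF, OrderSix.irreducible_asPolyInY hn hn0 hF⟩,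
    fun h1 => OrderSix.swapXY_eq hn h1 hF, fun hp _ => ?_⟩
  simpa only [map_sub, map_mul, map_pow, OrderSix.ofBivariate_X, OrderSix.ofBivariate_C_X,
    map_natCast] using map_dvd OrderSix.ofBivariate (hK hp)
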